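/- Let $X$ be a finite-dimensional locally finite simplicial complex and $\mathbb A$ an additive category. Let $\mathbb A^*(X)$ (respectively $\mathbb A_*(X)$) be the category whose objects are families $\{M(\sigma)\}_{\sigma\in X}$ of objects of $\mathbb A$ indexed by the simplices of $X$ and whose morphisms $f:M\to N$ are matrices of morphisms $f_{\tau,\sigma}:M(\sigma)\to N(\tau)$ of $\mathbb A$ with finitely many nonzero entries in each column and with $f_{\tau,\sigma}=0$ unless $\tau\leqslant\sigma$ (respectively $\tau\geqslant\sigma$). Write $\mathbb A(X)$ for either of them, and $\mathbb B(\mathbb A(X))$ for the category of finite chain complexes ($\mathbb Z$-graded, with finitely many nonzero terms) in $\mathbb A(X)$ and chain maps. Let $\{\sigma_i\}$ be a collection of simplices of $X$ with pairwise disjoint open stars (for example a single simplex), and let $X'$ be obtained from $X$ by stellar subdivision at the barycentres $\widehat\sigma_i$, i.e. by replacing each $\sigma_i*\mathrm{link}(\sigma_i,X)$ by $\widehat\sigma_i*\partial\sigma_i*\mathrm{link}(\sigma_i,X)$. Let $r:X'\to X$ be a simplicial approximation to the identity, i.e. the simplicial map that fixes the vertices of $X$ and maps each $\widehat\sigma_i$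 to a chosen vertex $r(\widehat\sigma_i)\in\sigma_i$. Let $\mathcal R_r:\mathbb B(\mathbb A(X'))\to\mathbb B(\mathbb A(X))$ be the assembly functor, $\mathcal R_r(M)(\tau)=\bigoplus_{r(\widetilde\rho)=\tau}M(\widetilde\rho)$, with block matrices as morphisms. The choice of $r$ defines an algebraic subdivision functor $Sd_r:\mathbb B(\mathbb A(X))\to\mathbb B(\mathbb A(X'))$. For $\mathbb A^*$ it is given by $Sd_r(C)(\widetilde\sigma)_n=C(r(\widetilde\sigma))_{n-|\widetilde\sigma|+|r(\widetilde\sigma)|}$, where the component of the differential from $\widetilde\sigma$ to $\widetilde\rho$ in degree $n$ is * $(d_C)_{r(\widetilde\rho),r(\widetilde\sigma)}$ in degree $n-|\widetilde\sigma|+|r(\widetilde\sigma)|$, if $\widetilde\rho\leqslant\widetilde\sigma$ and $|\widetilde\sigma|-|r(\widetilde\sigma)|=|\widetilde\rho|-|r(\widetilde\rho)|$; * $(-1)^n\,\mathrm{id}$, if $\widetilde\sigma=\widetilde\rho*r(\widehat\sigma_i)$ with $\widehat\sigma_i\in\widetilde\rho$ for some $i$; * $(-1)^{n+1}\,\mathrm{id}$,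 if $\widetilde\sigma=\widetilde\rho*\widehat\sigma_i$ with $r(\widehat\sigma_i)\in\widetilde\rho$ for some $i$; * $0$ otherwise; and $Sd_r(f)$ has the components $f_{r(\widetilde\rho),r(\widetilde\sigma)}$ in degree $n-|\widetilde\sigma|+|r(\widetilde\sigma)|$ in the first case and $0$ otherwise. For $\mathbb A_*$ one puts $Sd_r(C)(\widetilde\sigma)_n=C(r(\widetilde\sigma))_{n+|\widetilde\sigma|-|r(\widetilde\sigma)|}$, and the same formulae give the components from $\widetilde\rho$ to $\widetilde\sigma$ (with $(d_C)_{r(\widetilde\sigma),r(\widetilde\rho)}$ and $f_{r(\widetilde\sigma),r(\widetilde\rho)}$ in degree $n+|\widetilde\sigma|-|r(\widetilde\sigma)|$). Then for every $C\in\mathbb B(\mathbb A(X))$ there is a canonical chain equivalence $\mathcal R_rSd_r\,C\simeq C$ in $\mathbb B(\mathbb A(X))$. More precisely: 1. For $\mathbb A^*$, the maps $\mathcal R_rSd_r\,C\to C$ whose component from the summand $Sd_r\,C(\widetilde\rho)_n$ to $C(\tau)_n$ is the identity if $r(\widetilde\rho)=\tau$ and $|\widetilde\rho|=|\tau|$,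 and $0$ otherwise, are chain maps, are natural in $C$, and are chain equivalences in $\mathbb A^*(X)$. 2. For $\mathbb A_*$, the maps $C\to\mathcal R_rSd_r\,C$ whose component from $C(\tau)_n$ to the summand $Sd_r\,C(\widetilde\rho)_n$ is the identity if $r(\widetilde\rho)=\tau$ and $|\widetilde\rho|=|\tau|$, and $0$ otherwise, are chain maps, are natural in $C$, and are chain equivalences in $\mathbb A_*(X)$. Moreover, let $X'$ be an iterated stellar subdivision of $X$, i.e. obtained by finitely many simultaneous subdivisions as above with approximations $r_0,\dots,r_n$, and put $r=r_0\circ\dots\circ r_n$ and $Sd_r=Sd_{r_n}\circ\dots\circ Sd_{r_0}$. Then $\mathcal R_rSd_r\,C\simeq C$ in $\mathbb B(\mathbb A(X))$ for every $C\in\mathbb B(\mathbb A(X))$, by a chain equivalence natural in $C$ (from $\mathcal R_rSd_r\,C$ to $C$ for $\mathbb A^*$, and from $C$ to $\mathcal R_rSd_r\,C$ for $\mathbb A_*$). -/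

import Mathlib

open CategoryTheory CategoryTheory.Limits

universe u v w

noncomputable section

namespace GeomAlg

open scoped Classical

/-- The two kinds of simplicially controlled categories: `upper` stands for the category `𝒜^*(X)`
and `lower` for `𝒜_*(X)`. -/
inductive Kind
  | upper
  | lower

/-- `k.allows τ σ` says that a morphism may have a nonzero entry from `σ` to `τ`:
`τ ≤ σ` for `𝒜^*(X)` and `σ ≤ τ` for `𝒜_*(X)`. -/
def Kind.allows {P : Type*} [PartialOrder P] (k : Kind) (τ σ : P) : Prop :=
  match k with
  | upper => τ ≤ σ
  | lower => σ ≤ τ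

theorem exists_ne_zero_of_sum {ι G : Type*} [AddCommMonoid G] {f : ι → G} (h : ∑ᶠ i, f i ≠ 0) :
    ∃ i, f i ≠ 0 := by
  by_contra h'
  push Not at h'
  exact h (finsum_eq_zero_of_forall_eq_zero h')

section Allows

variable {P : Type*} [PartialOrder P] (k : Kind)

theorem Kind.allows_refl (σ : P) : k.allows σ σ := by
  cases k <;> exact le_refl σ

theorem Kind.allows_trans {ρ τ σ : P} (h : k.allows ρ τ) (h' : k.allows τ σ) : k.allows ρ σ := by
  cases k
  · exact le_trans h h'
  · exact le_trans (α := P) h' h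

end Allows

/-- An object of `𝒜^*(X)` or `𝒜_*(X)`: a collection of objects of `𝒜` indexed by the simplices. -/
structure Controlled (k : Kind) (P : Type u) (𝒜 : Type v) where
  /-- the object over each simplex -/
  obj : P → 𝒜

namespace Controlled

variable {k : Kind} {P : Type u} [PartialOrder P] {𝒜 : Type v} [Category.{w} 𝒜] [Preadditive 𝒜]

/-- A morphism of `𝒜^*(X)` or `𝒜_*(X)`: a matrix with finite columns, `entry τ σ` being the component
from the object over `σ` to the object over `τ`, which is zero unless `k.allows τ σ`. -/
@[ext]
structure Hom (M N : Controlled k P 𝒜) where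
  /-- the matrix entries -/
  entry : ∀ τ σ : P, M.obj σ ⟶ N.obj τ
  finite_column : ∀ σ, {τ | entry τ σ ≠ 0}.Finite
  eq_zero : ∀ τ σ, ¬ k.allows τ σ → entry τ σ = 0

variable {M N L : Controlled k P 𝒜}

theorem compEntry_eq (f : Hom M N) (g : Hom N L) (ρ σ : P) (s : Finset P)
    (hs : ∀ τ, f.entry τ σ ≠ 0 → τ ∈ s) :
    ∑ᶠ τ, f.entry τ σ ≫ g.entry ρ τ = ∑ τ ∈ s, f.entry τ σ ≫ g.entry ρ τ := by
  apply finsum_eq_finsetSum_of_support_subset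
  intro τ hτ
  apply hs
  intro h
  apply hτ
  simp [h]

theorem comp_finite_column (f : Hom M N) (g : Hom N L) (σ : P) :
    {ρ | ∑ᶠ τ, f.entry τ σ ≫ g.entry ρ τ ≠ 0}.Finite := by
  refine ((f.finite_column σ).biUnion fun τ _ => g.finite_column τ).subset ?_
  intro ρ hρ
  obtain ⟨τ, hτ⟩ := exists_ne_zero_of_sum hρ
  simp only [Set.mem_iUnion]
  exact ⟨τ, fun h => by simp [h] at hτ, fun h => by simp [h] at hτ⟩

/-- Composition is matrix multiplication. -/
def Hom.comp (f : Hom M N) (g : Hom N L) : Hom M L where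
  entry ρ σ := ∑ᶠ τ, f.entry τ σ ≫ g.entry ρ τ
  finite_column := comp_finite_column f g
  eq_zero ρ σ h := by
    apply finsum_eq_zero_of_forall_eq_zero
    intro τ
    by_cases h1 : k.allows τ σ
    · by_cases h2 : k.allows ρ τ
      · exact absurd (k.allows_trans h2 h1) h
      · simp [g.eq_zero _ _ h2]
    · simp [f.eq_zero _ _ h1]

/-- The identity matrix. -/
def Hom.id (M : Controlled k P 𝒜) : Hom M M where
  entry τ σ := if h : σ = τ then eqToHom (by rw [h]) else 0
  finite_column σ := (Set.finite_singleton σ).subset fun τ hτ => by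
    by_contra h
    exact hτ (dif_neg fun h' => h h'.symm)
  eq_zero τ σ h := dif_neg fun h' => by
    subst h'
    exact h (k.allows_refl σ)

instance : Category (Controlled k P 𝒜) where
  Hom := Hom
  id := Hom.id
  comp := Hom.comp
  id_comp {M N} f := by
    ext τ σ
    change ∑ᶠ μ, (Hom.id M).entry μ σ ≫ f.entry τ μ = f.entry τ σ
    rw [finsum_eq_single _ σ]
    · simp [Hom.id]
    · intro μ hμ
      simp [Hom.id, hμ.symm]
  comp_id {M N} f := by
    ext τ σ
    change ∑ᶠ μ, f.entry μ σ ≫ (Hom.id N).entry τ μ = f.entry τ σ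
    rw [finsum_eq_single _ τ]
    · simp [Hom.id]
    · intro μ hμ
      simp [Hom.id, hμ]
  assoc {M N L K} f g h := by
    ext ρ σ
    change ∑ᶠ τ, (∑ᶠ μ, f.entry μ σ ≫ g.entry τ μ) ≫ h.entry ρ τ
      = ∑ᶠ μ, f.entry μ σ ≫ ∑ᶠ τ, g.entry τ μ ≫ h.entry ρ τ
    let s := (f.finite_column σ).toFinset
    let t := s.biUnion fun μ => (g.finite_column μ).toFinset
    have hs : ∀ μ, f.entry μ σ ≠ 0 → μ ∈ s := fun μ hμ => by simpa [s] using hμ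
    have ht : ∀ μ ∈ s, ∀ τ, g.entry τ μ ≠ 0 → τ ∈ t := fun μ hμ τ hτ =>
      Finset.mem_biUnion.2 ⟨μ, hμ, by simpa using hτ⟩
    have e1 := compEntry_eq f (Hom.comp g h) ρ σ s hs
    have e2 := compEntry_eq (Hom.comp f g) h ρ σ t (by
      intro τ hτ
      obtain ⟨μ, hμ⟩ := exists_ne_zero_of_sum hτ
      refine ht μ (hs μ ?_) τ ?_
      · intro h; simp [h] at hμ
      · intro h; simp [h] at hμ)
    refine e2.trans (Eq.trans ?_ e1.symm)
    have e3 : ∀ τ ∈ t, (Hom.comp f g).entry τ σ ≫ h.entry ρ τ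
        = ∑ μ ∈ s, f.entry μ σ ≫ g.entry τ μ ≫ h.entry ρ τ := by
      intro τ _
      change (∑ᶠ μ, f.entry μ σ ≫ g.entry τ μ) ≫ h.entry ρ τ = _
      rw [compEntry_eq f g τ σ s hs, Preadditive.sum_comp]
      simp
    have e4 : ∀ μ ∈ s, f.entry μ σ ≫ (Hom.comp g h).entry ρ μ
        = ∑ τ ∈ t, f.entry μ σ ≫ g.entry τ μ ≫ h.entry ρ τ := by
      intro μ hμ
      change f.entry μ σ ≫ (∑ᶠ τ, g.entry τ μ ≫ h.entry ρ τ) = _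
      rw [compEntry_eq g h ρ μ t (ht μ hμ), Preadditive.comp_sum]
    rw [Finset.sum_congr rfl e3, Finset.sum_congr rfl e4, Finset.sum_comm]

/-- The entry of a morphism from `σ` to `τ`. -/
def entry (f : M ⟶ N) (τ σ : P) : M.obj σ ⟶ N.obj τ := Hom.entry f τ σ

theorem finite_column (f : M ⟶ N) (σ : P) : {τ | entry f τ σ ≠ 0}.Finite := Hom.finite_column f σ

theorem entry_eq_zero (f : M ⟶ N) {τ σ : P} (h : ¬ k.allows τ σ) : entry f τ σ = 0 :=
  Hom.eq_zero f τ σ h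

theorem hom_ext {f g : M ⟶ N} (h : ∀ τ σ, entry f τ σ = entry g τ σ) : f = g :=
  Hom.ext (funext fun τ => funext fun σ => h τ σ)

theorem entry_comp (f : M ⟶ N) (g : N ⟶ L) (ρ σ : P) :
    entry (f ≫ g) ρ σ = ∑ᶠ τ, entry f τ σ ≫ entry g ρ τ := rfl

theorem entry_id (M : Controlled k P 𝒜) (τ σ : P) :
    entry (𝟙 M) τ σ = if h : σ = τ then eqToHom (by rw [h]) else 0 := rfl

instance : Zero (M ⟶ N) := ⟨⟨fun _ _ => 0, by simp, fun _ _ _ => rfl⟩⟩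

instance : Add (M ⟶ N) := ⟨fun f g => ⟨fun τ σ => entry f τ σ + entry g τ σ, fun σ =>
  ((finite_column f σ).union (finite_column g σ)).subset fun τ hτ => by
    by_contra h
    have h : entry f τ σ = 0 ∧ entry g τ σ = 0 := by
      simpa [not_or] using h
    exact hτ (by rw [h.1, h.2, add_zero]), fun τ σ h => by
    rw [entry_eq_zero f h, entry_eq_zero g h, add_zero]⟩⟩

instance : Neg (M ⟶ N) := ⟨fun f => ⟨fun τ σ => - entry f τ σ, fun σ =>
  (finite_column f σ).subset fun τ hτ h => hτ (by rw [h, neg_zero]), fun τ σ h => by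
    rw [entry_eq_zero f h, neg_zero]⟩⟩

theorem entry_zero (τ σ : P) : entry (0 : M ⟶ N) τ σ = 0 := rfl

theorem entry_add (f g : M ⟶ N) (τ σ : P) : entry (f + g) τ σ = entry f τ σ + entry g τ σ := rfl

theorem entry_neg (f : M ⟶ N) (τ σ : P) : entry (-f) τ σ = - entry f τ σ := rfl

/-- Morphisms are added entrywise. -/
instance : AddCommGroup (M ⟶ N) where
  add_assoc f g h := hom_ext fun τ σ => by simp only [entry_add, add_assoc]
  zero_add f := hom_ext fun τ σ => by simp only [entry_add, entry_zero, zero_add]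
  add_zero f := hom_ext fun τ σ => by simp only [entry_add, entry_zero, add_zero]
  nsmul := nsmulRec
  zsmul := zsmulRec
  neg_add_cancel f := hom_ext fun τ σ => by
    simp only [entry_add, entry_neg, entry_zero, neg_add_cancel]
  add_comm f g := hom_ext fun τ σ => by simp only [entry_add, add_comm]

/-- The entry at a given place as a homomorphism of groups. -/
def entryHom (τ σ : P) : (M ⟶ N) →+ (M.obj σ ⟶ N.obj τ) where
  toFun f := entry f τ σ
  map_zero' := rfl
  map_add' _ _ := rfl

theorem entry_sub (f g : M ⟶ N) (τ σ : P) : entry (f - g) τ σ = entry f τ σ - entry g τ σ :=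
  map_sub (entryHom τ σ) f g

theorem entry_units_smul (a : ℤˣ) (f : M ⟶ N) (τ σ : P) :
    entry (a • f) τ σ = a • entry f τ σ :=
  map_zsmul (entryHom τ σ) (a : ℤ) f

theorem finite_support_comp (f : M ⟶ N) (g : N ⟶ L) (ρ σ : P) :
    (Function.support fun τ => entry f τ σ ≫ entry g ρ τ).Finite :=
  (finite_column f σ).subset fun τ hτ h => hτ (by
    change entry f τ σ ≫ entry g ρ τ = 0
    rw [show entry f τ σ = 0 from h, zero_comp])

instance : Preadditive (Controlled k P 𝒜) where
  homGroup _ _ := inferInstance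
  add_comp _ _ _ f f' g := hom_ext fun ρ σ => by
    simp only [entry_comp, entry_add, Preadditive.add_comp]
    exact finsum_add_distrib (finite_support_comp f g ρ σ) (finite_support_comp f' g ρ σ)
  comp_add _ _ _ f g g' := hom_ext fun ρ σ => by
    simp only [entry_comp, entry_add, Preadditive.comp_add]
    exact finsum_add_distrib (finite_support_comp f g ρ σ) (finite_support_comp f g' ρ σ)

end Controlled

namespace Controlled

variable {k : Kind} {P : Type u} [PartialOrder P] {𝒜 : Type v} [Category.{w} 𝒜] [Preadditive 𝒜]

theorem isZero_iff (M : Controlled k P 𝒜) : IsZero M ↔ ∀ σ, IsZero (M.obj σ) := by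
  constructor
  · intro h σ
    rw [IsZero.iff_id_eq_zero] at h ⊢
    have := congrArg (fun f => entry f σ σ) h
    simpa [entry_id, entry_zero] using this
  · intro h
    rw [IsZero.iff_id_eq_zero]
    exact hom_ext fun τ σ => (h σ).eq_of_src _ _

end Controlled

section Assembly

variable (k : Kind) {P Q : Type u} [PartialOrder P] [PartialOrder Q]
  (𝒜 : Type v) [Category.{w} 𝒜] [Preadditive 𝒜] [HasFiniteBiproducts 𝒜]

theorem Kind.allows_map {k : Kind} (p : Q →o P) {τ σ : Q} (h : k.allows τ σ) :
    k.allows (p τ) (p σ) := by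
  cases k <;> exact p.monotone h

/-- The set of simplices lying over `τ`. -/
abbrev Fibre (p : Q →o P) (τ : P) : Type u := {ρ : Q // p ρ = τ}

variable {k 𝒜} (p : Q →o P) [∀ τ, Finite (Fibre p τ)]

/-- The assembly of an object: the object over `τ` is the direct sum of the objects over all the
`ρ` that `p` maps to `τ`. -/
def assembleObj (M : Controlled k Q 𝒜) : Controlled k P 𝒜 where
  obj τ := ⨁ fun ρ : Fibre p τ => M.obj ρ.1

variable {M N L : Controlled k Q 𝒜}

/-- The inclusion of a summand. -/
def assembleι (M : Controlled k Q 𝒜) {τ : P} (ρ : Fibre p τ) :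
    M.obj ρ.1 ⟶ (assembleObj p M).obj τ :=
  biproduct.ι (fun ρ : Fibre p τ => M.obj ρ.1) ρ

/-- The projection to a summand. -/
def assembleπ (M : Controlled k Q 𝒜) {τ : P} (ρ : Fibre p τ) :
    (assembleObj p M).obj τ ⟶ M.obj ρ.1 :=
  biproduct.π (fun ρ : Fibre p τ => M.obj ρ.1) ρ

/-- The block matrix with the given entries. -/
def assembleBlock {τ σ : P} (f : ∀ (ρ : Fibre p τ) (μ : Fibre p σ), M.obj μ.1 ⟶ N.obj ρ.1) :
    (assembleObj p M).obj σ ⟶ (assembleObj p N).obj τ :=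
  biproduct.desc (f := fun μ : Fibre p σ => M.obj μ.1) fun μ =>
    biproduct.lift (f := fun ρ : Fibre p τ => N.obj ρ.1) fun ρ => f ρ μ

theorem assembleι_block_π {τ σ : P} (f : ∀ (ρ : Fibre p τ) (μ : Fibre p σ), M.obj μ.1 ⟶ N.obj ρ.1)
    (ρ : Fibre p τ) (μ : Fibre p σ) :
    assembleι p M μ ≫ assembleBlock p f ≫ assembleπ p N ρ = f ρ μ := by
  unfold assembleι assembleBlock assembleπ
  erw [biproduct.ι_desc_assoc, biproduct.lift_π]

theorem assemble_obj_ext {τ σ : P} {f g : (assembleObj p M).obj σ ⟶ (assembleObj p N).obj τ}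
    (h : ∀ (ρ : Fibre p τ) (μ : Fibre p σ),
      assembleι p M μ ≫ f ≫ assembleπ p N ρ = assembleι p M μ ≫ g ≫ assembleπ p N ρ) : f = g := by
  refine biproduct.hom_ext' _ _ fun μ => biproduct.hom_ext _ _ fun ρ => ?_
  exact (Category.assoc _ _ _).trans ((h ρ μ).trans (Category.assoc _ _ _).symm)

theorem assembleι_π_self (M : Controlled k Q 𝒜) {τ : P} (ρ : Fibre p τ) :
    assembleι p M ρ ≫ assembleπ p M ρ = 𝟙 _ :=
  biproduct.ι_π_self (fun ρ : Fibre p τ => M.obj ρ.1) ρ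

theorem assembleι_π_ne (M : Controlled k Q 𝒜) {τ : P} {μ ρ : Fibre p τ} (h : μ ≠ ρ) :
    assembleι p M μ ≫ assembleπ p M ρ = 0 :=
  biproduct.ι_π_ne (fun ρ : Fibre p τ => M.obj ρ.1) h

theorem assemble_total (M : Controlled k Q 𝒜) (τ : P) [Fintype (Fibre p τ)] :
    𝟙 ((assembleObj p M).obj τ) = ∑ ρ : Fibre p τ, assembleπ p M ρ ≫ assembleι p M ρ := by
  refine assemble_obj_ext p fun ρ μ => ?_
  rw [Preadditive.sum_comp, Preadditive.comp_sum, Finset.sum_eq_single μ]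
  · rw [Category.id_comp, Category.assoc, ← Category.assoc, assembleι_π_self, Category.id_comp]
  · intro ν _ hν
    rw [Category.assoc, ← Category.assoc, assembleι_π_ne p M hν.symm, zero_comp]
  · intro h
    exact absurd (Finset.mem_univ _) h

/-- The assembly of a morphism: its entries are the block matrices. -/
def assembleMap (f : M ⟶ N) : assembleObj p M ⟶ assembleObj p N where
  entry τ σ := assembleBlock p fun (ρ : Fibre p τ) (μ : Fibre p σ) =>
    Controlled.entry f ρ.1 μ.1
  finite_column σ := by
    refine (Set.finite_iUnion fun μ : Fibre p σ =>
      (Controlled.finite_column f μ.1).image p).subset ?_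
    intro τ hτ
    by_contra h
    refine hτ (assemble_obj_ext p fun ρ μ => ?_)
    rw [assembleι_block_π, zero_comp, comp_zero]
    by_contra h'
    exact h (Set.mem_iUnion.2 ⟨μ, ρ.1, h', ρ.2⟩)
  eq_zero τ σ h := by
    refine assemble_obj_ext p fun ρ μ => ?_
    rw [assembleι_block_π, zero_comp, comp_zero]
    apply Controlled.entry_eq_zero
    intro h'
    have := Kind.allows_map p h'
    rw [μ.2, ρ.2] at this
    exact h this

theorem assembleMap_ι_π (f : M ⟶ N) {τ σ : P} (ρ : Fibre p τ) (μ : Fibre p σ) :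
    assembleι p M μ ≫ Controlled.entry (assembleMap p f) τ σ ≫ assembleπ p N ρ
      = Controlled.entry f ρ.1 μ.1 :=
  assembleι_block_π p _ ρ μ

theorem assembleMap_comp (f : M ⟶ N) (g : N ⟶ L) :
    assembleMap p (f ≫ g) = assembleMap p f ≫ assembleMap p g := by
  refine Controlled.hom_ext fun ρ σ => assemble_obj_ext p fun ξ μ => ?_
  rw [assembleMap_ι_π]
  let s := (Controlled.finite_column f μ.1).toFinset
  let t := (Controlled.finite_column (assembleMap p f) σ).toFinset ∪ s.image p
  have e1 : Controlled.entry (f ≫ g) ξ.1 μ.1 = _ :=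
    Controlled.compEntry_eq f g ξ.1 μ.1 s (fun τ hτ => (Set.Finite.mem_toFinset _).2 hτ)
  have e2 : Controlled.entry (assembleMap p f ≫ assembleMap p g) ρ σ = _ :=
    Controlled.compEntry_eq (assembleMap p f) (assembleMap p g) ρ σ t (fun τ hτ => by
      exact Finset.mem_union_left _ ((Set.Finite.mem_toFinset _).2 hτ))
  rw [e1, e2, Preadditive.sum_comp, Preadditive.comp_sum]
  rw [← Finset.sum_fiberwise_of_maps_to (s := s) (t := t) (g := p)
    (fun x hx => Finset.mem_union_right _ (Finset.mem_image_of_mem p hx))]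
  refine Finset.sum_congr rfl fun τ _ => ?_
  have := Fintype.ofFinite (Fibre p τ)
  have e3 : assembleι p M μ ≫
      (Controlled.entry (assembleMap p f) τ σ ≫ Controlled.entry (assembleMap p g) ρ τ) ≫
        assembleπ p L ξ =
      ∑ ν : Fibre p τ, Controlled.entry f ν.1 μ.1 ≫ Controlled.entry g ξ.1 ν.1 := by
    rw [← Category.id_comp (Controlled.entry (assembleMap p g) ρ τ), assemble_total p N τ]
    simp only [Preadditive.sum_comp, Preadditive.comp_sum]
    refine Finset.sum_congr rfl fun ν _ => ?_
    rw [← assembleMap_ι_π p f ν μ, ← assembleMap_ι_π p g ξ ν]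
    simp only [Category.assoc]
  refine Eq.trans ?_ e3.symm
  let F : Q → (M.obj μ.1 ⟶ L.obj ξ.1) := fun ν =>
    Controlled.entry f ν μ.1 ≫ Controlled.entry g ξ.1 ν
  change ∑ ν ∈ s with p ν = τ, F ν = ∑ ν : Fibre p τ, F ν.1
  rw [← Finset.sum_subtype_of_mem (p := fun ν => p ν = τ) F
    (fun x hx => (Finset.mem_filter.1 hx).2)]
  refine Finset.sum_subset (Finset.subset_univ _) fun ν _ hν => ?_
  have : Controlled.entry f ν.1 μ.1 = 0 := by
    by_contra h
    exact hν (by simp [s, h, ν.2])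
  change Controlled.entry f ν.1 μ.1 ≫ _ = 0
  rw [this, zero_comp]

theorem assembleMap_id (M : Controlled k Q 𝒜) :
    assembleMap p (𝟙 M) = 𝟙 (assembleObj p M) := by
  refine Controlled.hom_ext fun τ σ => assemble_obj_ext p fun ρ μ => ?_
  rw [assembleMap_ι_π, Controlled.entry_id, Controlled.entry_id]
  by_cases h : σ = τ
  · subst h
    rw [dif_pos rfl, eqToHom_refl, Category.id_comp]
    by_cases h' : μ = ρ
    · subst h'
      rw [dif_pos rfl, eqToHom_refl]
      exact (assembleι_π_self p M _).symm
    · rw [dif_neg (fun h'' => h' (Subtype.ext h''))]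
      exact (assembleι_π_ne p M h').symm
  · rw [dif_neg h, dif_neg, zero_comp, comp_zero]
    intro h'
    exact h (by rw [← μ.2, ← ρ.2, h'])

variable (k 𝒜)

/-- The assembly functor of an order preserving map with finite fibres. -/
def assemble : Controlled k Q 𝒜 ⥤ Controlled k P 𝒜 where
  obj M := assembleObj p M
  map f := assembleMap p f
  map_id M := assembleMap_id p M
  map_comp f g := assembleMap_comp p f g

instance : (assemble k 𝒜 p).Additive where
  map_add {M N f g} := by
    refine Controlled.hom_ext fun τ σ => assemble_obj_ext p fun ρ μ => ?_
    change assembleι p M μ ≫ Controlled.entry (assembleMap p (f + g)) τ σ ≫ _ = assembleι p M μ ≫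
      (Controlled.entry (assembleMap p f) τ σ + Controlled.entry (assembleMap p g) τ σ) ≫ _
    rw [Preadditive.add_comp, Preadditive.comp_add, assembleMap_ι_π, assembleMap_ι_π,
      assembleMap_ι_π, Controlled.entry_add]

end Assembly

section Complexes

/-- A chain complex is finite if only finitely many of its terms are nonzero. -/
def IsFiniteComplex (𝒞 : Type u) [Category.{v} 𝒞] [Preadditive 𝒞] :
    ObjectProperty (ChainComplex 𝒞 ℤ) :=
  fun C => {i | ¬ IsZero (C.X i)}.Finite

/-- The category `𝔹(𝒞)` of finite chain complexes in `𝒞` and chain maps. -/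
abbrev FinComplex (𝒞 : Type u) [Category.{v} 𝒞] [Preadditive 𝒞] :=
  (IsFiniteComplex 𝒞).FullSubcategory

/-- A morphism of `𝔹(𝒞)` is a chain equivalence if it has a chain homotopy inverse. -/
def IsChainEquiv {𝒞 : Type u} [Category.{v} 𝒞] [Preadditive 𝒞] {C D : FinComplex 𝒞}
    (f : C ⟶ D) : Prop :=
  ∃ e : HomotopyEquiv C.obj D.obj, e.hom = f.hom

variable {𝒞 : Type u} [Category.{v} 𝒞] [Preadditive 𝒞] {𝒟 : Type*} [Category* 𝒟] [Preadditive 𝒟]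

/-- The functor induced by an additive functor on finite chain complexes. -/
def mapFinComplex (F : 𝒞 ⥤ 𝒟) [F.Additive] : FinComplex 𝒞 ⥤ FinComplex 𝒟 :=
  (IsFiniteComplex 𝒟).lift ((IsFiniteComplex 𝒞).ι ⋙ F.mapHomologicalComplex _) fun C =>
    C.property.subset fun _ hi h => hi (F.map_isZero h)

end Complexes

section Simplicial

/-- A finite-dimensional locally finite simplicial complex. -/
structure FLComplex where
  /-- the vertices of the complex are elements of this type -/
  V : Type u
  /-- the underlying abstract simplicial complex -/
  K : PreAbstractSimplicialComplex V
  locallyFinite : ∀ x : V, {s | s ∈ K.faces ∧ x ∈ s}.Finite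
  finiteDimensional : ∃ N : ℕ, ∀ s ∈ K.faces, s.card ≤ N

namespace FLComplex

/-- The simplices of `X`, ordered by the face relation. -/
abbrev Simplex (X : FLComplex.{u}) : Type u := {s : Finset X.V // s ∈ X.K.faces}

/-- The dimension of a simplex. -/
def dim {X : FLComplex.{u}} (σ : X.Simplex) : ℤ := (σ.1.card : ℤ) - 1

/-- The open star of `σ`, as the set of those simplices whose interiors it consists of. -/
def openStar {X : FLComplex.{u}} (σ : X.Simplex) : Set X.Simplex := {τ | σ ≤ τ}

theorem nonempty {X : FLComplex.{u}} {s : Finset X.V} (h : s ∈ X.K.faces) : s.Nonempty :=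
  (X.K.isRelLowerSet_faces h).1

theorem face_of_subset {X : FLComplex.{u}} {s t : Finset X.V} (h : s ∈ X.K.faces) (hts : t ⊆ s)
    (ht : t.Nonempty) : t ∈ X.K.faces :=
  (X.K.isRelLowerSet_faces h).2 hts ht

theorem finite_faces (X : FLComplex.{u}) (σ : X.Simplex) : {τ : X.Simplex | τ ≤ σ}.Finite := by
  refine Set.Finite.of_finite_image (f := Subtype.val)
    ((σ.1.powerset.finite_toSet).subset ?_) Subtype.val_injective.injOn
  rintro _ ⟨τ, hτ, rfl⟩
  exact Finset.mem_coe.2 (Finset.mem_powerset.2 hτ)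

theorem finite_cofaces (X : FLComplex.{u}) (σ : X.Simplex) : {τ : X.Simplex | σ ≤ τ}.Finite := by
  obtain ⟨x, hx⟩ := nonempty σ.2
  refine Set.Finite.of_finite_image (f := Subtype.val)
    ((X.locallyFinite x).subset ?_) Subtype.val_injective.injOn
  rintro _ ⟨τ, hτ, rfl⟩
  exact ⟨τ.2, hτ hx⟩

theorem finite_allows (X : FLComplex.{u}) (k : Kind) (σ : X.Simplex) :
    {τ : X.Simplex | k.allows τ σ}.Finite := by
  cases k
  · exact X.finite_faces σ
  · exact X.finite_cofaces σ

end FLComplex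

/-- A simplicial map with finite fibres. -/
structure FiniteMap (Y X : FLComplex.{u}) where
  /-- the map of vertices -/
  toFun : Y.V → X.V
  map_face : ∀ s ∈ Y.K.faces, s.image toFun ∈ X.K.faces
  finite_fibre : ∀ τ : Finset X.V, {ρ : Y.Simplex | ρ.1.image toFun = τ}.Finite

namespace FiniteMap

/-- The induced map of simplices; it maps the interior of `ρ` into that of its image. -/
def onSimplex {Y X : FLComplex.{u}} (r : FiniteMap Y X) : Y.Simplex →o X.Simplex where
  toFun ρ := ⟨ρ.1.image r.toFun, r.map_face _ ρ.2⟩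
  monotone' _ _ h := Finset.image_subset_image h

instance {Y X : FLComplex.{u}} (r : FiniteMap Y X) (τ : X.Simplex) :
    Finite (Fibre r.onSimplex τ) :=
  ((r.finite_fibre τ.1).subset (t := {ρ | r.onSimplex ρ = τ})
    fun _ h => congrArg Subtype.val h).to_subtype

/-- The identity map. -/
def id (X : FLComplex.{u}) : FiniteMap X X where
  toFun x := x
  map_face s hs := by rwa [Finset.image_id']
  finite_fibre τ := by
    refine Set.Finite.of_finite_image (f := Subtype.val)
      ((Set.finite_singleton τ).subset ?_) Subtype.val_injective.injOn
    rintro _ ⟨ρ, hρ, rfl⟩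
    exact (Finset.image_id'.symm.trans hρ :)

/-- Composition of maps. -/
def comp {Z Y X : FLComplex.{u}} (r : FiniteMap Y X) (q : FiniteMap Z Y) : FiniteMap Z X where
  toFun x := r.toFun (q.toFun x)
  map_face s hs := by
    have := r.map_face _ (q.map_face s hs)
    rwa [Finset.image_image] at this
  finite_fibre τ := by
    refine ((r.finite_fibre τ).biUnion fun ρ _ => q.finite_fibre ρ.1).subset ?_
    intro ξ hξ
    refine Set.mem_biUnion (x := q.onSimplex ξ) ?_ rfl
    exact Finset.image_image.trans hξ

end FiniteMap

/-- The category `𝒜^*(X)` (for `k = upper`) or `𝒜_*(X)` (for `k = lower`). -/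
abbrev Ctrl (k : Kind) (X : FLComplex.{u}) (𝒜 : Type v) := Controlled k X.Simplex 𝒜

/-- The assembly functor `R_r` on finite chain complexes. -/
def assembly (k : Kind) {Y X : FLComplex.{u}} (r : FiniteMap Y X) (𝒜 : Type v) [Category.{w} 𝒜]
    [Preadditive 𝒜] [HasFiniteBiproducts 𝒜] :
    FinComplex (Ctrl k Y 𝒜) ⥤ FinComplex (Ctrl k X 𝒜) :=
  mapFinComplex (assemble k 𝒜 r.onSimplex)

/-- A collection of simplices with pairwise disjoint open stars. -/
structure Centres (X : FLComplex.{u}) where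
  /-- the simplices -/
  carrier : Set X.Simplex
  disjoint : carrier.PairwiseDisjoint FLComplex.openStar

namespace Centres

/-- The collection consisting of one simplex, which gives a single stellar subdivision. -/
def single {X : FLComplex.{u}} (σ : X.Simplex) : Centres X :=
  ⟨{σ}, Set.pairwiseDisjoint_singleton σ _⟩

variable {X : FLComplex.{u}} (S : Centres X)

/-- The simplices of the simultaneous stellar subdivision at the barycentres `σ̂` of the simplices
`σ` of `S`. The vertex `Sum.inr σ` is `σ̂`. The faces are the simplices of `X` that contain no
`σ ∈ S`, and the simplices `σ̂ * ρ` with `ρ` in `∂σ * link(σ, X)`, where `ρ` may be empty. A set of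
vertices `ρ` is of the latter kind if and only if `ρ ∪ σ` is a simplex and `ρ` does not
contain `σ`. -/
def IsFace (t : Finset (X.V ⊕ S.carrier)) : Prop :=
  (∃ τ ∈ X.K.faces, (∀ σ : S.carrier, ¬ σ.1.1 ⊆ τ) ∧ t = τ.image Sum.inl) ∨
  (∃ (σ : S.carrier) (ρ : Finset X.V), ρ ∪ σ.1.1 ∈ X.K.faces ∧ ¬ σ.1.1 ⊆ ρ ∧
    t = insert (Sum.inr σ) (ρ.image Sum.inl))

variable {S}

theorem IsFace.nonempty {t : Finset (X.V ⊕ S.carrier)} (h : S.IsFace t) : t.Nonempty := by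
  obtain ⟨τ, h1, -, rfl⟩ | ⟨σ, ρ, -, -, rfl⟩ := h
  · exact (FLComplex.nonempty h1).image _
  · exact Finset.insert_nonempty _ _

theorem eq_of_subset {σ σ' : S.carrier} {τ : Finset X.V} (hτ : τ ∈ X.K.faces) (h : σ.1.1 ⊆ τ)
    (h' : σ'.1.1 ⊆ τ) : σ = σ' := by
  by_contra hne
  have hd := S.disjoint σ.2 σ'.2 (fun e => hne (Subtype.ext e))
  exact Set.disjoint_left.1 hd (show (⟨τ, hτ⟩ : X.Simplex) ∈ FLComplex.openStar σ.1 from h)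
    (show (⟨τ, hτ⟩ : X.Simplex) ∈ FLComplex.openStar σ'.1 from h')

theorem exists_image_inl (t : Finset (X.V ⊕ S.carrier)) (h : ∀ x ∈ t, ∃ v, x = Sum.inl v) :
    ∃ τ : Finset X.V, t = τ.image Sum.inl := by
  refine ⟨t.preimage Sum.inl Sum.inl_injective.injOn, ?_⟩
  ext x
  simp only [Finset.mem_image, Finset.mem_preimage]
  constructor
  · intro hx
    obtain ⟨v, rfl⟩ := h x hx
    exact ⟨v, hx, rfl⟩
  · rintro ⟨v, hv, rfl⟩
    exact hv

theorem IsFace.mono {s t : Finset (X.V ⊕ S.carrier)} (h : S.IsFace s) (hts : t ⊆ s)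
    (ht : t.Nonempty) : S.IsFace t := by
  obtain ⟨τ, h1, h2, rfl⟩ | ⟨σ, ρ, h1, h2, rfl⟩ := h
  · obtain ⟨τ', rfl⟩ := exists_image_inl t fun x hx => by
      obtain ⟨v, -, hv⟩ := Finset.mem_image.1 (hts hx)
      exact ⟨v, hv.symm⟩
    have hs : τ' ⊆ τ := (Finset.image_subset_image_iff Sum.inl_injective).1 hts
    exact Or.inl ⟨τ', FLComplex.face_of_subset h1 hs (Finset.image_nonempty.1 ht),
      fun σ hσ => h2 σ (hσ.trans hs), rfl⟩
  · by_cases hc : Sum.inr σ ∈ t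
    · obtain ⟨ρ', hρ'⟩ := exists_image_inl (t.erase (Sum.inr σ)) fun x hx => by
        have hx' := Finset.mem_of_mem_insert_of_ne (hts (Finset.mem_of_mem_erase hx))
          (Finset.ne_of_mem_erase hx)
        obtain ⟨v, -, hv⟩ := Finset.mem_image.1 hx'
        exact ⟨v, hv.symm⟩
      have hs : ρ' ⊆ ρ := by
        intro x hx
        have h3 : (Sum.inl x : X.V ⊕ S.carrier) ∈ t.erase (Sum.inr σ) := by
          rw [hρ']
          exact Finset.mem_image_of_mem _ hx
        have := hts (Finset.mem_of_mem_erase h3)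
        simpa using this
      refine Or.inr ⟨σ, ρ', FLComplex.face_of_subset h1 (Finset.union_subset_union_left hs)
        ((FLComplex.nonempty σ.1.2).mono Finset.subset_union_right),
        fun h3 => h2 (h3.trans hs), ?_⟩
      rw [← hρ', Finset.insert_erase hc]
    · obtain ⟨τ', rfl⟩ := exists_image_inl t fun x hx => by
        obtain rfl | hx' := Finset.mem_insert.1 (hts hx)
        · exact absurd hx hc
        · obtain ⟨v, -, hv⟩ := Finset.mem_image.1 hx'
          exact ⟨v, hv.symm⟩
      have hs : τ' ⊆ ρ := by
        intro x hx
        have := hts (Finset.mem_image_of_mem Sum.inl hx)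
        simpa using this
      have ht' : τ'.Nonempty := Finset.image_nonempty.1 ht
      refine Or.inl ⟨τ', FLComplex.face_of_subset h1 (hs.trans Finset.subset_union_left) ht',
        fun σ' hσ' => ?_, rfl⟩
      have e : σ' = σ := eq_of_subset h1 ((hσ'.trans hs).trans Finset.subset_union_left)
        Finset.subset_union_right
      subst e
      exact h2 (hσ'.trans hs)

theorem finite_inl (x : X.V) : {t | S.IsFace t ∧ Sum.inl x ∈ t}.Finite := by
  let A : Set (Finset X.V) := {s | s ∈ X.K.faces ∧ x ∈ s}
  have hA : A.Finite := X.locallyFinite x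
  let B : Set (Finset X.V) := ⋃ s ∈ A, (s.powerset : Set (Finset X.V))
  have hB : B.Finite := hA.biUnion fun s _ => s.powerset.finite_toSet
  let C : Set S.carrier := {σ | σ.1.1 ∈ B}
  have hC : C.Finite := by
    refine Set.Finite.of_finite_image (f := fun σ : S.carrier => σ.1.1) (hB.subset ?_)
      (fun a _ b _ h => Subtype.ext (Subtype.ext h))
    rintro _ ⟨σ, hσ, rfl⟩
    exact hσ
  refine ((hA.image fun τ => τ.image Sum.inl).union
    ((hC.prod hB).image fun q => insert (Sum.inr q.1) (q.2.image Sum.inl))).subset ?_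
  rintro t ⟨⟨τ, h1, -, rfl⟩ | ⟨σ, ρ, h1, -, rfl⟩, hx⟩
  · left
    exact ⟨τ, ⟨h1, by simpa using hx⟩, rfl⟩
  · right
    have hx' : x ∈ ρ := by simpa using hx
    have hm : ρ ∪ σ.1.1 ∈ A := ⟨h1, Finset.mem_union_left _ hx'⟩
    refine ⟨(σ, ρ), ⟨?_, ?_⟩, rfl⟩
    · exact Set.mem_biUnion hm (Finset.mem_coe.2 (Finset.mem_powerset.2 Finset.subset_union_right))
    · exact Set.mem_biUnion hm (Finset.mem_coe.2 (Finset.mem_powerset.2 Finset.subset_union_left))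

theorem finite_inr (σ : S.carrier) : {t | S.IsFace t ∧ Sum.inr σ ∈ t}.Finite := by
  obtain ⟨x, hx⟩ := FLComplex.nonempty σ.1.2
  let A : Set (Finset X.V) := {s | s ∈ X.K.faces ∧ x ∈ s}
  have hA : A.Finite := X.locallyFinite x
  let B : Set (Finset X.V) := ⋃ s ∈ A, (s.powerset : Set (Finset X.V))
  have hB : B.Finite := hA.biUnion fun s _ => s.powerset.finite_toSet
  refine (hB.image fun ρ => insert (Sum.inr σ) (ρ.image Sum.inl)).subset ?_
  rintro t ⟨⟨τ, h1, -, rfl⟩ | ⟨σ', ρ, h1, -, rfl⟩, hs⟩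
  · simp at hs
  · have e : σ = σ' := by simpa using hs
    subst e
    have hm : ρ ∪ σ.1.1 ∈ A := ⟨h1, Finset.mem_union_right _ hx⟩
    exact ⟨ρ, Set.mem_biUnion hm
      (Finset.mem_coe.2 (Finset.mem_powerset.2 Finset.subset_union_left)), rfl⟩

variable (S)

/-- The simultaneous disjoint stellar subdivision of `X` at the barycentres of the simplices
of `S`. -/
def subdivision : FLComplex.{u} where
  V := X.V ⊕ S.carrier
  K := { faces := {t | S.IsFace t}
         isRelLowerSet_faces := fun _ h => ⟨IsFace.nonempty h, fun _ hts ht => h.mono hts ht⟩ }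
  locallyFinite
    | Sum.inl x => finite_inl x
    | Sum.inr σ => finite_inr σ
  finiteDimensional := by
    obtain ⟨N, hN⟩ := X.finiteDimensional
    refine ⟨N + 1, ?_⟩
    rintro t (⟨τ, h1, -, rfl⟩ | ⟨σ, ρ, h1, -, rfl⟩)
    · exact (Finset.card_image_le.trans (hN _ h1)).trans (Nat.le_succ N)
    · refine (Finset.card_insert_le _ _).trans (Nat.succ_le_succ ?_)
      exact Finset.card_image_le.trans
        ((Finset.card_le_card Finset.subset_union_left).trans (hN _ h1))

/-- The vertices of the smallest simplex of `X` that contains the given vertex of the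
subdivision. -/
def support : X.V ⊕ S.carrier → Finset X.V
  | Sum.inl x => {x}
  | Sum.inr σ => σ.1.1

/-- A simplicial approximation `r` to the identity: every vertex `w` of the subdivision
goes to a vertex of the smallest simplex of `X` that contains the point `w`. Thus `r` fixes the
vertices of `X` and maps `σ̂` to a vertex of `σ`. -/
structure Approx where
  /-- the map of vertices -/
  toFun : X.V ⊕ S.carrier → X.V
  mem_support : ∀ w, toFun w ∈ S.support w

namespace Approx

variable {S} (r : S.Approx)

theorem inl (x : X.V) : r.toFun (Sum.inl x) = x :=
  Finset.mem_singleton.1 (show _ ∈ ({x} : Finset X.V) from r.mem_support (Sum.inl x))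

theorem inr (σ : S.carrier) : r.toFun (Sum.inr σ) ∈ σ.1.1 := r.mem_support _

theorem image_image_inl (τ : Finset X.V) : (τ.image Sum.inl).image r.toFun = τ := by
  rw [Finset.image_image]
  have : r.toFun ∘ Sum.inl = _root_.id := funext r.inl
  rw [this, Finset.image_id]

theorem image_mem {t : Finset (X.V ⊕ S.carrier)} (h : S.IsFace t) :
    t.image r.toFun ∈ X.K.faces := by
  obtain ⟨τ, h1, -, rfl⟩ | ⟨σ, ρ, h1, -, rfl⟩ := h
  · rwa [image_image_inl]
  · rw [Finset.image_insert, image_image_inl]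
    refine FLComplex.face_of_subset h1 ?_ (Finset.insert_nonempty _ _)
    exact Finset.insert_subset (Finset.mem_union_right _ (r.inr σ)) Finset.subset_union_left

/-- The simplicial map given by `r`. -/
def map : FiniteMap S.subdivision X where
  toFun := r.toFun
  map_face _ h := r.image_mem h
  finite_fibre τ := by
    rcases τ.eq_empty_or_nonempty with rfl | ⟨x, hx⟩
    · refine Set.finite_empty.subset fun ρ hρ => ?_
      have := FLComplex.nonempty ρ.2
      rw [Finset.image_eq_empty.1 hρ] at this
      exact absurd this Finset.not_nonempty_empty
    · have hW : {σ : S.carrier | r.toFun (Sum.inr σ) = x}.Finite := by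
        refine Set.Finite.of_finite_image (f := fun σ : S.carrier => σ.1.1)
          ((X.locallyFinite x).subset ?_) (fun a _ b _ h => Subtype.ext (Subtype.ext h))
        rintro _ ⟨σ, hσ, rfl⟩
        exact ⟨σ.1.2, by rw [← show r.toFun (Sum.inr σ) = x from hσ]; exact r.inr σ⟩
      refine Set.Finite.of_finite_image (f := Subtype.val)
        (((finite_inl (S := S) x).union (hW.biUnion fun σ _ => finite_inr σ)).subset ?_)
        Subtype.val_injective.injOn
      rintro _ ⟨ρ, hρ, rfl⟩
      have hx' : x ∈ ρ.1.image r.toFun := by rw [show ρ.1.image r.toFun = τ from hρ]; exact hx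
      obtain ⟨y | σ, hw, hwx⟩ := Finset.mem_image.1 hx'
      · left
        rw [r.inl] at hwx
        subst hwx
        exact ⟨ρ.2, hw⟩
      · right
        exact Set.mem_biUnion (show σ ∈ {σ : S.carrier | r.toFun (Sum.inr σ) = x} from hwx)
          ⟨ρ.2, hw⟩

/-- The simplices of the subdivision. -/
abbrev Sx (_ : S.Approx) : Type u := S.subdivision.Simplex

/-- The set of vertices of a simplex of the subdivision. -/
def verts (ρ : S.subdivision.Simplex) : Finset (X.V ⊕ S.carrier) := ρ.1

/-- The difference `|ρ| - |r(ρ)|` of the dimensions. -/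
def defect (ρ : r.Sx) : ℤ := FLComplex.dim ρ - FLComplex.dim (r.map.onSimplex ρ)

/-- `ρ * r(σ̂) = τ` with `σ̂ ∈ ρ`, for some `σ ∈ S`. -/
def JoinImage (ρ τ : r.Sx) : Prop :=
  ∃ σ : S.carrier, Sum.inr σ ∈ verts ρ ∧ Sum.inl (r.toFun (Sum.inr σ)) ∉ verts ρ ∧
    verts τ = insert (Sum.inl (r.toFun (Sum.inr σ))) (verts ρ)

/-- `ρ * σ̂ = τ` with `r(σ̂) ∈ ρ`, for some `σ ∈ S`. -/
def JoinBary (ρ τ : r.Sx) : Prop :=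
  ∃ σ : S.carrier, Sum.inl (r.toFun (Sum.inr σ)) ∈ verts ρ ∧ Sum.inr σ ∉ verts ρ ∧
    verts τ = insert (Sum.inr σ) (verts ρ)

/-- Both `σ̂` and `r(σ̂)` are vertices. -/
def Both (σ : S.carrier) (ρ : r.Sx) : Prop :=
  Sum.inr σ ∈ verts ρ ∧ Sum.inl (r.toFun (Sum.inr σ)) ∈ verts ρ

variable {r}

theorem inr_unique {ρ : r.Sx} {σ σ' : S.carrier} (h : Sum.inr σ ∈ verts ρ)
    (h' : Sum.inr σ' ∈ verts ρ) : σ = σ' := by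
  obtain ⟨τ, -, -, e⟩ | ⟨σ₀, τ, -, -, e⟩ := ρ.2
  · change verts ρ = _ at e
    rw [e] at h
    simp at h
  · change verts ρ = _ at e
    rw [e] at h h'
    have e₁ : σ = σ₀ := by simpa using h
    have e₂ : σ' = σ₀ := by simpa using h'
    rw [e₁, e₂]

theorem eq_or {ρ : r.Sx} {x y : X.V ⊕ S.carrier} (hx : x ∈ verts ρ) (hy : y ∈ verts ρ)
    (h : r.toFun x = r.toFun y) :
    x = y ∨ ∃ σ, r.Both σ ρ ∧ ((x = Sum.inr σ ∧ y = Sum.inl (r.toFun (Sum.inr σ))) ∨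
      (y = Sum.inr σ ∧ x = Sum.inl (r.toFun (Sum.inr σ)))) := by
  rcases x with x | σ <;> rcases y with y | σ'
  · rw [r.inl, r.inl] at h
    exact Or.inl (by rw [h])
  · rw [r.inl] at h
    subst h
    exact Or.inr ⟨σ', ⟨hy, hx⟩, Or.inr ⟨rfl, rfl⟩⟩
  · rw [r.inl] at h
    subst h
    exact Or.inr ⟨σ, ⟨hx, hy⟩, Or.inl ⟨rfl, rfl⟩⟩
  · exact Or.inl (by rw [inr_unique hx hy])

theorem card_image {ρ : r.Sx} (h : ∀ σ, ¬ r.Both σ ρ) :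
    ((verts ρ).image r.toFun).card = (verts ρ).card := by
  refine Finset.card_image_of_injOn fun x hx y hy hxy => ?_
  obtain e | ⟨σ, hσ, -⟩ := eq_or hx hy hxy
  · exact e
  · exact absurd hσ (h σ)

theorem card_image_both {ρ : r.Sx} {σ : S.carrier} (h : r.Both σ ρ) :
    ((verts ρ).image r.toFun).card + 1 = (verts ρ).card := by
  have e : (verts ρ).image r.toFun = ((verts ρ).erase (Sum.inr σ)).image r.toFun := by
    rw [← Finset.insert_erase h.1, Finset.image_insert, Finset.erase_insert_eq_erase,
      Finset.erase_idem, Finset.insert_eq_of_mem]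
    rw [Finset.mem_image]
    exact ⟨_, Finset.mem_erase.2 ⟨by simp, h.2⟩, r.inl _⟩
  rw [e, Finset.card_image_of_injOn, Finset.card_erase_add_one h.1]
  intro x hx y hy hxy
  have hx' := Finset.mem_erase.1 (Finset.mem_coe.1 hx)
  have hy' := Finset.mem_erase.1 (Finset.mem_coe.1 hy)
  obtain e | ⟨σ', hσ', ⟨e1, e2⟩ | ⟨e1, e2⟩⟩ := eq_or hx'.2 hy'.2 hxy
  · exact e
  · rw [inr_unique hσ'.1 h.1] at e1
    exact absurd e1 hx'.1
  · rw [inr_unique hσ'.1 h.1] at e1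
    exact absurd e1 hy'.1

theorem defect_eq (ρ : r.Sx) :
    r.defect ρ = ((verts ρ).card : ℤ) - ((verts ρ).image r.toFun).card := by
  change ((verts ρ).card : ℤ) - 1 - (((verts ρ).image r.toFun).card - 1) = _
  ring

theorem defect_both {ρ : r.Sx} {σ : S.carrier} (h : r.Both σ ρ) : r.defect ρ = 1 := by
  rw [defect_eq, ← card_image_both h]
  push_cast
  ring

theorem defect_not {ρ : r.Sx} (h : ∀ σ, ¬ r.Both σ ρ) : r.defect ρ = 0 := by
  rw [defect_eq, card_image h]
  ring

theorem defect_cases (ρ : r.Sx) :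
    (r.defect ρ = 1 ∧ ∃ σ, r.Both σ ρ) ∨ (r.defect ρ = 0 ∧ ∀ σ, ¬ r.Both σ ρ) := by
  by_cases h : ∃ σ, r.Both σ ρ
  · obtain ⟨σ, h⟩ := h
    exact Or.inl ⟨defect_both h, σ, h⟩
  · push Not at h
    exact Or.inr ⟨defect_not h, h⟩

theorem Both.mono {ρ τ : r.Sx} {σ : S.carrier} (h : r.Both σ ρ) (hl : ρ ≤ τ) : r.Both σ τ :=
  ⟨hl h.1, hl h.2⟩

theorem defect_mono {ρ τ : r.Sx} (h : ρ ≤ τ) : r.defect ρ ≤ r.defect τ := by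
  obtain ⟨h1, σ, hσ⟩ | ⟨h1, -⟩ := defect_cases ρ
  · rw [h1, defect_both (hσ.mono h)]
  · rw [h1]
    obtain ⟨h2, -⟩ | ⟨h2, -⟩ := defect_cases τ <;> simp [h2]

/-- A nonempty set of vertices of a simplex spans a simplex. -/
def sub (τ : r.Sx) (s : Finset (X.V ⊕ S.carrier)) (hs : s ⊆ verts τ) (h : s.Nonempty) : r.Sx :=
  ⟨s, FLComplex.face_of_subset τ.2 hs h⟩

theorem verts_nonempty (ρ : r.Sx) : (verts ρ).Nonempty := FLComplex.nonempty ρ.2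

theorem sx_ext {ρ τ : r.Sx} (h : verts ρ = verts τ) : ρ = τ := Subtype.ext h

theorem bijOn_Icc {ρ τ : r.Sx} (h : ρ ≤ τ) (hd : r.defect ρ = r.defect τ) :
    Set.BijOn r.map.onSimplex (Set.Icc ρ τ) (Set.Icc (r.map.onSimplex ρ) (r.map.onSimplex τ)) := by
  refine ⟨fun μ hμ => ⟨r.map.onSimplex.monotone hμ.1, r.map.onSimplex.monotone hμ.2⟩, ?_, ?_⟩
  · have key : ∀ μ ∈ Set.Icc ρ τ, verts μ =
        (verts τ).filter fun x => r.toFun x ∈ (verts μ).image r.toFun := by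
      intro μ hμ
      ext x
      rw [Finset.mem_filter]
      refine ⟨fun hx => ⟨hμ.2 hx, Finset.mem_image_of_mem _ hx⟩, ?_⟩
      rintro ⟨hx, hx'⟩
      obtain ⟨y, hy, hyx⟩ := Finset.mem_image.1 hx'
      obtain e | ⟨σ, hσ, h'⟩ := eq_or hx (hμ.2 hy) hyx.symm
      · rwa [e]
      · obtain ⟨-, σ', hσ'⟩ | ⟨h0, -⟩ := defect_cases ρ
        · rw [inr_unique (hσ'.mono h).1 hσ.1] at hσ'
          obtain ⟨e, -⟩ | ⟨-, e⟩ := h'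
          · rw [e]; exact hμ.1 hσ'.1
          · rw [e]; exact hμ.1 hσ'.2
        · rw [h0, defect_both hσ] at hd
          norm_num at hd
    intro μ hμ ν hν hμν
    apply sx_ext (r := r)
    have e : (verts μ).image r.toFun = (verts ν).image r.toFun := congrArg Subtype.val hμν
    rw [key μ hμ, key ν hν, e]
  · rintro ξ ⟨hξ1, hξ2⟩
    let s := (verts τ).filter fun x => r.toFun x ∈ ξ.1
    have hs : verts ρ ⊆ s := fun x hx =>
      Finset.mem_filter.2 ⟨h hx, hξ1 (Finset.mem_image_of_mem _ hx)⟩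
    have hs' : s ⊆ verts τ := Finset.filter_subset _ _
    refine ⟨sub τ s hs' ((verts_nonempty ρ).mono hs), ⟨hs, hs'⟩, ?_⟩
    apply Subtype.ext
    change s.image r.toFun = ξ.1
    ext y
    rw [Finset.mem_image]
    constructor
    · rintro ⟨x, hx, rfl⟩
      exact (Finset.mem_filter.1 hx).2
    · intro hy
      obtain ⟨x, hx, rfl⟩ := Finset.mem_image.1 (hξ2 hy)
      exact ⟨x, Finset.mem_filter.2 ⟨hx, hy⟩, rfl⟩

theorem image_insert_image (σ : S.carrier) {s : Finset (X.V ⊕ S.carrier)} (h : Sum.inr σ ∈ s) :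
    (insert (Sum.inl (r.toFun (Sum.inr σ))) s).image r.toFun = s.image r.toFun := by
  rw [Finset.image_insert, r.inl, Finset.insert_eq_of_mem (Finset.mem_image_of_mem _ h)]

theorem image_insert_bary (σ : S.carrier) {s : Finset (X.V ⊕ S.carrier)}
    (h : Sum.inl (r.toFun (Sum.inr σ)) ∈ s) :
    (insert (Sum.inr σ) s).image r.toFun = s.image r.toFun := by
  rw [Finset.image_insert, Finset.insert_eq_of_mem]
  have := Finset.mem_image_of_mem r.toFun h
  rwa [r.inl] at this

theorem JoinImage.le {ρ τ : r.Sx} (h : r.JoinImage ρ τ) : ρ ≤ τ := by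
  obtain ⟨σ, -, -, e⟩ := h
  change verts ρ ⊆ verts τ
  rw [e]
  exact Finset.subset_insert _ _

theorem JoinBary.le {ρ τ : r.Sx} (h : r.JoinBary ρ τ) : ρ ≤ τ := by
  obtain ⟨σ, -, -, e⟩ := h
  change verts ρ ⊆ verts τ
  rw [e]
  exact Finset.subset_insert _ _

theorem JoinImage.map_eq {ρ τ : r.Sx} (h : r.JoinImage ρ τ) :
    r.map.onSimplex ρ = r.map.onSimplex τ := by
  obtain ⟨σ, h1, -, e⟩ := h
  apply Subtype.ext
  change (verts ρ).image r.toFun = (verts τ).image r.toFun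
  rw [e, image_insert_image σ h1]

theorem JoinBary.map_eq {ρ τ : r.Sx} (h : r.JoinBary ρ τ) :
    r.map.onSimplex ρ = r.map.onSimplex τ := by
  obtain ⟨σ, h1, -, e⟩ := h
  apply Subtype.ext
  change (verts ρ).image r.toFun = (verts τ).image r.toFun
  rw [e, image_insert_bary σ h1]

theorem JoinImage.defect_right {ρ τ : r.Sx} (h : r.JoinImage ρ τ) : r.defect τ = 1 := by
  obtain ⟨σ, h1, -, e⟩ := h
  exact defect_both (σ := σ) ⟨by rw [e]; exact Finset.mem_insert_of_mem h1,
    by rw [e]; exact Finset.mem_insert_self _ _⟩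

theorem JoinBary.defect_right {ρ τ : r.Sx} (h : r.JoinBary ρ τ) : r.defect τ = 1 := by
  obtain ⟨σ, h1, -, e⟩ := h
  exact defect_both (σ := σ) ⟨by rw [e]; exact Finset.mem_insert_self _ _,
    by rw [e]; exact Finset.mem_insert_of_mem h1⟩

theorem JoinImage.defect_left {ρ τ : r.Sx} (h : r.JoinImage ρ τ) : r.defect ρ = 0 := by
  obtain ⟨σ, h1, h2, -⟩ := h
  refine defect_not fun σ' h' => h2 ?_
  rw [inr_unique h1 h'.1]
  exact h'.2

theorem JoinBary.defect_left {ρ τ : r.Sx} (h : r.JoinBary ρ τ) : r.defect ρ = 0 := by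
  have hle := h.le
  obtain ⟨σ, h1, h2, e⟩ := h
  refine defect_not fun σ' h' => h2 ?_
  have h3 : Sum.inr σ ∈ verts τ := by rw [e]; exact Finset.mem_insert_self _ _
  rw [inr_unique h3 (hle h'.1)]
  exact h'.1

theorem JoinImage.not_bary {ρ τ : r.Sx} (h : r.JoinImage ρ τ) : ¬ r.JoinBary ρ τ := by
  rintro ⟨σ, h1, h2, e⟩
  have hle := h.le
  obtain ⟨σ', h1', h2', e'⟩ := h
  have h3 : Sum.inr σ ∈ verts τ := by rw [e]; exact Finset.mem_insert_self _ _
  rw [inr_unique h3 (hle h1')] at h2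
  exact h2 h1'

theorem JoinImage.unique_right {ρ τ τ' : r.Sx} (h : r.JoinImage ρ τ) (h' : r.JoinImage ρ τ') :
    τ = τ' := by
  obtain ⟨σ, h1, -, e⟩ := h
  obtain ⟨σ', h1', -, e'⟩ := h'
  obtain rfl := inr_unique h1 h1'
  exact sx_ext (e.trans e'.symm)

theorem JoinImage.unique_left {ρ ρ' τ : r.Sx} (h : r.JoinImage ρ τ) (h' : r.JoinImage ρ' τ) :
    ρ = ρ' := by
  have hle := h.le
  have hle' := h'.le
  obtain ⟨σ, h1, h2, e⟩ := h
  obtain ⟨σ', h1', h2', e'⟩ := h'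
  obtain rfl := inr_unique (hle h1) (hle' h1')
  apply sx_ext
  rw [← Finset.erase_insert h2, ← e, e', Finset.erase_insert h2']

theorem JoinBary.unique_left {ρ ρ' τ : r.Sx} (h : r.JoinBary ρ τ) (h' : r.JoinBary ρ' τ) :
    ρ = ρ' := by
  obtain ⟨σ, h1, h2, e⟩ := h
  obtain ⟨σ', h1', h2', e'⟩ := h'
  obtain rfl := inr_unique (ρ := τ) (σ := σ) (σ' := σ') (by rw [e]; exact Finset.mem_insert_self _ _)
    (by rw [e']; exact Finset.mem_insert_self _ _)
  apply sx_ext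
  rw [← Finset.erase_insert h2, ← e, e', Finset.erase_insert h2']

theorem JoinBary.unique_of_le {ρ τ τ' ξ : r.Sx} (h : r.JoinBary ρ τ) (h' : r.JoinBary ρ τ')
    (hl : τ ≤ ξ) (hl' : τ' ≤ ξ) : τ = τ' := by
  obtain ⟨σ, h1, -, e⟩ := h
  obtain ⟨σ', h1', -, e'⟩ := h'
  obtain rfl := inr_unique (ρ := ξ) (σ := σ) (σ' := σ')
    (hl (by change _ ∈ verts τ; rw [e]; exact Finset.mem_insert_self _ _))
    (hl' (by change _ ∈ verts τ'; rw [e']; exact Finset.mem_insert_self _ _))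
  exact sx_ext (e.trans e'.symm)

variable (r) in
/-- The common properties of the two kinds of joins. -/
structure IsJoin (J : r.Sx → r.Sx → Prop) : Prop where
  le : ∀ {ρ τ}, J ρ τ → ρ ≤ τ
  map_eq : ∀ {ρ τ}, J ρ τ → r.map.onSimplex ρ = r.map.onSimplex τ
  left : ∀ {ρ τ}, J ρ τ → r.defect ρ = 0
  right : ∀ {ρ τ}, J ρ τ → r.defect τ = 1
  unique_left : ∀ {ρ ρ' τ}, J ρ τ → J ρ' τ → ρ = ρ'
  unique_of_le : ∀ {ρ τ τ' ξ}, J ρ τ → J ρ τ' → τ ≤ ξ → τ' ≤ ξ → τ = τ'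

theorem isJoin_image : r.IsJoin r.JoinImage :=
  ⟨JoinImage.le, JoinImage.map_eq, JoinImage.defect_left, JoinImage.defect_right,
    JoinImage.unique_left, fun h h' _ _ => h.unique_right h'⟩

theorem isJoin_bary : r.IsJoin r.JoinBary :=
  ⟨JoinBary.le, JoinBary.map_eq, JoinBary.defect_left, JoinBary.defect_right,
    JoinBary.unique_left, JoinBary.unique_of_le⟩

/-- Passing first within one defect and then to a face. -/
def Down (J : r.Sx → r.Sx → Prop) (ρ μ τ : r.Sx) : Prop :=
  μ ≤ τ ∧ r.defect μ = r.defect τ ∧ J ρ μ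

/-- Passing first to a face and then within one defect. -/
def Up (J : r.Sx → r.Sx → Prop) (ρ μ τ : r.Sx) : Prop :=
  J μ τ ∧ ρ ≤ μ ∧ r.defect ρ = r.defect μ

theorem down_image_iff {ρ τ : r.Sx} {σ : S.carrier} (hB : r.Both σ τ) (hle : ρ ≤ τ) :
    (∃ μ, Down r.JoinImage ρ μ τ) ↔
      Sum.inr σ ∈ verts ρ ∧ Sum.inl (r.toFun (Sum.inr σ)) ∉ verts ρ := by
  constructor
  · rintro ⟨μ, h1, -, σ', h3, h4, -⟩
    obtain rfl := inr_unique (hle h3) hB.1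
    exact ⟨h3, h4⟩
  · rintro ⟨h3, h4⟩
    let μ := sub τ (insert (Sum.inl (r.toFun (Sum.inr σ))) (verts ρ))
      (Finset.insert_subset hB.2 hle) (Finset.insert_nonempty _ _)
    have hJ : r.JoinImage ρ μ := ⟨σ, h3, h4, rfl⟩
    have hμ : verts μ ⊆ verts τ := Finset.insert_subset hB.2 hle
    exact ⟨μ, hμ, by rw [hJ.defect_right, defect_both hB], hJ⟩

theorem down_bary_iff {ρ τ : r.Sx} {σ : S.carrier} (hB : r.Both σ τ) (hle : ρ ≤ τ) :
    (∃ μ, Down r.JoinBary ρ μ τ) ↔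
      Sum.inl (r.toFun (Sum.inr σ)) ∈ verts ρ ∧ Sum.inr σ ∉ verts ρ := by
  constructor
  · rintro ⟨μ, h1, -, σ', h3, h4, e⟩
    have : Sum.inr σ' ∈ verts μ := by rw [e]; exact Finset.mem_insert_self _ _
    obtain rfl := inr_unique (h1 this) hB.1
    exact ⟨h3, h4⟩
  · rintro ⟨h3, h4⟩
    let μ := sub τ (insert (Sum.inr σ) (verts ρ))
      (Finset.insert_subset hB.1 hle) (Finset.insert_nonempty _ _)
    have hJ : r.JoinBary ρ μ := ⟨σ, h3, h4, rfl⟩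
    have hμ : verts μ ⊆ verts τ := Finset.insert_subset hB.1 hle
    exact ⟨μ, hμ, by rw [hJ.defect_right, defect_both hB], hJ⟩

theorem up_image_iff {ρ τ : r.Sx} {σ : S.carrier} (hB : r.Both σ τ) (hle : ρ ≤ τ) :
    (∃ μ, Up r.JoinImage ρ μ τ) ↔ Sum.inl (r.toFun (Sum.inr σ)) ∉ verts ρ := by
  constructor
  · rintro ⟨μ, h, h2, -⟩ h5
    have hle' := h.le
    obtain ⟨σ', h3, h4, -⟩ := h
    obtain rfl := inr_unique (hle' h3) hB.1
    exact h4 (h2 h5)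
  · intro h4
    have h5 : Sum.inr σ ∈ (verts τ).erase (Sum.inl (r.toFun (Sum.inr σ))) :=
      Finset.mem_erase.2 ⟨by simp, hB.1⟩
    let μ := sub τ ((verts τ).erase (Sum.inl (r.toFun (Sum.inr σ)))) (Finset.erase_subset _ _)
      ⟨_, h5⟩
    have hJ : r.JoinImage μ τ :=
      ⟨σ, h5, Finset.notMem_erase _ _, (Finset.insert_erase hB.2).symm⟩
    have hρ : verts ρ ⊆ verts μ := fun x hx => Finset.mem_erase.2 ⟨fun e => h4 (e ▸ hx), hle hx⟩
    refine ⟨μ, hJ, hρ, ?_⟩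
    obtain ⟨h6, -⟩ | ⟨h6, -⟩ := defect_cases ρ
    · have := defect_mono (r := r) (ρ := ρ) (τ := μ) hρ
      rw [h6, hJ.defect_left] at this
      norm_num at this
    · rw [h6, hJ.defect_left]

theorem up_bary_iff {ρ τ : r.Sx} {σ : S.carrier} (hB : r.Both σ τ) (hle : ρ ≤ τ) :
    (∃ μ, Up r.JoinBary ρ μ τ) ↔ Sum.inr σ ∉ verts ρ := by
  constructor
  · rintro ⟨μ, ⟨σ', h3, h4, e⟩, h2, -⟩ h5
    obtain rfl := inr_unique (ρ := τ) (σ := σ) (σ' := σ') hB.1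
      (by rw [e]; exact Finset.mem_insert_self _ _)
    exact h4 (h2 h5)
  · intro h4
    have h5 : Sum.inl (r.toFun (Sum.inr σ)) ∈ (verts τ).erase (Sum.inr σ) :=
      Finset.mem_erase.2 ⟨by simp, hB.2⟩
    let μ := sub τ ((verts τ).erase (Sum.inr σ)) (Finset.erase_subset _ _) ⟨_, h5⟩
    have hJ : r.JoinBary μ τ :=
      ⟨σ, h5, Finset.notMem_erase _ _, (Finset.insert_erase hB.1).symm⟩
    have hρ : verts ρ ⊆ verts μ := fun x hx => Finset.mem_erase.2 ⟨fun e => h4 (e ▸ hx), hle hx⟩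
    refine ⟨μ, hJ, hρ, ?_⟩
    obtain ⟨h6, -⟩ | ⟨h6, -⟩ := defect_cases ρ
    · have := defect_mono (r := r) (ρ := ρ) (τ := μ) hρ
      rw [h6, hJ.defect_left] at this
      norm_num at this
    · rw [h6, hJ.defect_left]

theorem ite_identity {G : Type*} [AddCommGroup G] (v : G) (ρ τ : r.Sx) :
    (if ∃ μ, Down r.JoinImage ρ μ τ then v else 0) - (if ∃ μ, Down r.JoinBary ρ μ τ then v else 0)
    = (if ∃ μ, Up r.JoinImage ρ μ τ then v else 0)
      - (if ∃ μ, Up r.JoinBary ρ μ τ then v else 0) := by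
  by_cases h : ρ ≤ τ ∧ ∃ σ, r.Both σ τ
  · obtain ⟨hle, σ, hB⟩ := h
    simp only [down_image_iff hB hle, down_bary_iff hB hle, up_image_iff hB hle,
      up_bary_iff hB hle]
    by_cases h1 : Sum.inr σ ∈ verts ρ <;>
      by_cases h2 : Sum.inl (r.toFun (Sum.inr σ)) ∈ verts ρ <;> simp [h1, h2]
  · have hno : ∀ {d : ℤ}, r.defect τ = d → d = 1 → ρ ≤ τ → False := by
      intro d h1 h2 h3
      obtain ⟨-, hB⟩ | ⟨h0, -⟩ := defect_cases τ
      · exact h ⟨h3, hB⟩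
      · rw [h1, h2] at h0
        norm_num at h0
    have d1 : ¬ ∃ μ, Down r.JoinImage ρ μ τ := fun ⟨μ, h1, h2, h3⟩ =>
      hno h2.symm h3.defect_right (h3.le.trans h1)
    have d2 : ¬ ∃ μ, Down r.JoinBary ρ μ τ := fun ⟨μ, h1, h2, h3⟩ =>
      hno h2.symm h3.defect_right (h3.le.trans h1)
    have u1 : ¬ ∃ μ, Up r.JoinImage ρ μ τ := fun ⟨μ, h1, h2, _⟩ =>
      hno h1.defect_right rfl (h2.trans h1.le)
    have u2 : ¬ ∃ μ, Up r.JoinBary ρ μ τ := fun ⟨μ, h1, h2, _⟩ =>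
      hno h1.defect_right rfl (h2.trans h1.le)
    simp [d1, d2, u1, u2]

variable {k : Kind} {𝒜 : Type v} [Category.{w} 𝒜] [Preadditive 𝒜]

variable (k) in
/-- The degree `n - d` for `𝒜^*` and `n + d` for `𝒜_*`. -/
def degOf (n d : ℤ) : ℤ :=
  match k with
  | Kind.upper => n - d
  | Kind.lower => n + d

variable (k) in
/-- `joins k J τ σ` is `J τ σ` for `𝒜^*` and `J σ τ` for `𝒜_*`. -/
def joins (J : r.Sx → r.Sx → Prop) (τ σ : r.Sx) : Prop :=
  match k with
  | Kind.upper => J τ σ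
  | Kind.lower => J σ τ

variable (r k) in
/-- The degree `n - |ρ| + |r(ρ)|` for `𝒜^*` and `n + |ρ| - |r(ρ)|` for `𝒜_*`. -/
def deg (n : ℤ) (ρ : r.Sx) : ℤ := degOf k n (r.defect ρ)

theorem deg_eq {ρ τ : r.Sx} (n : ℤ) (h : r.defect τ = r.defect ρ) :
    r.deg k n ρ = r.deg k n τ := by
  unfold deg
  rw [h]

theorem joins_allows {J : r.Sx → r.Sx → Prop} (hJ : r.IsJoin J) {τ σ : r.Sx}
    (h : joins k J τ σ) : k.allows τ σ := by
  cases k <;> exact hJ.le h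

theorem joins_map {J : r.Sx → r.Sx → Prop} (hJ : r.IsJoin J) {τ σ : r.Sx}
    (h : joins k J τ σ) : r.map.onSimplex σ = r.map.onSimplex τ := by
  cases k
  · exact (hJ.map_eq h).symm
  · exact hJ.map_eq h

theorem joins_defect {J : r.Sx → r.Sx → Prop} (hJ : r.IsJoin J) {τ σ : r.Sx}
    (h : joins k J τ σ) : r.defect τ ≠ r.defect σ := by
  cases k
  · rw [hJ.left h, hJ.right h]; norm_num
  · rw [hJ.left h, hJ.right h]; norm_num

theorem joins_deg {J : r.Sx → r.Sx → Prop} (hJ : r.IsJoin J) {n m : ℤ} {τ σ : r.Sx}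
    (h : m + 1 = n ∧ joins k J τ σ) : r.deg k n σ = r.deg k m τ := by
  obtain ⟨rfl, h⟩ := h
  cases k
  · simp only [deg, degOf, hJ.left h, hJ.right h]; ring
  · simp only [deg, degOf, hJ.left h, hJ.right h]; ring

variable {M N L : ℤ → Ctrl k X 𝒜}

variable (M) in
/-- The identity map between two presentations of the same object. -/
def castHom {i j : ℤ} {x y : X.Simplex} (hi : i = j) (hx : x = y) : (M i).obj x ⟶ (M j).obj y :=
  eqToHom (by rw [hi, hx])

variable (r M) in
/-- The graded object with `(Sd_r M)(ρ)_n = M(r(ρ))_{n - |ρ| + |r(ρ)|}` for `𝒜^*` and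
`(Sd_r M)(ρ)_n = M(r(ρ))_{n + |ρ| - |r(ρ)|}` for `𝒜_*`. -/
abbrev sdObj (n : ℤ) : Ctrl k S.subdivision 𝒜 where
  obj ρ := (M (r.deg k n ρ)).obj (r.map.onSimplex ρ)

variable (r) in
/-- The differential of `Sd_r C`, in which `entry τ σ` is the component from `σ` to `τ`:
the component of the differential of `C` between faces with the same `|ρ| - |r(ρ)|`, and `(-1)^n` or
`(-1)^(n+1)` times the identity if the larger one of `σ` and `τ` is the join of the smaller one
and `r(σ̂₀)` or `σ̂₀` respectively, for a subdivided simplex `σ₀`. -/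
def sdD (C : ChainComplex (Ctrl k X 𝒜) ℤ) (n m : ℤ) : sdObj r C.X n ⟶ sdObj r C.X m where
  entry τ σ :=
    if k.allows τ σ ∧ r.defect τ = r.defect σ then
      Controlled.entry (C.d (r.deg k n σ) (r.deg k m τ)) (r.map.onSimplex τ) (r.map.onSimplex σ)
    else if h : m + 1 = n ∧ joins k r.JoinImage τ σ then
      n.negOnePow • castHom C.X (joins_deg isJoin_image h) (joins_map isJoin_image h.2)
    else if h : m + 1 = n ∧ joins k r.JoinBary τ σ then
      (n + 1).negOnePow • castHom C.X (joins_deg isJoin_bary h) (joins_map isJoin_bary h.2)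
    else 0
  finite_column σ := (S.subdivision.finite_allows k σ).subset fun τ hτ => by
    by_contra h
    refine hτ ?_
    rw [if_neg (fun h' => h h'.1), dif_neg (fun h' => h (joins_allows isJoin_image h'.2)),
      dif_neg (fun h' => h (joins_allows isJoin_bary h'.2))]
  eq_zero τ σ h := by
    rw [if_neg (fun h' => h h'.1), dif_neg (fun h' => h (joins_allows isJoin_image h'.2)),
      dif_neg (fun h' => h (joins_allows isJoin_bary h'.2))]

variable (r) in
/-- The components of `Sd_r f` for a chain map `f`. -/
def sdF {C D : ChainComplex (Ctrl k X 𝒜) ℤ} (f : C ⟶ D) (n : ℤ) :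
    sdObj r C.X n ⟶ sdObj r D.X n where
  entry τ σ :=
    if h : k.allows τ σ ∧ r.defect τ = r.defect σ then
      Controlled.entry (f.f (r.deg k n σ)) (r.map.onSimplex τ) (r.map.onSimplex σ) ≫
        castHom D.X (deg_eq n h.2) rfl
    else 0
  finite_column σ := (S.subdivision.finite_allows k σ).subset fun τ hτ => by
    by_contra h
    exact hτ (dif_neg (fun h' => h h'.1))
  eq_zero τ σ h := dif_neg (fun h' => h h'.1)

/-- The common part of `sdD` and `sdF`. -/
def tMat (F : ∀ i j, M i ⟶ N j) (n m : ℤ) : sdObj r M n ⟶ sdObj r N m where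
  entry τ σ :=
    if k.allows τ σ ∧ r.defect τ = r.defect σ then
      Controlled.entry (F (r.deg k n σ) (r.deg k m τ)) (r.map.onSimplex τ) (r.map.onSimplex σ)
    else 0
  finite_column σ := (S.subdivision.finite_allows k σ).subset fun τ hτ => by
    by_contra h
    exact hτ (if_neg (fun h' => h h'.1))
  eq_zero τ σ h := if_neg (fun h' => h h'.1)

variable (M) in
/-- The identity part of `sdD` without signs. -/
def eMat {J : r.Sx → r.Sx → Prop} (hJ : r.IsJoin J) (n m : ℤ) :
    sdObj r M n ⟶ sdObj r M m where
  entry τ σ :=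
    if h : m + 1 = n ∧ joins k J τ σ then castHom M (joins_deg hJ h) (joins_map hJ h.2) else 0
  finite_column σ := (S.subdivision.finite_allows k σ).subset fun τ hτ => by
    by_contra h
    exact hτ (dif_neg (fun h' => h (joins_allows hJ h'.2)))
  eq_zero τ σ h := dif_neg (fun h' => h (joins_allows hJ h'.2))

theorem tMat_entry (F : ∀ i j, M i ⟶ N j) (n m : ℤ) {τ σ : r.Sx}
    (h : k.allows τ σ ∧ r.defect τ = r.defect σ) :
    Controlled.entry (tMat (r := r) F n m) τ σ =
      Controlled.entry (F (r.deg k n σ) (r.deg k m τ)) (r.map.onSimplex τ)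
        (r.map.onSimplex σ) := if_pos h

theorem tMat_entry_neg (F : ∀ i j, M i ⟶ N j) (n m : ℤ) {τ σ : r.Sx}
    (h : ¬ (k.allows τ σ ∧ r.defect τ = r.defect σ)) :
    Controlled.entry (tMat (r := r) F n m) τ σ = 0 := if_neg h

theorem eMat_entry {J : r.Sx → r.Sx → Prop} (hJ : r.IsJoin J) {n m : ℤ} {τ σ : r.Sx}
    (h : m + 1 = n ∧ joins k J τ σ) :
    Controlled.entry (eMat M hJ n m) τ σ = castHom M (joins_deg hJ h) (joins_map hJ h.2) :=
  dif_pos h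

theorem eMat_entry_neg {J : r.Sx → r.Sx → Prop} (hJ : r.IsJoin J) {n m : ℤ} {τ σ : r.Sx}
    (h : ¬ (m + 1 = n ∧ joins k J τ σ)) :
    Controlled.entry (eMat M hJ n m) τ σ = 0 :=
  dif_neg h

theorem bijOn_allows {ρ σ : r.Sx} (h : k.allows ρ σ) (hd : r.defect ρ = r.defect σ) :
    Set.BijOn r.map.onSimplex {μ | k.allows ρ μ ∧ k.allows μ σ}
      {x | k.allows (r.map.onSimplex ρ) x ∧ k.allows x (r.map.onSimplex σ)} := by
  cases k
  · exact bijOn_Icc h hd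
  · have e := bijOn_Icc (r := r) (ρ := σ) (τ := ρ) h hd.symm
    have e1 : {μ : r.Sx | Kind.lower.allows ρ μ ∧ Kind.lower.allows μ σ} = Set.Icc σ ρ :=
      Set.ext fun _ => And.comm
    have e2 : {x | Kind.lower.allows (r.map.onSimplex ρ) x ∧
        Kind.lower.allows x (r.map.onSimplex σ)} =
        Set.Icc (r.map.onSimplex σ) (r.map.onSimplex ρ) :=
      Set.ext fun _ => And.comm
    rw [e1, e2]
    exact e

theorem defect_between {ρ μ σ : r.Sx} (h1 : k.allows ρ μ) (h2 : k.allows μ σ)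
    (hd : r.defect ρ = r.defect σ) : r.defect μ = r.defect σ := by
  cases k
  · exact le_antisymm (defect_mono h2) (hd ▸ defect_mono h1)
  · exact le_antisymm (hd ▸ defect_mono (r := r) (ρ := μ) (τ := ρ) h1)
      (defect_mono (r := r) (ρ := σ) (τ := μ) h2)

theorem finsum_restrict {ι G : Type*} [AddCommMonoid G] (f : ι → G) (s : Set ι)
    (h : ∀ x, x ∉ s → f x = 0) : ∑ᶠ x, f x = ∑ᶠ x ∈ s, f x := by
  rw [← finsum_mem_univ]
  refine finsum_mem_inter_support_eq' f _ _ fun x hx => ?_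
  simp only [Set.mem_univ, true_iff]
  by_contra h'
  exact hx (h x h')

theorem tMat_comp (F : ∀ i j, M i ⟶ N j) (G : ∀ i j, N i ⟶ L j) (H : ∀ i j, M i ⟶ L j)
    (n m l : ℤ) (hH : ∀ d, F (degOf k n d) (degOf k m d) ≫ G (degOf k m d) (degOf k l d)
      = H (degOf k n d) (degOf k l d)) :
    tMat (r := r) F n m ≫ tMat G m l = tMat H n l := by
  refine Controlled.hom_ext fun ρ σ => ?_
  rw [Controlled.entry_comp]
  by_cases hc : k.allows ρ σ ∧ r.defect ρ = r.defect σ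
  · obtain ⟨ha, hd⟩ := hc
    rw [tMat_entry H n l ⟨ha, hd⟩]
    have e : H (r.deg k n σ) (r.deg k l ρ) =
        F (r.deg k n σ) (degOf k m (r.defect σ)) ≫ G (degOf k m (r.defect σ)) (r.deg k l ρ) := by
      unfold deg
      rw [hd, hH]
    rw [e, Controlled.entry_comp, finsum_restrict _ {μ | k.allows ρ μ ∧ k.allows μ σ},
      finsum_restrict _ {x | k.allows (r.map.onSimplex ρ) x ∧ k.allows x (r.map.onSimplex σ)}]
    · refine finsum_mem_eq_of_bijOn _ (bijOn_allows ha hd) fun μ hμ => ?_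
      have hdμ := defect_between hμ.1 hμ.2 hd
      rw [tMat_entry F n m ⟨hμ.2, hdμ⟩, tMat_entry G m l ⟨hμ.1, hd.trans hdμ.symm⟩]
      change Controlled.entry (F _ (degOf k m (r.defect μ))) _ _ ≫
        Controlled.entry (G (degOf k m (r.defect μ)) _) _ _ = _
      rw [hdμ]
    · intro x hx
      by_cases h1 : k.allows (r.map.onSimplex ρ) x
      · rw [Controlled.entry_eq_zero _ (fun h2 => hx ⟨h1, h2⟩), zero_comp]
      · rw [Controlled.entry_eq_zero (G _ _) h1, comp_zero]
    · intro μ hμ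
      by_cases h1 : k.allows ρ μ
      · rw [Controlled.entry_eq_zero _ (fun h2 => hμ ⟨h1, h2⟩), zero_comp]
      · rw [Controlled.entry_eq_zero (tMat G m l) h1, comp_zero]
  · rw [tMat_entry_neg H n l hc]
    refine finsum_eq_zero_of_forall_eq_zero fun μ => ?_
    by_cases h1 : k.allows μ σ ∧ r.defect μ = r.defect σ
    · by_cases h2 : k.allows ρ μ ∧ r.defect ρ = r.defect μ
      · exact absurd ⟨k.allows_trans h2.1 h1.1, h2.2.trans h1.2⟩ hc
      · rw [tMat_entry_neg G m l h2, comp_zero]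
    · rw [tMat_entry_neg F n m h1, zero_comp]

theorem finsum_unique_ite {ι G : Type*} [AddCommMonoid G] (f : ι → G) (Q : ι → Prop) (v : G)
    (h1 : ∀ x, Q x → f x = v) (h0 : ∀ x, ¬ Q x → f x = 0) (hu : ∀ x y, Q x → Q y → x = y) :
    ∑ᶠ x, f x = if ∃ x, Q x then v else 0 := by
  by_cases h : ∃ x, Q x
  · rw [if_pos h]
    obtain ⟨x, hx⟩ := h
    rw [finsum_eq_single f x fun y hy => h0 y fun h' => hy (hu y x h' hx), h1 x hx]
  · rw [if_neg h]
    exact finsum_eq_zero_of_forall_eq_zero fun x => h0 x fun h' => h ⟨x, h'⟩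

theorem entry_castHom (F : ∀ i j, M i ⟶ N j) {i j j' : ℤ} {x y y' : X.Simplex} (hj : j = j')
    (hy : y = y') :
    Controlled.entry (F i j) y x ≫ castHom N hj hy = Controlled.entry (F i j') y' x := by
  subst hj hy
  exact Category.comp_id _

theorem castHom_entry (F : ∀ i j, M i ⟶ N j) {i i' j : ℤ} {x x' y : X.Simplex} (hi : i = i')
    (hx : x = x') :
    castHom M hi hx ≫ Controlled.entry (F i' j) y x' = Controlled.entry (F i j) y x := by
  subst hi hx
  exact Category.id_comp _

theorem t_e_entry (F : ∀ i j, M i ⟶ N j) {J : r.Sx → r.Sx → Prop} (hJ : r.IsJoin J) (n : ℤ)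
    {m l : ℤ} (hl : l + 1 = m) (ρ σ : r.Sx) :
    Controlled.entry (tMat F n m ≫ eMat N hJ m l) ρ σ =
      if ∃ μ, (k.allows μ σ ∧ r.defect μ = r.defect σ) ∧ joins k J ρ μ then
        Controlled.entry (F (r.deg k n σ) (r.deg k l ρ)) (r.map.onSimplex ρ) (r.map.onSimplex σ)
      else 0 := by
  rw [Controlled.entry_comp]
  refine finsum_unique_ite _
    (fun μ => (k.allows μ σ ∧ r.defect μ = r.defect σ) ∧ joins k J ρ μ) _ ?_ ?_ ?_
  · rintro μ ⟨h1, h2⟩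
    rw [tMat_entry F n m h1, eMat_entry hJ ⟨hl, h2⟩, entry_castHom]
  · intro μ h
    by_cases h1 : k.allows μ σ ∧ r.defect μ = r.defect σ
    · rw [eMat_entry_neg hJ (fun h2 => h ⟨h1, h2.2⟩), comp_zero]
    · rw [tMat_entry_neg F n m h1, zero_comp]
  · rintro μ μ' ⟨⟨h1, -⟩, h2⟩ ⟨⟨h1', -⟩, h2'⟩
    cases k
    · exact hJ.unique_of_le h2 h2' h1 h1'
    · exact hJ.unique_left h2 h2'

theorem e_t_entry (F : ∀ i j, M i ⟶ N j) {J : r.Sx → r.Sx → Prop} (hJ : r.IsJoin J)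
    {n m : ℤ} (l : ℤ) (hm : m + 1 = n) (ρ σ : r.Sx) :
    Controlled.entry (eMat M hJ n m ≫ tMat F m l) ρ σ =
      if ∃ μ, joins k J μ σ ∧ (k.allows ρ μ ∧ r.defect ρ = r.defect μ) then
        Controlled.entry (F (r.deg k n σ) (r.deg k l ρ)) (r.map.onSimplex ρ) (r.map.onSimplex σ)
      else 0 := by
  rw [Controlled.entry_comp]
  refine finsum_unique_ite _
    (fun μ => joins k J μ σ ∧ (k.allows ρ μ ∧ r.defect ρ = r.defect μ)) _ ?_ ?_ ?_
  · rintro μ ⟨h1, h2⟩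
    rw [tMat_entry F m l h2, eMat_entry hJ ⟨hm, h1⟩, castHom_entry]
  · intro μ h
    by_cases h1 : k.allows ρ μ ∧ r.defect ρ = r.defect μ
    · rw [eMat_entry_neg hJ (fun h2 => h ⟨h2.2, h1⟩), zero_comp]
    · rw [tMat_entry_neg F m l h1, comp_zero]
  · rintro μ μ' ⟨h2, h1, -⟩ ⟨h2', h1', -⟩
    cases k
    · exact hJ.unique_left h2 h2'
    · exact hJ.unique_of_le h2 h2' h1 h1'

theorem ite_identity_kind {G : Type*} [AddCommGroup G] (v : G) (ρ σ : r.Sx) :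
    (if ∃ μ, (k.allows μ σ ∧ r.defect μ = r.defect σ) ∧ joins k r.JoinImage ρ μ then v else 0) -
    (if ∃ μ, (k.allows μ σ ∧ r.defect μ = r.defect σ) ∧ joins k r.JoinBary ρ μ then v else 0) =
    (if ∃ μ, joins k r.JoinImage μ σ ∧ (k.allows ρ μ ∧ r.defect ρ = r.defect μ) then v else 0) -
    (if ∃ μ, joins k r.JoinBary μ σ ∧ (k.allows ρ μ ∧ r.defect ρ = r.defect μ) then v else 0) := by
  cases k
  · have hD : ∀ J : r.Sx → r.Sx → Prop, (∃ μ, (Kind.upper.allows μ σ ∧ r.defect μ = r.defect σ) ∧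
        joins Kind.upper J ρ μ) ↔ ∃ μ, Down J ρ μ σ := fun J =>
      exists_congr fun μ => and_assoc
    have hU : ∀ J : r.Sx → r.Sx → Prop, (∃ μ, joins Kind.upper J μ σ ∧
        (Kind.upper.allows ρ μ ∧ r.defect ρ = r.defect μ)) ↔ ∃ μ, Up J ρ μ σ := fun J => Iff.rfl
    simp only [hD, hU]
    exact ite_identity v ρ σ
  · have hD : ∀ J : r.Sx → r.Sx → Prop, (∃ μ, joins Kind.lower J μ σ ∧
        (Kind.lower.allows ρ μ ∧ r.defect ρ = r.defect μ)) ↔ ∃ μ, Down J σ μ ρ := fun J =>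
      exists_congr fun μ => ⟨fun h => ⟨h.2.1, h.2.2.symm, h.1⟩, fun h => ⟨h.2.2, h.1, h.2.1.symm⟩⟩
    have hU : ∀ J : r.Sx → r.Sx → Prop, (∃ μ, (Kind.lower.allows μ σ ∧ r.defect μ = r.defect σ) ∧
        joins Kind.lower J ρ μ) ↔ ∃ μ, Up J σ μ ρ := fun J =>
      exists_congr fun μ => ⟨fun h => ⟨h.2, h.1.1, h.1.2.symm⟩, fun h => ⟨⟨h.2.1, h.2.2.symm⟩, h.1⟩⟩
    simp only [hD, hU]
    exact (ite_identity v σ ρ).symm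

variable (r M) in
/-- The difference of the two identity parts. -/
def eDiff (n m : ℤ) : sdObj r M n ⟶ sdObj r M m :=
  eMat M isJoin_image n m - eMat M isJoin_bary n m

theorem t_eDiff (F : ∀ i j, M i ⟶ N j) {n m m' l : ℤ} (hl : l + 1 = m) (hm : m' + 1 = n) :
    tMat F n m ≫ eDiff r N m l = eDiff r M n m' ≫ tMat F m' l := by
  unfold eDiff
  rw [Preadditive.comp_sub, Preadditive.sub_comp]
  refine Controlled.hom_ext fun ρ σ => ?_
  rw [Controlled.entry_sub, Controlled.entry_sub, t_e_entry F _ n hl, t_e_entry F _ n hl, e_t_entry F _ l hm, e_t_entry F _ l hm]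
  exact ite_identity_kind _ ρ σ

theorem e_e {J J' : r.Sx → r.Sx → Prop} (hJ : r.IsJoin J) (hJ' : r.IsJoin J') (n m l : ℤ) :
    eMat M hJ n m ≫ eMat M hJ' m l = 0 := by
  refine Controlled.hom_ext fun ρ σ => ?_
  rw [Controlled.entry_comp, Controlled.entry_zero]
  refine finsum_eq_zero_of_forall_eq_zero fun μ => ?_
  by_cases h1 : m + 1 = n ∧ joins k J μ σ
  · by_cases h2 : l + 1 = m ∧ joins k J' ρ μ
    · exfalso
      obtain ⟨-, h1⟩ := h1
      obtain ⟨-, h2⟩ := h2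
      cases k
      · have a := hJ.left h1
        rw [hJ'.right h2] at a
        norm_num at a
      · have a := hJ.right h1
        rw [hJ'.left h2] at a
        norm_num at a
    · rw [eMat_entry_neg hJ' h2, comp_zero]
  · rw [eMat_entry_neg hJ h1, zero_comp]

theorem eDiff_eDiff (n m l : ℤ) : eDiff r M n m ≫ eDiff r M m l = 0 := by
  unfold eDiff
  simp only [Preadditive.comp_sub, Preadditive.sub_comp, e_e, sub_zero]

theorem sdD_eq (C : ChainComplex (Ctrl k X 𝒜) ℤ) (n m : ℤ) :
    sdD r C n m = tMat C.d n m + n.negOnePow • eDiff r C.X n m := by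
  refine Controlled.hom_ext fun τ σ => ?_
  unfold eDiff
  rw [Controlled.entry_add, Controlled.entry_units_smul, Controlled.entry_sub]
  change (if _ then _ else _) = _
  by_cases h1 : k.allows τ σ ∧ r.defect τ = r.defect σ
  · rw [if_pos h1, tMat_entry C.d n m h1,
      eMat_entry_neg isJoin_image (fun h => joins_defect isJoin_image h.2 h1.2),
      eMat_entry_neg isJoin_bary (fun h => joins_defect isJoin_bary h.2 h1.2), sub_zero, smul_zero,
      add_zero]
  · rw [if_neg h1, tMat_entry_neg C.d n m h1, zero_add]
    by_cases h2 : m + 1 = n ∧ joins k r.JoinImage τ σ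
    · have h3 : ¬ (m + 1 = n ∧ joins k r.JoinBary τ σ) := by
        rintro ⟨-, h3⟩
        cases k
        · exact JoinImage.not_bary h2.2 h3
        · exact JoinImage.not_bary h2.2 h3
      rw [dif_pos h2, eMat_entry isJoin_image h2, eMat_entry_neg isJoin_bary h3, sub_zero]
    · rw [dif_neg h2, eMat_entry_neg isJoin_image h2, zero_sub]
      by_cases h3 : m + 1 = n ∧ joins k r.JoinBary τ σ
      · rw [dif_pos h3, eMat_entry isJoin_bary h3, Int.negOnePow_succ, smul_neg, Units.neg_smul]
      · rw [dif_neg h3, eMat_entry_neg isJoin_bary h3, neg_zero, smul_zero]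

theorem tMat_zero (n m : ℤ) : tMat (r := r) (M := M) (N := N) (fun _ _ => 0) n m = 0 := by
  refine Controlled.hom_ext fun τ σ => ?_
  by_cases h : k.allows τ σ ∧ r.defect τ = r.defect σ
  · rw [tMat_entry _ n m h]; rfl
  · rw [tMat_entry_neg _ n m h]; rfl

theorem tMat_congr (F G : ∀ i j, M i ⟶ N j) (n m : ℤ)
    (h : ∀ d, F (degOf k n d) (degOf k m d) = G (degOf k n d) (degOf k m d)) :
    tMat (r := r) F n m = tMat G n m := by
  refine Controlled.hom_ext fun τ σ => ?_
  by_cases hc : k.allows τ σ ∧ r.defect τ = r.defect σ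
  · rw [tMat_entry F n m hc, tMat_entry G n m hc]
    have e : ∀ a b : ℤ, a = b → F (degOf k n b) (degOf k m a) = G (degOf k n b) (degOf k m a) := by
      rintro a _ rfl
      exact h a
    exact congrArg (fun f => Controlled.entry f _ _) (e _ _ hc.2)
  · rw [tMat_entry_neg F n m hc, tMat_entry_neg G n m hc]

theorem sdD_comp (C : ChainComplex (Ctrl k X 𝒜) ℤ) {n m l : ℤ} (hm : m + 1 = n)
    (hl : l + 1 = m) : sdD r C n m ≫ sdD r C m l = 0 := by
  have e : n.negOnePow = - m.negOnePow := by rw [← hm, Int.negOnePow_succ]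
  have e1 : tMat (r := r) C.d n m ≫ tMat C.d m l = 0 := by
    rw [tMat_comp C.d C.d (fun _ _ => 0) n m l fun d => C.d_comp_d _ _ _, tMat_zero]
  rw [sdD_eq, sdD_eq, Preadditive.add_comp, Preadditive.comp_add, Preadditive.comp_add, e1,
    zero_add]
  simp only [Units.smul_def, Preadditive.zsmul_comp, Preadditive.comp_zsmul, eDiff_eDiff,
    smul_zero, add_zero]
  rw [t_eDiff C.d hl hm, e]
  simp

theorem sdD_shape (C : ChainComplex (Ctrl k X 𝒜) ℤ) {n m : ℤ} (h : ¬ m + 1 = n) :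
    sdD r C n m = 0 := by
  have e1 : tMat (r := r) C.d n m = 0 := by
    rw [tMat_congr C.d (fun _ _ => 0) n m, tMat_zero]
    intro d
    apply C.shape
    intro h'
    change degOf k m d + 1 = degOf k n d at h'
    apply h
    cases k <;> simp only [degOf] at h' <;> omega
  have e2 : eDiff r C.X n m = 0 := by
    unfold eDiff
    have : ∀ {J : r.Sx → r.Sx → Prop} (hJ : r.IsJoin J), eMat C.X hJ n m = 0 := fun hJ =>
      Controlled.hom_ext fun τ σ => eMat_entry_neg hJ fun h' => h h'.1
    rw [this, this, sub_zero]
  rw [sdD_eq, e1, e2, smul_zero, add_zero]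

/-- A chain map as a family of morphisms between all terms. -/
def family {C D : ChainComplex (Ctrl k X 𝒜) ℤ} (f : C ⟶ D) (i j : ℤ) : C.X i ⟶ D.X j :=
  if h : i = j then f.f i ≫ eqToHom (by rw [h]) else 0

theorem family_self {C D : ChainComplex (Ctrl k X 𝒜) ℤ} (f : C ⟶ D) (i : ℤ) :
    family f i i = f.f i := by
  unfold family
  rw [dif_pos rfl]
  exact Category.comp_id _

theorem sdF_eq {C D : ChainComplex (Ctrl k X 𝒜) ℤ} (f : C ⟶ D) (n : ℤ) :
    sdF r f n = tMat (family f) n n := by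
  refine Controlled.hom_ext fun τ σ => ?_
  by_cases h : k.allows τ σ ∧ r.defect τ = r.defect σ
  · rw [tMat_entry _ n n h]
    change (if h : _ then _ else _) = _
    rw [dif_pos h, ← family_self f (r.deg k n σ), entry_castHom]
  · rw [tMat_entry_neg _ n n h]
    exact dif_neg h

variable (r) in
/-- The algebraic subdivision `Sd_r C` of a chain complex. -/
def sdComplex (C : ChainComplex (Ctrl k X 𝒜) ℤ) :
    ChainComplex (Ctrl k S.subdivision 𝒜) ℤ where
  X n := sdObj r C.X n
  d n m := sdD r C n m
  shape _ _ h := sdD_shape C h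
  d_comp_d' _ _ _ h h' := sdD_comp C h h'

variable (r) in
/-- The algebraic subdivision `Sd_r f` of a chain map. -/
def sdMap {C D : ChainComplex (Ctrl k X 𝒜) ℤ} (f : C ⟶ D) : sdComplex r C ⟶ sdComplex r D where
  f n := sdF r f n
  comm' n m h := by
    change m + 1 = n at h
    change sdF r f n ≫ sdD r D n m = sdD r C n m ≫ sdF r f m
    rw [sdF_eq, sdF_eq, sdD_eq, sdD_eq, Preadditive.comp_add, Preadditive.add_comp]
    have e1 : tMat (r := r) (family f) n n ≫ tMat D.d n m = tMat C.d n m ≫ tMat (family f) m m := by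
      rw [tMat_comp _ _ (fun i j => family f i i ≫ D.d i j) n n m fun d => rfl,
        tMat_comp _ _ (fun i j => family f i i ≫ D.d i j) n m m fun d => ?_]
      rw [family_self, family_self, f.comm]
    rw [e1]
    simp only [Units.smul_def, Preadditive.zsmul_comp, Preadditive.comp_zsmul]
    rw [t_eDiff (family f) h h]

variable (r k 𝒜) in
/-- Algebraic subdivision as a functor on all chain complexes. -/
def sdFunctor : ChainComplex (Ctrl k X 𝒜) ℤ ⥤ ChainComplex (Ctrl k S.subdivision 𝒜) ℤ where
  obj C := sdComplex r C
  map f := sdMap r f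
  map_id C := by
    ext n : 1
    change sdF r (𝟙 C) n = 𝟙 (sdObj r C.X n)
    refine Controlled.hom_ext fun τ σ => ?_
    rw [Controlled.entry_id]
    change (if h : _ then _ else _) = _
    by_cases h : σ = τ
    · subst h
      rw [dif_pos ⟨k.allows_refl σ, rfl⟩, dif_pos rfl]
      change Controlled.entry (𝟙 (C.X _)) _ _ ≫ _ = _
      rw [Controlled.entry_id, dif_pos rfl]
      simp [castHom]
    · rw [dif_neg h]
      by_cases h' : k.allows τ σ ∧ r.defect τ = r.defect σ
      · rw [dif_pos h']
        change Controlled.entry (𝟙 (C.X _)) _ _ ≫ _ = _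
        rw [Controlled.entry_id, dif_neg, zero_comp]
        intro e
        have hb := (bijOn_allows h'.1 h'.2).injOn
        exact h (hb ⟨h'.1, k.allows_refl σ⟩ ⟨k.allows_refl τ, h'.1⟩ e)
      · rw [dif_neg h']
  map_comp {C D E} f g := by
    ext n : 1
    change sdF r (f ≫ g) n = sdF r f n ≫ sdF r g n
    rw [sdF_eq, sdF_eq, sdF_eq, tMat_comp _ _ (family (f ≫ g)) n n n fun d => ?_]
    rw [family_self, family_self, family_self, HomologicalComplex.comp_f]

theorem deg_cases (n : ℤ) (ρ : r.Sx) :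
    r.deg k n ρ + 1 = n ∨ r.deg k n ρ - 1 = n ∨ r.deg k n ρ = n := by
  obtain ⟨e, -⟩ | ⟨e, -⟩ := defect_cases ρ <;> cases k <;> simp [deg, degOf, e]

theorem sdComplex_finite (C : ChainComplex (Ctrl k X 𝒜) ℤ) (hC : IsFiniteComplex _ C) :
    IsFiniteComplex _ (sdComplex r C) := by
  have hC' : {i | ¬ IsZero (C.X i)}.Finite := hC
  refine (((hC'.image fun i => i + 1).union (hC'.image fun i => i - 1)).union hC').subset ?_
  intro n hn
  by_contra h
  refine hn ((Controlled.isZero_iff _).2 fun ρ => ?_)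
  change IsZero ((C.X (r.deg k n ρ)).obj _)
  refine (Controlled.isZero_iff _).1 ?_ _
  by_contra hz
  apply h
  obtain e | e | e := deg_cases (k := k) n ρ
  · exact Or.inl (Or.inl ⟨_, hz, e⟩)
  · exact Or.inl (Or.inr ⟨_, hz, e⟩)
  · exact Or.inr (by rwa [e] at hz)

variable (r k 𝒜) in
/-- The algebraic subdivision functor `Sd_r`. -/
def Sd : FinComplex (Ctrl k X 𝒜) ⥤ FinComplex (Ctrl k S.subdivision 𝒜) :=
  (IsFiniteComplex _).lift ((IsFiniteComplex _).ι ⋙ sdFunctor r k 𝒜) fun C =>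
    sdComplex_finite C.obj C.property

theorem deg_of_defect (n : ℤ) {ρ : r.Sx} (h : r.defect ρ = 0) : r.deg k n ρ = n := by
  cases k <;> simp [deg, degOf, h]

variable (r M) in
/-- The map from the term of `Sd_r M` over `ρ` in degree `n` to the term of `M` over `τ` which is
the identity if `r(ρ) = τ` and `|ρ| = |τ|`, and zero otherwise. -/
def retraction (n : ℤ) (ρ : r.Sx) (τ : X.Simplex) : (sdObj r M n).obj ρ ⟶ (M n).obj τ :=
  if h : r.map.onSimplex ρ = τ ∧ r.defect ρ = 0 then castHom M (deg_of_defect n h.2) h.1 else 0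

variable (r M) in
/-- The map from the term of `M` over `τ` to the term of `Sd_r M` over `ρ` in degree `n` which is
the identity if `r(ρ) = τ` and `|ρ| = |τ|`, and zero otherwise. -/
def inclusion (n : ℤ) (ρ : r.Sx) (τ : X.Simplex) : (M n).obj τ ⟶ (sdObj r M n).obj ρ :=
  if h : r.map.onSimplex ρ = τ ∧ r.defect ρ = 0 then
    castHom M (deg_of_defect n h.2).symm h.1.symm
  else 0

end Approx

end Centres

/-- An iterated stellar subdivision of `X`, together with a simplicial approximation to the
identity for each of the finitely many simultaneous disjoint stellar subdivisions it consists
of. -/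
inductive Iterated (X : FLComplex.{u}) : FLComplex.{u} → Type (u + 1)
  | refl : Iterated X X
  | step {Y : FLComplex.{u}} (h : Iterated X Y) (S : Centres Y) (r : S.Approx) :
      Iterated X S.subdivision

namespace Iterated

variable {X : FLComplex.{u}}

/-- The composition `r = r_0 ∘ ⋯ ∘ r_n` of the simplicial approximations to the identity. -/
def map : {Y : FLComplex.{u}} → Iterated X Y → FiniteMap Y X
  | _, refl => FiniteMap.id X
  | _, step h _ r => h.map.comp r.map

/-- The algebraic subdivision functor `Sd_r = Sd_{r_n} ∘ ⋯ ∘ Sd_{r_0}`. -/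
def Sd (k : Kind) (𝒜 : Type v) [Category.{w} 𝒜] [Preadditive 𝒜] :
    {Y : FLComplex.{u}} → Iterated X Y →
      (FinComplex (Ctrl k X 𝒜) ⥤ FinComplex (Ctrl k Y 𝒜))
  | _, refl => 𝟭 _
  | _, step h _ r => Sd k 𝒜 h ⋙ r.Sd k 𝒜

end Iterated

end Simplicial

end GeomAlg

end

open GeomAlg

/-!
The complex `E = R_r Sd_r C` has over each simplex `τ` of `X` one copy of `C(τ)` for every simplex of
the subdivision that `r` maps to `τ`, shifted by one if that simplex has larger dimension than `τ`
(its *defect* is then one). The differential of `E` is a sum `t + e`: the part `t` comes from the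
differential of `C` and preserves the defect, and `e` consists of the signed identities between
simplices of different defect, so it is diagonal with respect to `X`.

The proof cancels summands in pairs. A simplex of defect one contains both `σ̂` and `r(σ̂)` for
exactly one centre `σ`; leaving out `r(σ̂)` gives a simplex of defect zero over the same `τ`, and all
simplices over `τ` are matched in this way with exactly one exception, `canonicalLift τ`
(`ite_cancellation`). The inverse `h` of the matched part of `e` is the `contraction`. It moves up
and down in the subdivision in the direction opposite to `e`, so it is not a morphism over the
subdivision, but it is diagonal over `X`; for this reason morphisms between assemblies are handled
through their components `coeff`, which are sums over all simplices of the subdivision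
(`comp_entry_comp_through_assembly`). One finds `e h + h e = 1 - i φ`, where `φ` is the map of the
theorem and `i` the map in the other direction which is the identity between `C(τ)` and the summand of
`canonicalLift τ`; for `𝒜_*` the factors `φ` and `i` change places (`diagonal_homotopy_upper`,
`diagonal_homotopy_lower`).

Since `h t h = 0`, the perturbation `t` of the differential does no harm: the chain map
`1 - (d h + h d)`, which is homotopic to the identity, still factors through `φ`, and this gives a
homotopy inverse of `φ` (`PerturbedContraction.exists_homotopyEquiv_of_retraction` and its dual).
That `φ` is a chain map, natural in `C`, holds because `r` maps the faces of a simplex of defect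
zero bijectively to the faces of its image (`existsUnique_face`).

For iterated subdivisions, assembly along a composite is the composite of the assemblies
(`assemblyCompIso`), additive functors preserve chain equivalences, and one composes.
-/

noncomputable section

namespace GeomAlg

open scoped Classical

/-! ### Matrices of morphisms into and out of an assembly -/

namespace Controlled

variable {k : Kind} {P : Type u} [PartialOrder P] {𝒜 : Type v} [Category.{w} 𝒜] [Preadditive 𝒜]
  {M N L : Controlled k P 𝒜}

/-- The morphism with the given entries on the diagonal and zero elsewhere. -/
def diag (g : ∀ τ, M.obj τ ⟶ N.obj τ) : M ⟶ N where
  entry τ σ := if h : σ = τ then g σ ≫ eqToHom (by rw [h]) else 0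
  finite_column σ := (Set.finite_singleton σ).subset fun τ hτ => by
    by_contra h
    exact hτ (dif_neg fun h' => h h'.symm)
  eq_zero τ σ h := dif_neg fun h' => by
    subst h'
    exact h (k.allows_refl σ)

theorem entry_diag_self (g : ∀ τ, M.obj τ ⟶ N.obj τ) (τ : P) : entry (diag g) τ τ = g τ := by
  change (if h : τ = τ then g τ ≫ eqToHom _ else 0) = _
  rw [dif_pos rfl, eqToHom_refl, Category.comp_id]

theorem entry_diag_ne (g : ∀ τ, M.obj τ ⟶ N.obj τ) {τ σ : P} (h : σ ≠ τ) :
    entry (diag g) τ σ = 0 := dif_neg h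

theorem entry_comp_diag (f : M ⟶ N) (g : ∀ τ, N.obj τ ⟶ L.obj τ) (τ σ : P) :
    entry (f ≫ diag g) τ σ = entry f τ σ ≫ g τ := by
  rw [entry_comp, finsum_eq_single _ τ, entry_diag_self]
  intro μ hμ
  rw [entry_diag_ne g hμ, comp_zero]

theorem entry_diag_comp (g : ∀ τ, M.obj τ ⟶ N.obj τ) (f : N ⟶ L) (τ σ : P) :
    entry (diag g ≫ f) τ σ = g σ ≫ entry f τ σ := by
  rw [entry_comp, finsum_eq_single _ σ, entry_diag_self]
  intro μ hμ
  rw [entry_diag_ne g hμ.symm, zero_comp]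

theorem diag_comp_diag_eq_id {f : ∀ τ, M.obj τ ⟶ N.obj τ} {g : ∀ τ, N.obj τ ⟶ M.obj τ}
    (h : ∀ τ, f τ ≫ g τ = 𝟙 _) : diag f ≫ diag g = 𝟙 M := by
  refine hom_ext fun τ σ => ?_
  rw [entry_comp_diag, entry_id]
  by_cases hσ : σ = τ
  · subst hσ
    rw [entry_diag_self, dif_pos rfl, h, eqToHom_refl]
  · rw [entry_diag_ne f hσ, dif_neg hσ, zero_comp]

theorem comp_entry_comp (f : M ⟶ N) (g : N ⟶ L) {τ σ : P} {a b : 𝒜} (x : a ⟶ M.obj σ)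
    (y : L.obj τ ⟶ b) :
    x ≫ entry (f ≫ g) τ σ ≫ y = ∑ᶠ ρ, (x ≫ entry f ρ σ) ≫ (entry g τ ρ ≫ y) := by
  have e : entry (f ≫ g) τ σ = _ := compEntry_eq f g τ σ (finite_column f σ).toFinset
    fun ρ hρ => (Set.Finite.mem_toFinset _).2 hρ
  rw [e, finsum_eq_finsetSum_of_support_subset (s := (finite_column f σ).toFinset)]
  · rw [Preadditive.sum_comp, Preadditive.comp_sum]
    refine Finset.sum_congr rfl fun ρ _ => ?_
    simp only [Category.assoc]
    rfl
  · intro ρ hρ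
    refine Finset.mem_coe.2 ((Set.Finite.mem_toFinset _).2 fun h => hρ ?_)
    change (x ≫ entry f ρ σ) ≫ _ = 0
    rw [h, comp_zero, zero_comp]

end Controlled

section Coefficients

variable {k : Kind} {P Q : Type u} [PartialOrder P] [PartialOrder Q]
  {𝒜 : Type v} [Category.{w} 𝒜] [Preadditive 𝒜] [HasFiniteBiproducts 𝒜]
  (p : Q →o P) [∀ τ, Finite (Fibre p τ)]
  {M N L : Controlled k Q 𝒜} {A B : Controlled k P 𝒜}

/-- A composite through an assembly is a sum over all summands of the assembly, not only over
the simplices of the base. -/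
theorem comp_entry_comp_through_assembly (f : A ⟶ assembleObj p M) (g : assembleObj p M ⟶ B)
    {τ σ : P} {a b : 𝒜} (x : a ⟶ A.obj σ) (y : B.obj τ ⟶ b) :
    x ≫ Controlled.entry (f ≫ g) τ σ ≫ y =
      ∑ᶠ ν : Q, (x ≫ Controlled.entry f (p ν) σ ≫ assembleπ p M ⟨ν, rfl⟩) ≫
        (assembleι p M ⟨ν, rfl⟩ ≫ Controlled.entry g τ (p ν) ≫ y) := by
  let t := (Controlled.finite_column f σ).toFinset
  have hs : {ν : Q | p ν ∈ t}.Finite := by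
    refine (Set.finite_iUnion fun ξ : t =>
      Set.finite_range fun ν : Fibre p ξ.1 => ν.1).subset fun ν hν => ?_
    exact Set.mem_iUnion.2 ⟨⟨p ν, hν⟩, ⟨ν, rfl⟩, rfl⟩
  rw [Controlled.comp_entry_comp, finsum_eq_finsetSum_of_support_subset (s := t),
    finsum_eq_finsetSum_of_support_subset (s := hs.toFinset),
    ← Finset.sum_fiberwise_of_maps_to (s := hs.toFinset) (t := t) (g := p)
    (fun ν hν => show ν ∈ {ν : Q | p ν ∈ t} from (Set.Finite.mem_toFinset hs).1 hν)]
  · refine Finset.sum_congr rfl fun ξ hξ => ?_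
    have := Fintype.ofFinite (Fibre p ξ)
    rw [← Category.id_comp (Controlled.entry g τ ξ), assemble_total p M ξ]
    simp only [Preadditive.sum_comp, Preadditive.comp_sum]
    rw [Finset.sum_subtype (p := fun ν => p ν = ξ)]
    · refine Finset.sum_congr rfl ?_
      rintro ⟨ν, rfl⟩ _
      simp only [Category.assoc]
    · intro ν
      rw [Finset.mem_filter, Set.Finite.mem_toFinset]
      exact ⟨fun h => h.2, fun h => ⟨show p ν ∈ t by rw [h]; exact hξ, h⟩⟩
  · intro ν hν
    refine Finset.mem_coe.2 ((Set.Finite.mem_toFinset _).2 ?_)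
    refine (Set.Finite.mem_toFinset _).2 fun h => hν ?_
    change (x ≫ Controlled.entry f (p ν) σ ≫ _) ≫ _ = 0
    rw [h, zero_comp, comp_zero, zero_comp]
  · intro ξ hξ
    refine Finset.mem_coe.2 ((Set.Finite.mem_toFinset _).2 fun h => hξ ?_)
    change (x ≫ Controlled.entry f ξ σ) ≫ _ = 0
    rw [h, comp_zero, zero_comp]

/-- The component between the summands over `μ` and `ρ` of a morphism of assemblies. -/
def coeff (f : assembleObj p M ⟶ assembleObj p N) (ρ μ : Q) : M.obj μ ⟶ N.obj ρ :=
  assembleι p M ⟨μ, rfl⟩ ≫ Controlled.entry f (p ρ) (p μ) ≫ assembleπ p N ⟨ρ, rfl⟩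

/-- The component on the summand over `μ` of a morphism from an assembly. -/
def coeffFrom (f : assembleObj p M ⟶ B) (τ : P) (μ : Q) : M.obj μ ⟶ B.obj τ :=
  assembleι p M ⟨μ, rfl⟩ ≫ Controlled.entry f τ (p μ)

/-- The component in the summand over `ρ` of a morphism to an assembly. -/
def coeffTo (f : A ⟶ assembleObj p N) (ρ : Q) (σ : P) : A.obj σ ⟶ N.obj ρ :=
  Controlled.entry f (p ρ) σ ≫ assembleπ p N ⟨ρ, rfl⟩

variable {p}

theorem coeff_ext {f g : assembleObj p M ⟶ assembleObj p N}
    (h : ∀ ρ μ, coeff p f ρ μ = coeff p g ρ μ) : f = g := by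
  refine Controlled.hom_ext fun τ σ => assemble_obj_ext p ?_
  rintro ⟨ρ, rfl⟩ ⟨μ, rfl⟩
  exact h ρ μ

theorem coeffFrom_ext {f g : assembleObj p M ⟶ B}
    (h : ∀ τ μ, coeffFrom p f τ μ = coeffFrom p g τ μ) : f = g := by
  refine Controlled.hom_ext fun τ σ => biproduct.hom_ext' _ _ ?_
  rintro ⟨μ, rfl⟩
  exact h τ μ

theorem coeffTo_ext {f g : A ⟶ assembleObj p N}
    (h : ∀ ρ σ, coeffTo p f ρ σ = coeffTo p g ρ σ) : f = g := by
  refine Controlled.hom_ext fun τ σ => biproduct.hom_ext _ _ ?_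
  rintro ⟨ρ, rfl⟩
  exact h ρ σ

theorem coeff_comp (f : assembleObj p M ⟶ assembleObj p N) (g : assembleObj p N ⟶ assembleObj p L)
    (ξ μ : Q) : coeff p (f ≫ g) ξ μ = ∑ᶠ ν, coeff p f ν μ ≫ coeff p g ξ ν :=
  comp_entry_comp_through_assembly p f g _ _

theorem coeffFrom_comp (f : assembleObj p M ⟶ assembleObj p N) (g : assembleObj p N ⟶ B)
    (τ : P) (μ : Q) : coeffFrom p (f ≫ g) τ μ = ∑ᶠ ν, coeff p f ν μ ≫ coeffFrom p g τ ν := by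
  have := comp_entry_comp_through_assembly p f g (assembleι p M ⟨μ, rfl⟩) (𝟙 (B.obj τ))
  simp only [Category.comp_id] at this
  exact this

theorem coeffTo_comp (f : A ⟶ assembleObj p M) (g : assembleObj p M ⟶ assembleObj p N)
    (ρ : Q) (σ : P) : coeffTo p (f ≫ g) ρ σ = ∑ᶠ ν, coeffTo p f ν σ ≫ coeff p g ρ ν := by
  have := comp_entry_comp_through_assembly p f g (𝟙 (A.obj σ)) (assembleπ p N ⟨ρ, rfl⟩)
  simp only [Category.id_comp] at this
  exact this

theorem entry_comp_through_assembly (f : A ⟶ assembleObj p M) (g : assembleObj p M ⟶ B)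
    (τ σ : P) : Controlled.entry (f ≫ g) τ σ = ∑ᶠ ν, coeffTo p f ν σ ≫ coeffFrom p g τ ν := by
  have := comp_entry_comp_through_assembly p f g (𝟙 (A.obj σ)) (𝟙 (B.obj τ))
  simp only [Category.id_comp, Category.comp_id] at this
  exact this

theorem coeff_comp_through_base (f : assembleObj p M ⟶ A) (g : A ⟶ assembleObj p N) (ρ μ : Q) :
    coeff p (f ≫ g) ρ μ = ∑ᶠ τ, coeffFrom p f τ μ ≫ coeffTo p g ρ τ :=
  Controlled.comp_entry_comp f g _ _

theorem coeffFrom_comp_base (f : assembleObj p M ⟶ A) (g : A ⟶ B) (τ : P) (μ : Q) :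
    coeffFrom p (f ≫ g) τ μ = ∑ᶠ ξ, coeffFrom p f ξ μ ≫ Controlled.entry g τ ξ := by
  have := Controlled.comp_entry_comp f g (assembleι p M ⟨μ, rfl⟩) (𝟙 (B.obj τ))
  simp only [Category.comp_id] at this
  exact this

theorem coeffTo_base_comp (f : A ⟶ B) (g : B ⟶ assembleObj p N) (ρ : Q) (σ : P) :
    coeffTo p (f ≫ g) ρ σ = ∑ᶠ ξ, Controlled.entry f ξ σ ≫ coeffTo p g ρ ξ := by
  have := Controlled.comp_entry_comp f g (𝟙 (A.obj σ)) (assembleπ p N ⟨ρ, rfl⟩)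
  simp only [Category.id_comp] at this
  exact this

theorem coeff_add (f g : assembleObj p M ⟶ assembleObj p N) (ρ μ : Q) :
    coeff p (f + g) ρ μ = coeff p f ρ μ + coeff p g ρ μ := by
  unfold coeff
  rw [Controlled.entry_add, Preadditive.add_comp, Preadditive.comp_add]

theorem coeff_sub (f g : assembleObj p M ⟶ assembleObj p N) (ρ μ : Q) :
    coeff p (f - g) ρ μ = coeff p f ρ μ - coeff p g ρ μ := by
  unfold coeff
  rw [Controlled.entry_sub, Preadditive.sub_comp, Preadditive.comp_sub]

theorem coeff_zero (ρ μ : Q) : coeff p (0 : assembleObj p M ⟶ assembleObj p N) ρ μ = 0 := by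
  unfold coeff
  rw [Controlled.entry_zero, zero_comp, comp_zero]

theorem coeffFrom_zero (τ : P) (μ : Q) : coeffFrom p (0 : assembleObj p M ⟶ B) τ μ = 0 := by
  unfold coeffFrom
  rw [Controlled.entry_zero, comp_zero]

theorem coeffTo_zero (ρ : Q) (σ : P) : coeffTo p (0 : A ⟶ assembleObj p M) ρ σ = 0 := by
  unfold coeffTo
  rw [Controlled.entry_zero, zero_comp]

theorem coeff_assembleMap (f : M ⟶ N) (ρ μ : Q) :
    coeff p (assembleMap p f) ρ μ = Controlled.entry f ρ μ :=
  assembleMap_ι_π p f _ _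

theorem coeff_id (ρ μ : Q) :
    coeff p (𝟙 (assembleObj p M)) ρ μ = if h : μ = ρ then eqToHom (by rw [h]) else 0 := by
  rw [← assembleMap_id, coeff_assembleMap, Controlled.entry_id]

end Coefficients

/-! ### Assembly along an identity and along a composite -/

section Functoriality

variable (k : Kind) {P Q R : Type u} [PartialOrder P] [PartialOrder Q] [PartialOrder R]
  (𝒜 : Type v) [Category.{w} 𝒜] [Preadditive 𝒜] [HasFiniteBiproducts 𝒜]

/-- Assembly along the identity does nothing, since its fibres are points. -/
def assembleIdIso (p : P →o P) [∀ τ, Finite (Fibre p τ)] (hp : ∀ τ, p τ = τ) :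
    assemble k 𝒜 p ≅ 𝟭 (Controlled k P 𝒜) :=
  NatIso.ofComponents
    (fun M =>
      { hom := Controlled.diag (M := assembleObj p M) fun τ => assembleπ p M ⟨τ, hp τ⟩
        inv := Controlled.diag (N := assembleObj p M) fun τ => assembleι p M ⟨τ, hp τ⟩
        hom_inv_id := Controlled.diag_comp_diag_eq_id fun τ => by
          have := Fintype.ofFinite (Fibre p τ)
          have hu : ∀ ρ : Fibre p τ, ρ = ⟨τ, hp τ⟩ := fun ρ =>
            Subtype.ext ((hp ρ.1).symm.trans ρ.2)
          refine Eq.trans ?_ (assemble_total p M τ).symm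
          rw [Finset.sum_eq_single ⟨τ, hp τ⟩]
          · rfl
          · exact fun ρ _ hρ => absurd (hu ρ) hρ
          · exact fun h => absurd (Finset.mem_univ _) h
        inv_hom_id := Controlled.diag_comp_diag_eq_id fun τ => assembleι_π_self p M _ })
    fun {M N} f => Controlled.hom_ext fun τ σ => by
      refine (Controlled.entry_comp_diag (M := assembleObj p M) (N := assembleObj p N)
        (assembleMap p f) _ τ σ).trans
        (Eq.trans ?_ (Controlled.entry_diag_comp (M := assembleObj p M) _ f τ σ).symm)
      refine biproduct.hom_ext' _ _ fun μ => ?_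
      have hμ : μ = ⟨σ, hp σ⟩ := Subtype.ext ((hp μ.1).symm.trans μ.2)
      subst hμ
      refine (assembleMap_ι_π p f ⟨τ, hp τ⟩ ⟨σ, hp σ⟩).trans ?_
      change _ = assembleι p M ⟨σ, hp σ⟩ ≫ assembleπ p M ⟨σ, hp σ⟩ ≫ Controlled.entry f τ σ
      rw [← Category.assoc, assembleι_π_self, Category.id_comp]

variable {k 𝒜} (p : R →o P) (q : Q →o P) (s : R →o Q) [∀ τ, Finite (Fibre p τ)]
  [∀ τ, Finite (Fibre q τ)] [∀ τ, Finite (Fibre s τ)] (hp : ∀ ρ, q (s ρ) = p ρ)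

variable (M : Controlled k R 𝒜)

/-- The sum over a fibre of `q ∘ s` as a sum over the fibre of `q` of sums over fibres of `s`. -/
def assembleSplit (τ : P) : (assembleObj p M).obj τ ⟶ (assembleObj q (assembleObj s M)).obj τ :=
  biproduct.desc (f := fun ρ : Fibre p τ => M.obj ρ.1) fun ρ =>
    assembleι s M ⟨ρ.1, rfl⟩ ≫ assembleι q (assembleObj s M) ⟨s ρ.1, (hp ρ.1).trans ρ.2⟩

/-- The inverse of `assembleSplit`. -/
def assembleJoin (τ : P) : (assembleObj q (assembleObj s M)).obj τ ⟶ (assembleObj p M).obj τ :=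
  biproduct.lift (f := fun ρ : Fibre p τ => M.obj ρ.1) fun ρ =>
    assembleπ q (assembleObj s M) ⟨s ρ.1, (hp ρ.1).trans ρ.2⟩ ≫ assembleπ s M ⟨ρ.1, rfl⟩

theorem ι_assembleSplit {τ : P} (ρ : Fibre p τ) :
    assembleι p M ρ ≫ assembleSplit p q s hp M τ =
      assembleι s M ⟨ρ.1, rfl⟩ ≫ assembleι q (assembleObj s M) ⟨s ρ.1, (hp ρ.1).trans ρ.2⟩ :=
  biproduct.ι_desc _ _

theorem assembleJoin_π {τ : P} (ρ : Fibre p τ) :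
    assembleJoin p q s hp M τ ≫ assembleπ p M ρ =
      assembleπ q (assembleObj s M) ⟨s ρ.1, (hp ρ.1).trans ρ.2⟩ ≫ assembleπ s M ⟨ρ.1, rfl⟩ :=
  biproduct.lift_π _ _

theorem assembleι_ι_π_π {τ : P} (ρ μ : R) (hρ : q (s ρ) = τ) (hμ : q (s μ) = τ) :
    (assembleι s M ⟨μ, rfl⟩ ≫ assembleι q (assembleObj s M) ⟨s μ, hμ⟩) ≫
      assembleπ q (assembleObj s M) ⟨s ρ, hρ⟩ ≫ assembleπ s M ⟨ρ, rfl⟩ =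
    if h : μ = ρ then eqToHom (by rw [h]) else 0 := by
  by_cases h : μ = ρ
  · subst h
    rw [dif_pos rfl, Category.assoc, ← Category.assoc (assembleι q _ _), assembleι_π_self,
      Category.id_comp, assembleι_π_self, eqToHom_refl]
  · rw [dif_neg h, Category.assoc, ← Category.assoc (assembleι q _ _)]
    by_cases h' : s μ = s ρ
    · have e : ∀ (ν : Q) (hν : s μ = ν) (h1 : q ν = τ) , assembleι s M ⟨μ, rfl⟩ ≫
          (assembleι q (assembleObj s M) ⟨s μ, hμ⟩ ≫ assembleπ q (assembleObj s M) ⟨ν, h1⟩) =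
          assembleι s M ⟨μ, hν⟩ := by
        rintro _ rfl h1
        rw [assembleι_π_self]
        exact Category.comp_id _
      rw [← Category.assoc, e _ h' hρ]
      exact assembleι_π_ne s M fun h2 => h (congrArg Subtype.val h2)
    · rw [assembleι_π_ne q _ fun h2 => h' (congrArg Subtype.val h2), zero_comp, comp_zero]

theorem assembleSplit_join (τ : P) :
    assembleSplit p q s hp M τ ≫ assembleJoin p q s hp M τ = 𝟙 _ := by
  refine assemble_obj_ext p fun ρ μ => ?_
  rw [Category.assoc, assembleJoin_π, ← Category.assoc, ι_assembleSplit, assembleι_ι_π_π,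
    Category.id_comp]
  by_cases h : μ = ρ
  · subst h
    rw [dif_pos rfl, assembleι_π_self, eqToHom_refl]
  · rw [dif_neg fun h' => h (Subtype.ext h'), assembleι_π_ne p M h]

theorem assembleSplit_π_π {τ : P} (ρ : R) (hρ : q (s ρ) = τ) :
    assembleSplit p q s hp M τ ≫
      assembleπ q (assembleObj s M) ⟨s ρ, hρ⟩ ≫ assembleπ s M ⟨ρ, rfl⟩ =
    assembleπ p M ⟨ρ, (hp ρ).symm.trans hρ⟩ := by
  have := assembleJoin_π p q s hp M (τ := τ) ⟨ρ, (hp ρ).symm.trans hρ⟩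
  rw [← this, ← Category.assoc, assembleSplit_join, Category.id_comp]

theorem assembleJoin_split (τ : P) :
    assembleJoin p q s hp M τ ≫ assembleSplit p q s hp M τ = 𝟙 _ := by
  refine biproduct.hom_ext _ _ ?_
  rintro ⟨ν, hν⟩
  refine biproduct.hom_ext _ _ ?_
  rintro ⟨ρ, hρ⟩
  change s ρ = ν at hρ
  subst hρ
  change (_ ≫ assembleπ q (assembleObj s M) ⟨s ρ, hν⟩) ≫ assembleπ s M ⟨ρ, rfl⟩ =
    (_ ≫ assembleπ q (assembleObj s M) ⟨s ρ, hν⟩) ≫ assembleπ s M ⟨ρ, rfl⟩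
  simp only [Category.assoc]
  rw [assembleSplit_π_π, assembleJoin_π, Category.id_comp]

variable (k 𝒜)

/-- Assembly along a composite is the composite of the assemblies. -/
def assembleCompIso : assemble k 𝒜 p ≅ assemble k 𝒜 s ⋙ assemble k 𝒜 q :=
  NatIso.ofComponents
    (fun M =>
      { hom := Controlled.diag (M := assembleObj p M) (N := assembleObj q (assembleObj s M))
          (assembleSplit p q s hp M)
        inv := Controlled.diag (M := assembleObj q (assembleObj s M)) (N := assembleObj p M)
          (assembleJoin p q s hp M)
        hom_inv_id := Controlled.diag_comp_diag_eq_id (assembleSplit_join p q s hp M)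
        inv_hom_id := Controlled.diag_comp_diag_eq_id (assembleJoin_split p q s hp M) })
    fun {M N} f => Controlled.hom_ext fun τ σ => by
      refine (Controlled.entry_comp_diag (M := assembleObj p M) (N := assembleObj p N)
        (assembleMap p f) (assembleSplit p q s hp N) τ σ).trans
        (Eq.trans ?_ (Controlled.entry_diag_comp (M := assembleObj p M) (assembleSplit p q s hp M)
          (assembleMap q (assembleMap s f)) τ σ).symm)
      refine biproduct.hom_ext' _ _ fun μ => biproduct.hom_ext _ _ ?_
      rintro ⟨ν, hν⟩
      refine biproduct.hom_ext _ _ ?_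
      rintro ⟨ρ, hρ⟩
      change s ρ = ν at hρ
      subst hρ
      change ((assembleι p M μ ≫ _) ≫ assembleπ q (assembleObj s N) ⟨s ρ, hν⟩) ≫
          assembleπ s N ⟨ρ, rfl⟩ =
        ((assembleι p M μ ≫ _) ≫ assembleπ q (assembleObj s N) ⟨s ρ, hν⟩) ≫ assembleπ s N ⟨ρ, rfl⟩
      have e := congrArg (fun x => assembleι s M ⟨μ.1, rfl⟩ ≫ x ≫ assembleπ s N ⟨ρ, rfl⟩)
        (assembleMap_ι_π q (assembleMap s f) ⟨s ρ, hν⟩ ⟨s μ.1, (hp μ.1).trans μ.2⟩)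
      simp only [Category.assoc] at e ⊢
      rw [assembleSplit_π_π, assembleMap_ι_π, ← Category.assoc (assembleι p M μ),
        ι_assembleSplit, Category.assoc, e]
      exact (assembleMap_ι_π s f ⟨ρ, rfl⟩ ⟨μ.1, rfl⟩).symm

end Functoriality

/-! ### The canonical simplex over a simplex of the base -/

namespace Centres

namespace Approx

variable {X : FLComplex.{u}} {S : Centres X} (r : S.Approx)

theorem isFace_insert_erase {τ : X.Simplex} {σ : S.carrier} (h : σ.1.1 ⊆ τ.1) :
    S.IsFace (insert (Sum.inr σ) ((τ.1.erase (r.toFun (Sum.inr σ))).image Sum.inl)) := by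
  refine Or.inr ⟨σ, _, ?_, fun h' => Finset.notMem_erase _ _ (h' (r.inr σ)), rfl⟩
  refine FLComplex.face_of_subset τ.2 (Finset.union_subset (Finset.erase_subset _ _) h) ?_
  exact (FLComplex.nonempty σ.1.2).mono Finset.subset_union_right

theorem isFace_image_inl {τ : X.Simplex} (h : ¬ ∃ σ : S.carrier, σ.1.1 ⊆ τ.1) :
    S.IsFace (τ.1.image Sum.inl) :=
  Or.inl ⟨τ.1, τ.2, fun σ hσ => h ⟨σ, hσ⟩, rfl⟩

/-- The simplex of the same dimension over `τ` that survives when all pairs `ρ`, `ρ * r(σ̂)` with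
`σ̂ ∈ ρ` are cancelled: it is `τ` itself if `τ` contains no centre, and the simplex obtained from
`τ` by replacing the vertex `r(σ̂)` by `σ̂` if `τ` contains the centre `σ`. -/
def canonicalLift (τ : X.Simplex) : r.Sx :=
  if h : ∃ σ : S.carrier, σ.1.1 ⊆ τ.1 then ⟨_, r.isFace_insert_erase h.choose_spec⟩
  else ⟨_, isFace_image_inl h⟩

variable {r}

theorem verts_canonicalLift_of_subset {τ : X.Simplex} {σ : S.carrier} (h : σ.1.1 ⊆ τ.1) :
    verts (r.canonicalLift τ) =
      insert (Sum.inr σ) ((τ.1.erase (r.toFun (Sum.inr σ))).image Sum.inl) := by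
  have h' : ∃ σ : S.carrier, σ.1.1 ⊆ τ.1 := ⟨σ, h⟩
  obtain rfl : σ = h'.choose := eq_of_subset τ.2 h h'.choose_spec
  unfold canonicalLift
  rw [dif_pos h']
  rfl

theorem verts_canonicalLift_of_not {τ : X.Simplex} (h : ¬ ∃ σ : S.carrier, σ.1.1 ⊆ τ.1) :
    verts (r.canonicalLift τ) = τ.1.image Sum.inl := by
  unfold canonicalLift
  rw [dif_neg h]
  rfl

theorem map_canonicalLift (τ : X.Simplex) : r.map.onSimplex (r.canonicalLift τ) = τ := by
  apply Subtype.ext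
  change (verts (r.canonicalLift τ)).image r.toFun = τ.1
  by_cases h : ∃ σ : S.carrier, σ.1.1 ⊆ τ.1
  · obtain ⟨σ, h⟩ := h
    rw [verts_canonicalLift_of_subset h, Finset.image_insert, image_image_inl,
      Finset.insert_erase (h (r.inr σ))]
  · rw [verts_canonicalLift_of_not h, image_image_inl]

theorem not_both_canonicalLift (τ : X.Simplex) (σ : S.carrier) : ¬ r.Both σ (r.canonicalLift τ) := by
  rintro ⟨h1, h2⟩
  by_cases h : ∃ σ : S.carrier, σ.1.1 ⊆ τ.1
  · obtain ⟨σ', h⟩ := h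
    rw [verts_canonicalLift_of_subset h] at h1 h2
    obtain rfl : σ = σ' := by simpa using h1
    simp at h2
  · rw [verts_canonicalLift_of_not h] at h1
    simp at h1

theorem defect_canonicalLift (τ : X.Simplex) : r.defect (r.canonicalLift τ) = 0 :=
  defect_not (not_both_canonicalLift τ)

theorem isFace_of_verts_eq_insert {μ : r.Sx} {σ : S.carrier} {s : Finset X.V}
    (h : verts μ = insert (Sum.inr σ) (s.image Sum.inl)) :
    s ∪ σ.1.1 ∈ X.K.faces ∧ ¬ σ.1.1 ⊆ s := by
  obtain ⟨τ, -, -, e⟩ | ⟨σ', t, h1, h2, e⟩ := μ.2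
  · change verts μ = _ at e
    have : Sum.inr σ ∈ verts μ := by rw [h]; exact Finset.mem_insert_self _ _
    rw [e] at this
    simp at this
  · change verts μ = _ at e
    obtain rfl : σ = σ' := by
      have : Sum.inr σ ∈ verts μ := by rw [h]; exact Finset.mem_insert_self _ _
      rw [e] at this
      simpa using this
    obtain rfl : s = t := by
      ext x
      have : Sum.inl x ∈ verts μ ↔ Sum.inl x ∈ verts μ := Iff.rfl
      nth_rw 1 [h] at this
      rw [e] at this
      simpa using this
    exact ⟨h1, h2⟩

theorem exists_verts_eq_of_inr_mem {μ : r.Sx} {σ : S.carrier} (h : Sum.inr σ ∈ verts μ) :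
    ∃ s : Finset X.V, verts μ = insert (Sum.inr σ) (s.image Sum.inl) := by
  obtain ⟨τ, -, -, e⟩ | ⟨σ', t, -, -, e⟩ := μ.2
  · change verts μ = _ at e
    rw [e] at h
    simp at h
  · change verts μ = _ at e
    obtain rfl : σ = σ' := by
      rw [e] at h
      simpa using h
    exact ⟨t, e⟩

theorem not_joinImage_canonicalLift (τ : X.Simplex) (μ : r.Sx) :
    ¬ r.JoinImage (r.canonicalLift τ) μ := by
  rintro ⟨σ, h1, -, e⟩
  by_cases h : ∃ σ : S.carrier, σ.1.1 ⊆ τ.1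
  · obtain ⟨σ', h⟩ := h
    rw [verts_canonicalLift_of_subset h] at h1 e
    obtain rfl : σ = σ' := by simpa using h1
    rw [Finset.insert_comm, ← Finset.image_insert, Finset.insert_erase (h (r.inr σ))] at e
    exact (isFace_of_verts_eq_insert e).2 h
  · rw [verts_canonicalLift_of_not h] at h1
    simp at h1

/-- If `μ = ρ * r(σ̂)`, then the face of `μ` opposite to `σ̂` is a simplex of `X` without centres, so
it is the canonical simplex over the image of `ρ`. -/
theorem JoinImage.joinBary_canonicalLift {ρ μ : r.Sx} (h : r.JoinImage ρ μ) :
    r.JoinBary (r.canonicalLift (r.map.onSimplex ρ)) μ := by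
  have hB : ∃ σ, r.Both σ μ := by
    obtain ⟨σ, h1, -, e⟩ := h
    exact ⟨σ, by rw [e]; exact Finset.mem_insert_of_mem h1,
      by rw [e]; exact Finset.mem_insert_self _ _⟩
  rw [h.map_eq]
  obtain ⟨σ, h1, h2⟩ := hB
  obtain ⟨s, hs⟩ := exists_verts_eq_of_inr_mem h1
  have hv : r.toFun (Sum.inr σ) ∈ s := by
    rw [hs] at h2
    simpa using h2
  have himg : (r.map.onSimplex μ).1 = s := by
    change (verts μ).image r.toFun = s
    rw [hs, Finset.image_insert, image_image_inl, Finset.insert_eq_of_mem hv]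
  obtain ⟨h3, h4⟩ := isFace_of_verts_eq_insert hs
  have hno : ¬ ∃ σ' : S.carrier, σ'.1.1 ⊆ (r.map.onSimplex μ).1 := by
    rintro ⟨σ', h'⟩
    rw [himg] at h'
    obtain rfl : σ' = σ := eq_of_subset h3 (h'.trans Finset.subset_union_left)
      Finset.subset_union_right
    exact h4 h'
  refine ⟨σ, ?_, ?_, ?_⟩
  · rw [verts_canonicalLift_of_not hno, himg]
    simpa using hv
  · rw [verts_canonicalLift_of_not hno]
    simp
  · rw [verts_canonicalLift_of_not hno, himg, hs]

/-- A simplex of defect zero that contains `σ̂` can be joined with `r(σ̂)` unless its image contains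
the whole of `σ`. -/
theorem eq_canonicalLift_or_joinImage {ρ : r.Sx} (h : r.defect ρ = 0) :
    ρ = r.canonicalLift (r.map.onSimplex ρ) ∨ ∃ μ, r.JoinImage ρ μ := by
  obtain ⟨τ, h1, h2, e⟩ | ⟨σ, s, h1, h2, e⟩ := ρ.2
  · change verts ρ = _ at e
    left
    have himg : (r.map.onSimplex ρ).1 = τ := by
      change (verts ρ).image r.toFun = τ
      rw [e, image_image_inl]
    apply sx_ext
    rw [verts_canonicalLift_of_not, himg, e]
    rintro ⟨σ, hσ⟩
    exact h2 σ (by rwa [himg] at hσ)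
  · change verts ρ = _ at e
    have hσ : Sum.inr σ ∈ verts ρ := by rw [e]; exact Finset.mem_insert_self _ _
    have hv : Sum.inl (r.toFun (Sum.inr σ)) ∉ verts ρ := fun hv => by
      rw [defect_both ⟨hσ, hv⟩] at h
      norm_num at h
    have hvs : r.toFun (Sum.inr σ) ∉ s := fun h' => hv (by rw [e]; simpa using h')
    have himg : (r.map.onSimplex ρ).1 = insert (r.toFun (Sum.inr σ)) s := by
      change (verts ρ).image r.toFun = _
      rw [e, Finset.image_insert, image_image_inl]
    by_cases hsub : σ.1.1 ⊆ insert (r.toFun (Sum.inr σ)) s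
    · left
      apply sx_ext
      rw [verts_canonicalLift_of_subset (σ := σ) (by rwa [himg]), himg,
        Finset.erase_insert hvs, e]
    · right
      have hf : S.IsFace (insert (Sum.inl (r.toFun (Sum.inr σ))) (verts ρ)) := by
        refine Or.inr ⟨σ, insert (r.toFun (Sum.inr σ)) s, ?_, hsub, ?_⟩
        · rwa [Finset.insert_union, Finset.insert_eq_of_mem (Finset.mem_union_right _ (r.inr σ))]
        · rw [e, Finset.insert_comm, Finset.image_insert]
      exact ⟨⟨_, hf⟩, σ, hσ, hv, rfl⟩

theorem exists_joinImage_of_defect {ρ : r.Sx} (h : r.defect ρ = 1) : ∃ μ, r.JoinImage μ ρ := by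
  obtain ⟨-, σ, h1, h2⟩ | ⟨h0, -⟩ := defect_cases ρ
  · have h5 : Sum.inr σ ∈ (verts ρ).erase (Sum.inl (r.toFun (Sum.inr σ))) :=
      Finset.mem_erase.2 ⟨by simp, h1⟩
    exact ⟨sub ρ _ (Finset.erase_subset _ _) ⟨_, h5⟩, σ, h5, Finset.notMem_erase _ _,
      (Finset.insert_erase h2).symm⟩
  · rw [h0] at h
    norm_num at h

theorem JoinBary.not_joinImage {ρ τ μ : r.Sx} (h : r.JoinBary ρ τ) : ¬ r.JoinImage ρ μ := by
  rintro ⟨σ', h', -, -⟩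
  have hle := h.le
  obtain ⟨σ, -, h2, e⟩ := h
  have h3 : Sum.inr σ ∈ verts τ := by rw [e]; exact Finset.mem_insert_self _ _
  obtain rfl := inr_unique h3 (hle h')
  exact h2 h'

/-- Over each simplex, the pairs `(ρ, ρ * r(σ̂))` cancel all simplices but the canonical one; the
resulting identification of `ρ` with the canonical simplex passes through the face of
`ρ * r(σ̂)` opposite to `σ̂`. -/
theorem ite_cancellation {G : Type*} [AddCommGroup G] (v : G) (ρ ν : r.Sx) :
    ((if ∃ μ, r.JoinImage μ ρ ∧ r.JoinImage μ ν then v else 0) -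
      (if ∃ μ, r.JoinBary μ ρ ∧ r.JoinImage μ ν then v else 0)) +
    ((if ∃ μ, r.JoinImage ρ μ ∧ r.JoinImage ν μ then v else 0) -
      (if ∃ μ, r.JoinImage ρ μ ∧ r.JoinBary ν μ then v else 0)) =
    (if ρ = ν then v else 0) -
      (if r.defect ρ = 0 ∧ ν = r.canonicalLift (r.map.onSimplex ρ) then v else 0) := by
  have h2 : ¬ ∃ μ, r.JoinBary μ ρ ∧ r.JoinImage μ ν := fun ⟨μ, h, h'⟩ => h.not_joinImage h'
  rw [if_neg h2, sub_zero]
  obtain ⟨h1, -⟩ | ⟨h0, -⟩ := defect_cases ρ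
  · have n1 : ∀ μ, ¬ r.JoinImage ρ μ := fun μ h => by
      rw [h.defect_left] at h1
      norm_num at h1
    have e : (∃ μ, r.JoinImage μ ρ ∧ r.JoinImage μ ν) ↔ ρ = ν := by
      constructor
      · rintro ⟨μ, h, h'⟩
        exact h.unique_right h'
      · rintro rfl
        obtain ⟨μ, h⟩ := exists_joinImage_of_defect h1
        exact ⟨μ, h, h⟩
    simp [n1, e, h1]
  · have n1 : ∀ μ, ¬ r.JoinImage μ ρ := fun μ h => by
      rw [h.defect_right] at h0
      norm_num at h0
    obtain h | ⟨μ, h⟩ := eq_canonicalLift_or_joinImage h0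
    · have n2 : ∀ μ, ¬ r.JoinImage ρ μ := fun μ => by
        rw [h]
        exact not_joinImage_canonicalLift _ μ
      rw [← h]
      simp [n1, n2, h0, eq_comm]
    · have e : (∃ μ, r.JoinImage ρ μ ∧ r.JoinImage ν μ) ↔ ρ = ν := by
        constructor
        · rintro ⟨μ, h, h'⟩
          exact h.unique_left h'
        · rintro rfl
          exact ⟨μ, h, h⟩
      have e' : (∃ μ, r.JoinImage ρ μ ∧ r.JoinBary ν μ) ↔
          ν = r.canonicalLift (r.map.onSimplex ρ) := by
        constructor
        · rintro ⟨μ, h, h'⟩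
          exact h'.unique_left h.joinBary_canonicalLift
        · rintro rfl
          exact ⟨μ, h, h.joinBary_canonicalLift⟩
      simp only [e, e', n1, h0, false_and, exists_false, if_false, true_and, zero_add]

/-- If `ρ` has the same dimension as its image, then `r` maps the faces of `ρ` bijectively to the
faces of its image. -/
theorem existsUnique_face {ρ : r.Sx} (h : r.defect ρ = 0) {τ : X.Simplex}
    (hτ : τ ≤ r.map.onSimplex ρ) : ∃! μ : r.Sx, μ ≤ ρ ∧ r.map.onSimplex μ = τ := by
  have hinj : ∀ x ∈ verts ρ, ∀ y ∈ verts ρ, r.toFun x = r.toFun y → x = y := by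
    intro x hx y hy hxy
    obtain e | ⟨σ, hσ, -⟩ := eq_or hx hy hxy
    · exact e
    · rw [defect_both hσ] at h
      norm_num at h
  let s := (verts ρ).filter fun x => r.toFun x ∈ τ.1
  have hs : s ⊆ verts ρ := Finset.filter_subset _ _
  have himg : s.image r.toFun = τ.1 := by
    ext y
    rw [Finset.mem_image]
    constructor
    · rintro ⟨x, hx, rfl⟩
      exact (Finset.mem_filter.1 hx).2
    · intro hy
      obtain ⟨x, hx, rfl⟩ := Finset.mem_image.1 (hτ hy)
      exact ⟨x, Finset.mem_filter.2 ⟨hx, hy⟩, rfl⟩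
  have hne : s.Nonempty := Finset.image_nonempty.1 (himg ▸ FLComplex.nonempty τ.2)
  refine ⟨sub ρ s hs hne, ⟨hs, Subtype.ext himg⟩, ?_⟩
  rintro μ ⟨h1, h2⟩
  have h2' : (verts μ).image r.toFun = τ.1 := congrArg Subtype.val h2
  apply sx_ext
  change verts μ = s
  ext x
  rw [Finset.mem_filter, ← h2', Finset.mem_image]
  constructor
  · exact fun hx => ⟨h1 hx, x, hx, rfl⟩
  · rintro ⟨hx, y, hy, hyx⟩
    rwa [← hinj y (h1 hy) x hx hyx]

theorem defect_eq_zero_of_le {μ ρ : r.Sx} (h : μ ≤ ρ) (hρ : r.defect ρ = 0) : r.defect μ = 0 := by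
  have := defect_mono h
  obtain ⟨h1, -⟩ | ⟨h0, -⟩ := defect_cases μ
  · rw [h1, hρ] at this
    norm_num at this
  · exact h0

end Approx

end Centres

/-! ### Morphisms of assemblies given by blocks -/

section Blocks

variable {k : Kind} {P Q : Type u} [PartialOrder P] [PartialOrder Q]
  {𝒜 : Type v} [Category.{w} 𝒜] [Preadditive 𝒜] [HasFiniteBiproducts 𝒜]
  (p : Q →o P) [∀ τ, Finite (Fibre p τ)]
  {M N : Controlled k Q 𝒜} {B : Controlled k P 𝒜}

/-- The morphism of assemblies with the given components, which vanish between different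
fibres. They need not be controlled over `Q`. -/
def fibrewise (g : ∀ ρ μ : Q, M.obj μ ⟶ N.obj ρ) (hg : ∀ ρ μ, p μ ≠ p ρ → g ρ μ = 0) :
    assembleObj p M ⟶ assembleObj p N where
  entry τ σ := assembleBlock p fun ρ μ => g ρ.1 μ.1
  finite_column σ := (Set.finite_singleton σ).subset fun τ hτ => by
    by_contra h
    refine hτ (assemble_obj_ext p fun ρ μ => ?_)
    rw [assembleι_block_π, zero_comp, comp_zero]
    exact hg _ _ fun h' => h (by rw [Set.mem_singleton_iff, ← ρ.2, ← μ.2, h'])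
  eq_zero τ σ h := assemble_obj_ext p fun ρ μ => by
    rw [assembleι_block_π, zero_comp, comp_zero]
    refine hg _ _ fun h' => h ?_
    rw [← ρ.2, ← μ.2, h']
    exact k.allows_refl _

/-- The morphism from an assembly with the given components, which vanish outside the fibres. -/
def fibrewiseFrom (g : ∀ (τ : P) (μ : Q), M.obj μ ⟶ B.obj τ)
    (hg : ∀ τ μ, p μ ≠ τ → g τ μ = 0) : assembleObj p M ⟶ B where
  entry τ σ := biproduct.desc (f := fun μ : Fibre p σ => M.obj μ.1) fun μ => g τ μ.1
  finite_column σ := (Set.finite_singleton σ).subset fun τ hτ => by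
    by_contra h
    refine hτ (biproduct.hom_ext' _ _ fun μ => ?_)
    refine (biproduct.ι_desc _ _).trans (Eq.trans (hg _ _ fun h' => h ?_) comp_zero.symm)
    rw [Set.mem_singleton_iff, ← μ.2, h']
  eq_zero τ σ h := biproduct.hom_ext' _ _ fun μ => by
    refine (biproduct.ι_desc _ _).trans (Eq.trans (hg _ _ fun h' => h ?_) comp_zero.symm)
    rw [← μ.2, h']
    exact k.allows_refl _

/-- The morphism to an assembly with the given components, which vanish outside the fibres. -/
def fibrewiseTo (g : ∀ (ρ : Q) (σ : P), B.obj σ ⟶ M.obj ρ)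
    (hg : ∀ ρ σ, p ρ ≠ σ → g ρ σ = 0) : B ⟶ assembleObj p M where
  entry τ σ := biproduct.lift (f := fun ρ : Fibre p τ => M.obj ρ.1) fun ρ => g ρ.1 σ
  finite_column σ := (Set.finite_singleton σ).subset fun τ hτ => by
    by_contra h
    refine hτ (biproduct.hom_ext _ _ fun ρ => ?_)
    refine (biproduct.lift_π _ _).trans (Eq.trans (hg _ _ fun h' => h ?_) zero_comp.symm)
    rw [Set.mem_singleton_iff, ← ρ.2, h']
  eq_zero τ σ h := biproduct.hom_ext _ _ fun ρ => by
    refine (biproduct.lift_π _ _).trans (Eq.trans (hg _ _ fun h' => h ?_) zero_comp.symm)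
    rw [← ρ.2, h']
    exact k.allows_refl _

variable {p}

theorem coeff_fibrewise (g : ∀ ρ μ : Q, M.obj μ ⟶ N.obj ρ) (hg : ∀ ρ μ, p μ ≠ p ρ → g ρ μ = 0)
    (ρ μ : Q) : coeff p (fibrewise p g hg) ρ μ = g ρ μ :=
  assembleι_block_π p _ _ _

theorem ι_fibrewiseFrom (g : ∀ (τ : P) (μ : Q), M.obj μ ⟶ B.obj τ)
    (hg : ∀ τ μ, p μ ≠ τ → g τ μ = 0) (τ : P) {σ : P} (μ : Fibre p σ) :
    assembleι p M μ ≫ Controlled.entry (fibrewiseFrom p g hg) τ σ = g τ μ.1 :=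
  biproduct.ι_desc _ _

theorem fibrewiseTo_π (g : ∀ (ρ : Q) (σ : P), B.obj σ ⟶ M.obj ρ)
    (hg : ∀ ρ σ, p ρ ≠ σ → g ρ σ = 0) {τ : P} (ρ : Fibre p τ) (σ : P) :
    Controlled.entry (fibrewiseTo p g hg) τ σ ≫ assembleπ p M ρ = g ρ.1 σ :=
  biproduct.lift_π _ _

end Blocks

/-! ### The maps between a complex and its assembled subdivision -/

namespace Centres

namespace Approx

variable {X : FLComplex.{u}} {S : Centres X} {r : S.Approx} {k : Kind}
  {𝒜 : Type v} [Category.{w} 𝒜] {M N : ℤ → Ctrl k X 𝒜}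

theorem castHom_comp_castHom {i j l : ℤ} {x y z : X.Simplex} (hi : i = j) (hx : x = y) (hj : j = l)
    (hy : y = z) :
    castHom M hi hx ≫ castHom M hj hy = castHom M (hi.trans hj) (hx.trans hy) := by
  subst hi hx hj hy
  exact Category.comp_id _

variable [Preadditive 𝒜]

variable (r M) in
/-- The identity between the terms of `Sd_r M` over `μ` in degree `n` and over `ρ` in degree `m`,
if they are the same term of `M`, and zero otherwise. -/
def sdCast (n m : ℤ) (ρ μ : r.Sx) : (sdObj r M n).obj μ ⟶ (sdObj r M m).obj ρ :=
  if h : r.deg k n μ = r.deg k m ρ ∧ r.map.onSimplex μ = r.map.onSimplex ρ then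
    castHom M h.1 h.2
  else 0

theorem sdCast_pos {n m : ℤ} {ρ μ : r.Sx} (h1 : r.deg k n μ = r.deg k m ρ)
    (h2 : r.map.onSimplex μ = r.map.onSimplex ρ) : sdCast r M n m ρ μ = castHom M h1 h2 :=
  dif_pos ⟨h1, h2⟩

theorem sdCast_comp {n m l : ℤ} {ρ μ ν : r.Sx} (h1 : r.deg k n μ = r.deg k m ν)
    (h2 : r.map.onSimplex μ = r.map.onSimplex ν) :
    sdCast r M n m ν μ ≫ sdCast r M m l ρ ν = sdCast r M n l ρ μ := by
  rw [sdCast_pos h1 h2]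
  by_cases h : r.deg k m ν = r.deg k l ρ ∧ r.map.onSimplex ν = r.map.onSimplex ρ
  · rw [sdCast_pos h.1 h.2, sdCast_pos (h1.trans h.1) (h2.trans h.2), castHom_comp_castHom]
  · unfold sdCast
    rw [dif_neg h, dif_neg fun h' => h ⟨h1.symm.trans h'.1, h2.symm.trans h'.2⟩, comp_zero]

theorem joins_image_deg {n m : ℤ} {τ σ : r.Sx} (h : n + 1 = m ∧ joins k r.JoinImage σ τ) :
    r.deg k n σ = r.deg k m τ :=
  (joins_deg isJoin_image h).symm

theorem joins_image_map {τ σ : r.Sx} (h : joins k r.JoinImage σ τ) :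
    r.map.onSimplex σ = r.map.onSimplex τ :=
  (joins_map isJoin_image h).symm

theorem entry_eMat {J : r.Sx → r.Sx → Prop} (hJ : r.IsJoin J) (n m : ℤ) (τ σ : r.Sx) :
    Controlled.entry (eMat M hJ n m) τ σ =
      if m + 1 = n ∧ joins k J τ σ then sdCast r M n m τ σ else 0 := by
  by_cases h : m + 1 = n ∧ joins k J τ σ
  · rw [eMat_entry hJ h, if_pos h, sdCast_pos]
  · rw [eMat_entry_neg hJ h, if_neg h]

variable [HasFiniteBiproducts 𝒜]

variable (r M) in
/-- The inverse of the part of the differential given by the joins with `r(σ̂)`, as a map which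
raises the degree by one. It is controlled over `X` but not over the subdivision. -/
def contraction (n m : ℤ) : assembleObj r.map.onSimplex (sdObj r M n) ⟶
    assembleObj r.map.onSimplex (sdObj r M m) :=
  fibrewise r.map.onSimplex
    (fun ρ μ => if n + 1 = m ∧ joins k r.JoinImage μ ρ then sdCast r M n m ρ μ else 0)
    fun _ _ h => if_neg fun h' => h (joins_image_map h'.2)

variable (r M) in
/-- The map to `M` from the assembly of `Sd_r M` which is the identity on the summands of defect
zero that satisfy `A`, and zero on the others. -/
def project (A : r.Sx → Prop) (n : ℤ) : assembleObj r.map.onSimplex (sdObj r M n) ⟶ M n :=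
  fibrewiseFrom r.map.onSimplex (fun τ μ => if A μ then retraction r M n μ τ else 0)
    fun τ μ h => by
      by_cases hA : A μ
      · rw [if_pos hA]
        exact dif_neg fun h' => h h'.1
      · exact if_neg hA

variable (r M) in
/-- The map from `M` to the assembly of `Sd_r M` which is the identity to the summands of defect
zero that satisfy `A`, and zero to the others. -/
def embed (A : r.Sx → Prop) (n : ℤ) : M n ⟶ assembleObj r.map.onSimplex (sdObj r M n) :=
  fibrewiseTo r.map.onSimplex (fun ρ σ => if A ρ then inclusion r M n ρ σ else 0)
    fun ρ σ h => by
      by_cases hA : A ρ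
      · rw [if_pos hA]
        exact dif_neg fun h' => h h'.1
      · exact if_neg hA

theorem coeff_contraction (n m : ℤ) (ρ μ : r.Sx) :
    coeff r.map.onSimplex (contraction r M n m) ρ μ =
      if n + 1 = m ∧ joins k r.JoinImage μ ρ then sdCast r M n m ρ μ else 0 :=
  coeff_fibrewise _ _ _ _

theorem ι_project (A : r.Sx → Prop) (n : ℤ) (τ : X.Simplex) {σ : X.Simplex}
    (μ : Fibre r.map.onSimplex σ) :
    assembleι r.map.onSimplex (sdObj r M n) μ ≫ Controlled.entry (project r M A n) τ σ =
      if A μ.1 then retraction r M n μ.1 τ else 0 :=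
  ι_fibrewiseFrom _ _ _ _

theorem embed_π (A : r.Sx → Prop) (n : ℤ) {τ : X.Simplex} (ρ : Fibre r.map.onSimplex τ)
    (σ : X.Simplex) :
    Controlled.entry (embed r M A n) τ σ ≫ assembleπ r.map.onSimplex (sdObj r M n) ρ =
      if A ρ.1 then inclusion r M n ρ.1 σ else 0 :=
  fibrewiseTo_π _ _ _ _

theorem coeffFrom_project (A : r.Sx → Prop) (n : ℤ) (τ : X.Simplex) (μ : r.Sx) :
    coeffFrom r.map.onSimplex (project r M A n) τ μ = if A μ then retraction r M n μ τ else 0 :=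
  ι_project A n τ ⟨μ, rfl⟩

theorem coeffTo_embed (A : r.Sx → Prop) (n : ℤ) (ρ : r.Sx) (σ : X.Simplex) :
    coeffTo r.map.onSimplex (embed r M A n) ρ σ = if A ρ then inclusion r M n ρ σ else 0 :=
  embed_π A n ⟨ρ, rfl⟩ σ

theorem embed_project {A B : r.Sx → Prop}
    (h : ∀ ρ, A ρ ∧ B ρ ↔ ρ = r.canonicalLift (r.map.onSimplex ρ)) (n : ℤ) :
    embed r M A n ≫ project r M B n = 𝟙 (M n) := by
  refine Controlled.hom_ext fun τ σ => ?_
  rw [entry_comp_through_assembly, finsum_eq_single _ (r.canonicalLift σ)]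
  · rw [coeffTo_embed, coeffFrom_project]
    have hc := (h (r.canonicalLift σ)).2 (by rw [map_canonicalLift])
    rw [if_pos hc.1, if_pos hc.2, Controlled.entry_id]
    have e : inclusion r M n (r.canonicalLift σ) σ = castHom M _ _ :=
      dif_pos ⟨map_canonicalLift σ, defect_canonicalLift σ⟩
    rw [e]
    by_cases hστ : σ = τ
    · subst hστ
      have e' : retraction r M n (r.canonicalLift σ) σ = castHom M _ _ :=
        dif_pos ⟨map_canonicalLift σ, defect_canonicalLift σ⟩
      rw [e', castHom_comp_castHom, dif_pos rfl]
      rfl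
    · have e' : retraction r M n (r.canonicalLift σ) τ = 0 :=
        dif_neg fun h' => hστ ((map_canonicalLift σ).symm.trans h'.1)
      rw [e', dif_neg hστ, comp_zero]
  · intro ρ hρ
    rw [coeffTo_embed, coeffFrom_project]
    by_cases hA : A ρ
    · by_cases hB : B ρ
      · have e : inclusion r M n ρ σ = 0 := dif_neg fun h' => hρ (by
          rw [← h'.1]
          exact (h ρ).1 ⟨hA, hB⟩)
        rw [e, ite_self, zero_comp]
      · rw [if_neg hB, comp_zero]
    · rw [if_neg hA, zero_comp]

theorem coeff_project_embed (A B : r.Sx → Prop) (n : ℤ) (ρ μ : r.Sx) :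
    coeff r.map.onSimplex (project r M A n ≫ embed r M B n) ρ μ =
      if A μ ∧ B ρ ∧ r.defect μ = 0 ∧ r.defect ρ = 0 ∧ r.map.onSimplex μ = r.map.onSimplex ρ then
        sdCast r M n n ρ μ else 0 := by
  rw [coeff_comp_through_base, finsum_eq_single _ (r.map.onSimplex μ)]
  · rw [coeffFrom_project, coeffTo_embed]
    by_cases hA : A μ
    · by_cases hB : B ρ
      · rw [if_pos hA, if_pos hB]
        by_cases hμ : r.defect μ = 0
        · by_cases hρ : r.defect ρ = 0 ∧ r.map.onSimplex μ = r.map.onSimplex ρ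
          · have e : retraction r M n μ (r.map.onSimplex μ) = castHom M _ _ := dif_pos ⟨rfl, hμ⟩
            have e' : inclusion r M n ρ (r.map.onSimplex μ) = castHom M _ _ :=
              dif_pos ⟨hρ.2.symm, hρ.1⟩
            rw [e, e', castHom_comp_castHom, if_pos ⟨hA, hB, hμ, hρ⟩, sdCast_pos]
          · have e' : inclusion r M n ρ (r.map.onSimplex μ) = 0 :=
              dif_neg fun h => hρ ⟨h.2, h.1.symm⟩
            rw [e', comp_zero, if_neg fun h => hρ h.2.2.2]
        · have e : retraction r M n μ (r.map.onSimplex μ) = 0 := dif_neg fun h => hμ h.2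
          rw [e, zero_comp, if_neg fun h => hμ h.2.2.1]
      · rw [if_neg hB, comp_zero, if_neg fun h => hB h.2.1]
    · rw [if_neg hA, zero_comp, if_neg fun h => hA h.1]
  · intro τ hτ
    rw [coeffFrom_project]
    have e : retraction r M n μ τ = 0 := dif_neg fun h => hτ h.1.symm
    rw [e, ite_self, zero_comp]

theorem coeffFrom_project_eq_zero {A : r.Sx → Prop} (n : ℤ) (τ : X.Simplex) {μ : r.Sx}
    (h : r.defect μ ≠ 0) : coeffFrom r.map.onSimplex (project r M A n) τ μ = 0 := by
  have e : retraction r M n μ τ = 0 := dif_neg fun h' => h h'.2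
  rw [coeffFrom_project, e, ite_self]

theorem coeffTo_embed_eq_zero {A : r.Sx → Prop} (n : ℤ) {ρ : r.Sx} (σ : X.Simplex)
    (h : r.defect ρ ≠ 0) : coeffTo r.map.onSimplex (embed r M A n) ρ σ = 0 := by
  have e : inclusion r M n ρ σ = 0 := dif_neg fun h' => h h'.2
  rw [coeffTo_embed, e, ite_self]

theorem contraction_shape {n m : ℤ} (h : ¬ n + 1 = m) : contraction r M n m = 0 :=
  coeff_ext fun ρ μ => by rw [coeff_contraction, if_neg fun h' => h h'.1, coeff_zero]

/-- The contraction is nonzero on one value of the defect only, and maps it to the other one, whereas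
`tMat` preserves the defect. -/
theorem contraction_tMat_contraction (n m l j : ℤ) (F : ∀ i j, M i ⟶ N j) :
    contraction r M n m ≫ assembleMap r.map.onSimplex (tMat F m l) ≫ contraction r N l j = 0 := by
  refine coeff_ext fun ρ μ => ?_
  rw [coeff_comp, coeff_zero]
  refine finsum_eq_zero_of_forall_eq_zero fun ν => ?_
  rw [coeff_contraction]
  by_cases h : n + 1 = m ∧ joins k r.JoinImage μ ν
  · have : coeff r.map.onSimplex
        (assembleMap r.map.onSimplex (tMat F m l) ≫ contraction r N l j) ρ ν = 0 := by
      rw [coeff_comp]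
      refine finsum_eq_zero_of_forall_eq_zero fun ξ => ?_
      rw [coeff_assembleMap, coeff_contraction]
      by_cases h' : k.allows ξ ν ∧ r.defect ξ = r.defect ν
      · rw [if_neg, comp_zero]
        rintro ⟨-, h2⟩
        have h1 := h.2
        have h3 := h'.2
        cases k
        · rw [isJoin_image.left h2, isJoin_image.right h1] at h3
          norm_num at h3
        · rw [isJoin_image.right h2, isJoin_image.left h1] at h3
          norm_num at h3
      · rw [tMat_entry_neg _ _ _ h', zero_comp]
    rw [this, comp_zero]
  · rw [if_neg h, zero_comp]

theorem contraction_contraction (n m l : ℤ) :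
    contraction r M n m ≫ contraction r M m l = 0 := by
  refine coeff_ext fun ρ μ => ?_
  rw [coeff_comp, coeff_zero]
  refine finsum_eq_zero_of_forall_eq_zero fun ν => ?_
  rw [coeff_contraction, coeff_contraction]
  by_cases h : n + 1 = m ∧ joins k r.JoinImage μ ν
  · rw [if_neg (c := m + 1 = l ∧ _), comp_zero]
    rintro ⟨-, h2⟩
    have h1 := h.2
    cases k
    · have e := isJoin_image.left h2
      rw [isJoin_image.right h1] at e
      norm_num at e
    · have e := isJoin_image.right h2
      rw [isJoin_image.left h1] at e
      norm_num at e
  · rw [if_neg h, zero_comp]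

/-- Equivalent conditions may be exchanged whatever their decidability instances are. -/
theorem ite_congr_prop {G : Type*} {p q : Prop} {dp : Decidable p} {dq : Decidable q} (h : p ↔ q)
    (a b : G) : @ite G p dp a b = @ite G q dq a b := by
  by_cases hp : p
  · rw [if_pos hp, if_pos (h.1 hp)]
  · rw [if_neg hp, if_neg fun hq => hp (h.2 hq)]

/-- All components of `f` are identities or zero, and `T ρ μ` says that the component from `μ` to `ρ`
is an identity. -/
def IsIdentityMatrix {n m : ℤ} (f : assembleObj r.map.onSimplex (sdObj r M n) ⟶
    assembleObj r.map.onSimplex (sdObj r M m)) (T : r.Sx → r.Sx → Prop) : Prop :=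
  ∀ ρ μ, coeff r.map.onSimplex f ρ μ = if T ρ μ then sdCast r M n m ρ μ else 0

theorem isIdentityMatrix_contraction (n m : ℤ) : IsIdentityMatrix (contraction r M n m)
    fun ρ μ => n + 1 = m ∧ joins k r.JoinImage μ ρ :=
  fun ρ μ => (coeff_contraction n m ρ μ).trans (ite_congr_prop Iff.rfl _ _)

theorem isIdentityMatrix_eMat {J : r.Sx → r.Sx → Prop} (hJ : r.IsJoin J) (n m : ℤ) :
    IsIdentityMatrix (assembleMap r.map.onSimplex (eMat M hJ n m))
      fun ρ μ => m + 1 = n ∧ joins k J ρ μ := fun ρ μ => by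
  rw [coeff_assembleMap, entry_eMat]
  exact ite_congr_prop Iff.rfl _ _

theorem IsIdentityMatrix.comp {n m l : ℤ} {f : assembleObj r.map.onSimplex (sdObj r M n) ⟶
      assembleObj r.map.onSimplex (sdObj r M m)} {g : assembleObj r.map.onSimplex (sdObj r M m) ⟶
      assembleObj r.map.onSimplex (sdObj r M l)} {T U : r.Sx → r.Sx → Prop}
    (hf : IsIdentityMatrix f T) (hg : IsIdentityMatrix g U)
    (hT : ∀ ν μ, T ν μ → r.deg k n μ = r.deg k m ν ∧ r.map.onSimplex μ = r.map.onSimplex ν)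
    (hu : ∀ ρ μ ν ν', T ν μ → U ρ ν → T ν' μ → U ρ ν' → ν = ν') :
    IsIdentityMatrix (f ≫ g) fun ρ μ => ∃ ν, T ν μ ∧ U ρ ν := by
  intro ρ μ
  rw [coeff_comp]
  refine finsum_unique_ite _ (fun ν => T ν μ ∧ U ρ ν) _ ?_ ?_ ?_
  · rintro ν ⟨h1, h2⟩
    rw [hf, hg, if_pos h1, if_pos h2, sdCast_comp (hT _ _ h1).1 (hT _ _ h1).2]
  · intro ν h
    rw [hf, hg]
    by_cases h1 : T ν μ
    · rw [if_neg fun h2 => h ⟨h1, h2⟩, comp_zero]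
    · rw [if_neg h1, zero_comp]
  · exact fun ν ν' h h' => hu ρ μ ν ν' h.1 h.2 h'.1 h'.2

theorem contraction_eMat {J : r.Sx → r.Sx → Prop} (hJ : r.IsJoin J) (n : ℤ) {m : ℤ}
    (hm : n + 1 = m) :
    IsIdentityMatrix (contraction r M n m ≫ assembleMap r.map.onSimplex (eMat M hJ m n))
      fun ρ μ => ∃ ν, joins k r.JoinImage μ ν ∧ joins k J ρ ν := by
  have := (isIdentityMatrix_contraction (r := r) (M := M) n m).comp (isIdentityMatrix_eMat hJ m n)
    (fun ν μ h => ⟨joins_image_deg h, joins_image_map h.2⟩) (by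
      intro ρ μ ν ν' h1 h2 h3 h4
      cases k
      · exact JoinImage.unique_right h1.2 h3.2
      · exact JoinImage.unique_left h1.2 h3.2)
  simpa only [hm, true_and] using this

theorem eMat_contraction {J : r.Sx → r.Sx → Prop} (hJ : r.IsJoin J) (n : ℤ) {m : ℤ}
    (hm : m + 1 = n) :
    IsIdentityMatrix (assembleMap r.map.onSimplex (eMat M hJ n m) ≫ contraction r M m n)
      fun ρ μ => ∃ ν, joins k J ν μ ∧ joins k r.JoinImage ν ρ := by
  have := (isIdentityMatrix_eMat hJ n m).comp (isIdentityMatrix_contraction (r := r) (M := M) m n)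
    (fun ν μ h => ⟨joins_deg hJ h, joins_map hJ h.2⟩) (by
      intro ρ μ ν ν' h1 h2 h3 h4
      cases k
      · exact hJ.unique_left h1.2 h3.2
      · exact JoinImage.unique_right h2.2 h4.2)
  simpa only [hm, true_and] using this

theorem isIdentityMatrix_id (n : ℤ) :
    IsIdentityMatrix (𝟙 (assembleObj r.map.onSimplex (sdObj r M n))) fun ρ μ => μ = ρ := by
  intro ρ μ
  rw [coeff_id]
  by_cases h : μ = ρ
  · subst h
    rw [dif_pos rfl, if_pos rfl, sdCast_pos rfl rfl]
    rfl
  · rw [dif_neg h, if_neg h]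

variable (r M) in
/-- The diagonal part of the differential of the assembled subdivision, up to sign. -/
def diagonalPart (n m : ℤ) : assembleObj r.map.onSimplex (sdObj r M n) ⟶
    assembleObj r.map.onSimplex (sdObj r M m) :=
  assembleMap r.map.onSimplex (eDiff r M n m)

theorem diagonalPart_eq (n m : ℤ) : diagonalPart r M n m =
    assembleMap r.map.onSimplex (eMat M isJoin_image n m) -
      assembleMap r.map.onSimplex (eMat M isJoin_bary n m) :=
  (assemble k 𝒜 r.map.onSimplex).map_sub

theorem coeff_diagonal_homotopy (n m l : ℤ) (hm : m + 1 = n) (hl : n + 1 = l) (ρ μ : r.Sx) :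
    coeff r.map.onSimplex (diagonalPart r M n m ≫ contraction r M m n +
      contraction r M n l ≫ diagonalPart r M l n) ρ μ =
    ((if ∃ ν, joins k r.JoinImage ν μ ∧ joins k r.JoinImage ν ρ then sdCast r M n n ρ μ else 0) -
      (if ∃ ν, joins k r.JoinBary ν μ ∧ joins k r.JoinImage ν ρ then sdCast r M n n ρ μ else 0)) +
    ((if ∃ ν, joins k r.JoinImage μ ν ∧ joins k r.JoinImage ρ ν then sdCast r M n n ρ μ else 0) -
      (if ∃ ν, joins k r.JoinImage μ ν ∧ joins k r.JoinBary ρ ν then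
        sdCast r M n n ρ μ else 0)) := by
  rw [diagonalPart_eq, diagonalPart_eq, Preadditive.sub_comp, Preadditive.comp_sub, coeff_add,
    coeff_sub, coeff_sub, eMat_contraction isJoin_image n hm ρ μ,
    eMat_contraction isJoin_bary n hm ρ μ, contraction_eMat isJoin_image n hl ρ μ,
    contraction_eMat isJoin_bary n hl ρ μ]

theorem diagonal_homotopy_upper {M : ℤ → Ctrl Kind.upper X 𝒜} {n m l : ℤ} (hm : m + 1 = n)
    (hl : n + 1 = l) :
    diagonalPart r M n m ≫ contraction r M m n + contraction r M n l ≫ diagonalPart r M l n =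
      𝟙 _ - project r M (fun _ => True) n ≫
        embed r M (fun ρ => ρ = r.canonicalLift (r.map.onSimplex ρ)) n := by
  refine coeff_ext fun ρ μ => ?_
  rw [coeff_diagonal_homotopy n m l hm hl, coeff_sub, isIdentityMatrix_id, coeff_project_embed]
  refine (ite_cancellation _ μ ρ).trans ?_
  refine congrArg₂ (· - ·) (ite_congr_prop Iff.rfl _ _) (ite_congr_prop ?_ _ _)
  constructor
  · rintro ⟨h1, h2⟩
    have e : r.map.onSimplex μ = r.map.onSimplex ρ := by rw [h2, map_canonicalLift]
    exact ⟨trivial, by rwa [← e], h1, by rw [h2, defect_canonicalLift], e⟩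
  · rintro ⟨-, h1, h2, -, h3⟩
    exact ⟨h2, by rwa [h3]⟩

theorem diagonal_homotopy_lower {M : ℤ → Ctrl Kind.lower X 𝒜} {n m l : ℤ} (hm : m + 1 = n)
    (hl : n + 1 = l) :
    diagonalPart r M n m ≫ contraction r M m n + contraction r M n l ≫ diagonalPart r M l n =
      𝟙 _ - project r M (fun ρ => ρ = r.canonicalLift (r.map.onSimplex ρ)) n ≫
        embed r M (fun _ => True) n := by
  refine coeff_ext fun ρ μ => ?_
  rw [coeff_diagonal_homotopy n m l hm hl, coeff_sub, isIdentityMatrix_id, coeff_project_embed]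
  have e := ite_cancellation (r := r) (sdCast r M n n ρ μ) ρ μ
  rw [add_comm] at e
  -- In the lower case the matrix is the transpose of the upper one.
  have e1 : ∀ J J' : r.Sx → r.Sx → Prop, (∃ ν, J μ ν ∧ J' ρ ν) ↔ ∃ ν, J' ρ ν ∧ J μ ν :=
    fun _ _ => exists_congr fun _ => and_comm
  have e2 : ∀ J J' : r.Sx → r.Sx → Prop, (∃ ν, J ν μ ∧ J' ν ρ) ↔ ∃ ν, J' ν ρ ∧ J ν μ :=
    fun _ _ => exists_congr fun _ => and_comm
  change ((if ∃ ν, r.JoinImage μ ν ∧ r.JoinImage ρ ν then _ else _) -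
      (if ∃ ν, r.JoinBary μ ν ∧ r.JoinImage ρ ν then _ else _)) +
    ((if ∃ ν, r.JoinImage ν μ ∧ r.JoinImage ν ρ then _ else _) -
      (if ∃ ν, r.JoinImage ν μ ∧ r.JoinBary ν ρ then _ else _)) = _
  simp only [e1, e2]
  refine e.trans ?_
  refine congrArg₂ (· - ·) (ite_congr_prop eq_comm _ _) (ite_congr_prop ?_ _ _)
  constructor
  · rintro ⟨h1, h2⟩
    have e : r.map.onSimplex μ = r.map.onSimplex ρ := by rw [h2, map_canonicalLift]
    exact ⟨by rwa [e], trivial, by rw [h2, defect_canonicalLift], h1, e⟩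
  · rintro ⟨h1, -, -, h2, h3⟩
    exact ⟨h2, by rwa [← h3]⟩

theorem contraction_project {M : ℤ → Ctrl Kind.upper X 𝒜} (A : r.Sx → Prop) (n m : ℤ) :
    contraction r M n m ≫ project r M A m = 0 := by
  refine coeffFrom_ext fun τ μ => ?_
  rw [coeffFrom_comp, coeffFrom_zero]
  refine finsum_eq_zero_of_forall_eq_zero fun ν => ?_
  rw [coeff_contraction]
  by_cases h : n + 1 = m ∧ joins Kind.upper r.JoinImage μ ν
  · have h' : r.defect ν = 1 := JoinImage.defect_right h.2
    rw [coeffFrom_project_eq_zero m τ (by rw [h']; norm_num), comp_zero]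
  · rw [if_neg h, zero_comp]

theorem embed_contraction {M : ℤ → Ctrl Kind.lower X 𝒜} (A : r.Sx → Prop) (n m : ℤ) :
    embed r M A n ≫ contraction r M n m = 0 := by
  refine coeffTo_ext fun ρ σ => ?_
  rw [coeffTo_comp, coeffTo_zero]
  refine finsum_eq_zero_of_forall_eq_zero fun ν => ?_
  rw [coeff_contraction]
  by_cases h : n + 1 = m ∧ joins Kind.lower r.JoinImage ν ρ
  · have h' : r.defect ν = 1 := JoinImage.defect_right h.2
    rw [coeffTo_embed_eq_zero n σ (by rw [h']; norm_num), zero_comp]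
  · rw [if_neg h, comp_zero]

theorem exists_joinBary_of_defect {ρ : r.Sx} (h : r.defect ρ = 1) : ∃ μ, r.JoinBary μ ρ := by
  obtain ⟨μ, hμ⟩ := exists_joinImage_of_defect h
  exact ⟨_, hμ.joinBary_canonicalLift⟩

theorem coeffFrom_eMat_project {M : ℤ → Ctrl Kind.upper X 𝒜} {J : r.Sx → r.Sx → Prop}
    (hJ : r.IsJoin J) (hex : ∀ {ρ : r.Sx}, r.defect ρ = 1 → ∃ μ, J μ ρ) (n m : ℤ) (τ : X.Simplex)
    (μ : r.Sx) :
    coeffFrom r.map.onSimplex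
      (assembleMap r.map.onSimplex (eMat M hJ n m) ≫ project r M (fun _ => True) m) τ μ =
    if h : r.deg Kind.upper n μ = m ∧ r.defect μ = 1 ∧ r.map.onSimplex μ = τ then
      castHom M h.1 h.2.2 else 0 := by
  rw [coeffFrom_comp]
  by_cases h : r.deg Kind.upper n μ = m ∧ r.defect μ = 1 ∧ r.map.onSimplex μ = τ
  · obtain ⟨h1, h2, h3⟩ := h
    obtain ⟨ν, hν⟩ := hex h2
    have hm : m + 1 = n := by
      simp only [deg, degOf, h2] at h1
      omega
    rw [dif_pos ⟨h1, h2, h3⟩, finsum_eq_single _ ν]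
    · rw [coeff_assembleMap, eMat_entry (k := Kind.upper) hJ ⟨hm, hν⟩, coeffFrom_project, if_pos trivial]
      have e : retraction r M m ν τ = castHom M _ _ := dif_pos ⟨(hJ.map_eq hν).trans h3, hJ.left hν⟩
      rw [e, castHom_comp_castHom]
    · intro ξ hξ
      rw [coeff_assembleMap, eMat_entry_neg (k := Kind.upper) hJ fun h => hξ (hJ.unique_left h.2 hν), zero_comp]
  · rw [dif_neg h]
    refine finsum_eq_zero_of_forall_eq_zero fun ν => ?_
    rw [coeff_assembleMap, coeffFrom_project, if_pos trivial]
    by_cases hν : m + 1 = n ∧ joins Kind.upper J ν μ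
    · have hν' : J ν μ := hν.2
      have e : retraction r M m ν τ = 0 := dif_neg fun h' => h
        ⟨by simp only [deg, degOf, hJ.right hν']; omega, hJ.right hν',
          (hJ.map_eq hν').symm.trans h'.1⟩
      rw [e, comp_zero]
    · rw [eMat_entry_neg hJ hν, zero_comp]

theorem coeffTo_embed_eMat {M : ℤ → Ctrl Kind.lower X 𝒜} {J : r.Sx → r.Sx → Prop}
    (hJ : r.IsJoin J) (hex : ∀ {ρ : r.Sx}, r.defect ρ = 1 → ∃ μ, J μ ρ) (n m : ℤ) (ρ : r.Sx)
    (σ : X.Simplex) :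
    coeffTo r.map.onSimplex
      (embed r M (fun _ => True) n ≫ assembleMap r.map.onSimplex (eMat M hJ n m)) ρ σ =
    if h : n = r.deg Kind.lower m ρ ∧ r.defect ρ = 1 ∧ σ = r.map.onSimplex ρ then
      castHom M h.1 h.2.2 else 0 := by
  rw [coeffTo_comp]
  by_cases h : n = r.deg Kind.lower m ρ ∧ r.defect ρ = 1 ∧ σ = r.map.onSimplex ρ
  · obtain ⟨h1, h2, h3⟩ := h
    obtain ⟨ν, hν⟩ := hex h2
    have hm : m + 1 = n := by
      simp only [deg, degOf, h2] at h1
      omega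
    rw [dif_pos ⟨h1, h2, h3⟩, finsum_eq_single _ ν]
    · rw [coeff_assembleMap, eMat_entry (k := Kind.lower) hJ ⟨hm, hν⟩, coeffTo_embed, if_pos trivial]
      have e : inclusion r M n ν σ = castHom M _ _ :=
        dif_pos ⟨(hJ.map_eq hν).trans h3.symm, hJ.left hν⟩
      rw [e, castHom_comp_castHom]
    · intro ξ hξ
      rw [coeff_assembleMap, eMat_entry_neg (k := Kind.lower) hJ fun h => hξ (hJ.unique_left h.2 hν), comp_zero]
  · rw [dif_neg h]
    refine finsum_eq_zero_of_forall_eq_zero fun ν => ?_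
    rw [coeff_assembleMap, coeffTo_embed, if_pos trivial]
    by_cases hν : m + 1 = n ∧ joins Kind.lower J ρ ν
    · have hν' : J ν ρ := hν.2
      have e : inclusion r M n ν σ = 0 := dif_neg fun h' => h
        ⟨by simp only [deg, degOf, hJ.right hν']; omega, hJ.right hν',
          h'.1.symm.trans (hJ.map_eq hν')⟩
      rw [e, zero_comp]
    · rw [eMat_entry_neg hJ hν, comp_zero]

/-- A summand of defect one is mapped to two summands of defect zero with opposite signs, which
are both projected identically. -/
theorem diagonalPart_project {M : ℤ → Ctrl Kind.upper X 𝒜} (n m : ℤ) :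
    diagonalPart r M n m ≫ project r M (fun _ => True) m = 0 := by
  rw [diagonalPart_eq, Preadditive.sub_comp, sub_eq_zero]
  refine coeffFrom_ext fun τ μ => ?_
  rw [coeffFrom_eMat_project isJoin_image exists_joinImage_of_defect,
    coeffFrom_eMat_project isJoin_bary exists_joinBary_of_defect]

theorem embed_diagonalPart {M : ℤ → Ctrl Kind.lower X 𝒜} (n m : ℤ) :
    embed r M (fun _ => True) n ≫ diagonalPart r M n m = 0 := by
  rw [diagonalPart_eq, Preadditive.comp_sub, sub_eq_zero]
  refine coeffTo_ext fun ρ σ => ?_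
  rw [coeffTo_embed_eMat isJoin_image exists_joinImage_of_defect,
    coeffTo_embed_eMat isJoin_bary exists_joinBary_of_defect]

/-- The projection commutes with the matrices `tMat`, because a simplex of defect zero has exactly one
face over each face of its image. -/
theorem tMat_project {M N : ℤ → Ctrl Kind.upper X 𝒜} (F : ∀ i j, M i ⟶ N j) (n m : ℤ) :
    assembleMap r.map.onSimplex (tMat F n m) ≫ project r N (fun _ => True) m =
      project r M (fun _ => True) n ≫ F n m := by
  refine coeffFrom_ext fun τ μ => ?_
  rw [coeffFrom_comp, coeffFrom_comp_base]
  by_cases hμ : r.defect μ = 0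
  · have eR : ∑ᶠ ξ, coeffFrom r.map.onSimplex (project r M (fun _ => True) n) ξ μ ≫
        Controlled.entry (F n m) τ ξ =
        castHom M (deg_of_defect n hμ) rfl ≫ Controlled.entry (F n m) τ (r.map.onSimplex μ) := by
      rw [finsum_eq_single _ (r.map.onSimplex μ)]
      · rw [coeffFrom_project, if_pos trivial]
        congr 1
        exact dif_pos ⟨rfl, hμ⟩
      · intro ξ hξ
        rw [coeffFrom_project, if_pos trivial]
        have e : retraction r M n μ ξ = 0 := dif_neg fun h => hξ h.1.symm
        rw [e, zero_comp]
    rw [eR, castHom_entry]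
    by_cases hτ : τ ≤ r.map.onSimplex μ
    · obtain ⟨ν, ⟨h1, h2⟩, hu⟩ := existsUnique_face hμ hτ
      have hν : r.defect ν = 0 := defect_eq_zero_of_le h1 hμ
      rw [finsum_eq_single _ ν]
      · rw [coeff_assembleMap, coeffFrom_project, if_pos trivial,
          tMat_entry F n m ⟨h1, hν.trans hμ.symm⟩]
        have e : retraction r N m ν τ = castHom N (deg_of_defect m hν) h2 := dif_pos ⟨h2, hν⟩
        rw [e, entry_castHom]
      · intro ξ hξ
        rw [coeff_assembleMap, coeffFrom_project, if_pos trivial]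
        by_cases hξ' : ξ ≤ μ
        · have e : retraction r N m ξ τ = 0 := dif_neg fun h => hξ (hu ξ ⟨hξ', h.1⟩)
          rw [e, comp_zero]
        · rw [tMat_entry_neg F n m fun h => hξ' h.1, zero_comp]
    · rw [Controlled.entry_eq_zero (k := Kind.upper) _ hτ]
      refine finsum_eq_zero_of_forall_eq_zero fun ξ => ?_
      rw [coeff_assembleMap, coeffFrom_project, if_pos trivial]
      by_cases hξ : ξ ≤ μ
      · have e : retraction r N m ξ τ = 0 :=
          dif_neg fun h => hτ (by rw [← h.1]; exact r.map.onSimplex.monotone hξ)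
        rw [e, comp_zero]
      · rw [tMat_entry_neg F n m fun h => hξ h.1, zero_comp]
  · refine (finsum_eq_zero_of_forall_eq_zero fun ξ => ?_).trans
      (finsum_eq_zero_of_forall_eq_zero fun ξ => ?_).symm
    · rw [coeff_assembleMap]
      by_cases h : Kind.upper.allows ξ μ ∧ r.defect ξ = r.defect μ
      · rw [coeffFrom_project_eq_zero m τ (by rw [h.2]; exact hμ), comp_zero]
      · rw [tMat_entry_neg F n m h, zero_comp]
    · rw [coeffFrom_project_eq_zero n ξ hμ, zero_comp]

theorem embed_tMat {M N : ℤ → Ctrl Kind.lower X 𝒜} (F : ∀ i j, M i ⟶ N j) (n m : ℤ) :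
    embed r M (fun _ => True) n ≫ assembleMap r.map.onSimplex (tMat F n m) =
      F n m ≫ embed r N (fun _ => True) m := by
  refine coeffTo_ext fun ρ σ => ?_
  rw [coeffTo_comp, coeffTo_base_comp]
  by_cases hρ : r.defect ρ = 0
  · have eR : ∑ᶠ ξ, Controlled.entry (F n m) ξ σ ≫
        coeffTo r.map.onSimplex (embed r N (fun _ => True) m) ρ ξ =
        Controlled.entry (F n m) (r.map.onSimplex ρ) σ ≫
          castHom N (deg_of_defect m hρ).symm rfl := by
      rw [finsum_eq_single _ (r.map.onSimplex ρ)]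
      · rw [coeffTo_embed, if_pos trivial]
        congr 1
        exact dif_pos ⟨rfl, hρ⟩
      · intro ξ hξ
        rw [coeffTo_embed, if_pos trivial]
        have e : inclusion r N m ρ ξ = 0 := dif_neg fun h => hξ h.1.symm
        rw [e, comp_zero]
    rw [eR, entry_castHom]
    by_cases hσ : σ ≤ r.map.onSimplex ρ
    · obtain ⟨ν, ⟨h1, h2⟩, hu⟩ := existsUnique_face hρ hσ
      have hν : r.defect ν = 0 := defect_eq_zero_of_le h1 hρ
      rw [finsum_eq_single _ ν]
      · rw [coeff_assembleMap, coeffTo_embed, if_pos trivial,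
          tMat_entry F n m ⟨h1, hρ.trans hν.symm⟩]
        have e : inclusion r M n ν σ = castHom M (deg_of_defect n hν).symm h2.symm :=
          dif_pos ⟨h2, hν⟩
        rw [e, castHom_entry]
      · intro ξ hξ
        rw [coeff_assembleMap, coeffTo_embed, if_pos trivial]
        by_cases hξ' : ξ ≤ ρ
        · have e : inclusion r M n ξ σ = 0 := dif_neg fun h => hξ (hu ξ ⟨hξ', h.1⟩)
          rw [e, zero_comp]
        · rw [tMat_entry_neg F n m fun h => hξ' h.1, comp_zero]
    · rw [Controlled.entry_eq_zero (k := Kind.lower) _ hσ]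
      refine finsum_eq_zero_of_forall_eq_zero fun ξ => ?_
      rw [coeff_assembleMap, coeffTo_embed, if_pos trivial]
      by_cases hξ : ξ ≤ ρ
      · have e : inclusion r M n ξ σ = 0 :=
          dif_neg fun h => hσ (by rw [← h.1]; exact r.map.onSimplex.monotone hξ)
        rw [e, zero_comp]
      · rw [tMat_entry_neg F n m fun h => hξ h.1, comp_zero]
  · refine (finsum_eq_zero_of_forall_eq_zero fun ξ => ?_).trans
      (finsum_eq_zero_of_forall_eq_zero fun ξ => ?_).symm
    · rw [coeff_assembleMap]
      by_cases h : Kind.lower.allows ρ ξ ∧ r.defect ρ = r.defect ξ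
      · rw [coeffTo_embed_eq_zero n σ (by rw [← h.2]; exact hρ), zero_comp]
      · rw [tMat_entry_neg F n m h, comp_zero]
    · rw [coeffTo_embed_eq_zero m ξ hρ, comp_zero]

end Approx

end Centres

/-! ### Homotopy equivalences from contractions of the diagonal part of the differential -/

section Perturbation

variable {𝒞 : Type u} [Category.{v} 𝒞] [Preadditive 𝒞]

/-- A chain complex whose differential is the sum of a part `e` and a perturbation `t`, together
with a map `h` of degree one, intended as a contraction of `e` onto a direct summand. -/
structure PerturbedContraction (E : ChainComplex 𝒞 ℤ) where
  /-- the contraction -/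
  h : ∀ n m, E.X n ⟶ E.X m
  /-- the perturbation -/
  t : ∀ n m, E.X n ⟶ E.X m
  /-- the unperturbed differential -/
  e : ∀ n m, E.X n ⟶ E.X m
  d_eq : ∀ n m, m + 1 = n → E.d n m = t n m + e n m
  shape : ∀ n m, ¬ n + 1 = m → h n m = 0
  h_h : ∀ n m l, h n m ≫ h m l = 0
  h_t_h : ∀ n m l j, h n m ≫ t m l ≫ h l j = 0
  t_e : ∀ n m l, m + 1 = n → l + 1 = m → t n m ≫ e m l = - (e n m ≫ t m l)

namespace PerturbedContraction

variable {E C : ChainComplex 𝒞 ℤ} (W : PerturbedContraction E)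

/-- The chain map `1 - (d h + h d)`, which is homotopic to the identity. -/
def projector : E ⟶ E := 𝟙 E - Homotopy.nullHomotopicMap W.h

/-- The homotopy between the identity and the projector. -/
def projectorHomotopy : Homotopy (𝟙 E) W.projector :=
  Homotopy.equivSubZero.symm ((Homotopy.ofEq (by unfold projector; abel)).trans
    (Homotopy.nullHomotopy W.h fun i j hij => W.shape i j hij))

/-- The map `1 - (e h + h e)`, which is left if the perturbation is disregarded. -/
def remainder (n : ℤ) : E.X n ⟶ E.X n :=
  𝟙 _ - (W.e n (n - 1) ≫ W.h (n - 1) n + W.h n (n + 1) ≫ W.e (n + 1) n)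

theorem projector_f (n : ℤ) : W.projector.f n = W.remainder n -
    (W.t n (n - 1) ≫ W.h (n - 1) n + W.h n (n + 1) ≫ W.t (n + 1) n) := by
  have h1 : (ComplexShape.down ℤ).Rel n (n - 1) := by simp
  have h2 : (ComplexShape.down ℤ).Rel (n + 1) n := by simp
  unfold projector remainder
  rw [HomologicalComplex.sub_f_apply, Homotopy.nullHomotopicMap_f h2 h1,
    W.d_eq n (n - 1) (by ring), W.d_eq (n + 1) n rfl, Preadditive.add_comp, Preadditive.comp_add]
  simp only [HomologicalComplex.id_f]
  abel

theorem e_h (n : ℤ) : W.e n (n - 1) ≫ W.h (n - 1) n =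
    𝟙 _ - W.remainder n - W.h n (n + 1) ≫ W.e (n + 1) n := by
  unfold remainder
  abel

theorem h_e (n : ℤ) : W.h n (n + 1) ≫ W.e (n + 1) n =
    𝟙 _ - W.remainder n - W.e n (n - 1) ≫ W.h (n - 1) n := by
  unfold remainder
  abel

theorem e_h' {n m : ℤ} (hm : n + 1 = m) : W.e m n ≫ W.h n m =
    𝟙 _ - W.remainder m - W.h m (m + 1) ≫ W.e (m + 1) m := by
  obtain rfl : m - 1 = n := by omega
  exact W.e_h m

theorem h_e' {n m : ℤ} (hm : m + 1 = n) : W.h m n ≫ W.e n m =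
    𝟙 _ - W.remainder m - W.e m (m - 1) ≫ W.h (m - 1) m := by
  subst hm
  exact W.h_e m

/-- If the remainder is an idempotent that vanishes after `h` and after `h` followed by `t`, then the
projector vanishes after `e h + h e`. -/
theorem remainder_projector (n : ℤ) (h1 : W.remainder n ≫ W.remainder n = W.remainder n)
    (h2 : ∀ n m, W.h n m ≫ W.remainder m = 0)
    (h3 : ∀ n m l, W.h n m ≫ W.t m l ≫ W.remainder l = 0) :
    W.remainder n ≫ W.projector.f n = W.projector.f n := by
  have hx : W.e n (n - 1) ≫ W.h (n - 1) n ≫ W.projector.f n = 0 := by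
    rw [projector_f, Preadditive.comp_sub, Preadditive.comp_add, h2, W.h_t_h,
      ← Category.assoc (W.h (n - 1) n), W.h_h]
    simp
  have hy : W.h n (n + 1) ≫ W.e (n + 1) n ≫ W.projector.f n = 0 := by
    -- `e` and `t` anticommute, after which `e h` is `1 - remainder - h e`, whose last two terms vanish.
    have ea : W.h n (n + 1) ≫ W.e (n + 1) n ≫ W.t n (n - 1) ≫ W.h (n - 1) n =
        - W.h n (n + 1) ≫ W.t (n + 1) n := by
      have := W.t_e (n + 1) n (n - 1) rfl (by ring)
      rw [← Category.assoc (W.e (n + 1) n), ← neg_eq_iff_eq_neg.2 this, Preadditive.neg_comp,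
        Preadditive.comp_neg, Category.assoc, e_h]
      simp only [Preadditive.comp_sub, Category.comp_id, h3, sub_zero]
      rw [← Category.assoc (W.t _ _), ← Category.assoc (W.h _ _) (W.t _ _ ≫ _), W.h_t_h,
        zero_comp, sub_zero]
    -- The side conditions give `h e h = h`.
    have eb : W.h n (n + 1) ≫ W.e (n + 1) n ≫ W.h n (n + 1) ≫ W.t (n + 1) n =
        W.h n (n + 1) ≫ W.t (n + 1) n := by
      rw [← Category.assoc (W.e (n + 1) n), W.e_h' rfl]
      simp only [Preadditive.sub_comp, Preadditive.comp_sub, Category.id_comp]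
      rw [← Category.assoc _ (W.remainder _), h2, Category.assoc (W.h _ _),
        ← Category.assoc (W.h n _), W.h_h]
      simp
    have er : W.h n (n + 1) ≫ W.e (n + 1) n ≫ W.remainder n = 0 := by
      rw [← Category.assoc, h_e]
      simp only [Preadditive.sub_comp, Category.id_comp, Category.assoc, h1, h2, comp_zero,
        sub_self]
    rw [projector_f, Preadditive.comp_sub, Preadditive.comp_sub, er, Preadditive.comp_add,
      Preadditive.comp_add, ea, eb]
    simp
  have : W.remainder n = 𝟙 _ - (W.e n (n - 1) ≫ W.h (n - 1) n + W.h n (n + 1) ≫ W.e (n + 1) n) :=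
    rfl
  rw [this, Preadditive.sub_comp, Preadditive.add_comp, Category.assoc, Category.assoc, hx, hy]
  simp

/-- The dual of `remainder_projector`. -/
theorem projector_remainder (n : ℤ) (h1 : W.remainder n ≫ W.remainder n = W.remainder n)
    (h2 : ∀ n m, W.remainder n ≫ W.h n m = 0)
    (h3 : ∀ n m l, W.remainder n ≫ W.t n m ≫ W.h m l = 0) :
    W.projector.f n ≫ W.remainder n = W.projector.f n := by
  have hy : W.projector.f n ≫ W.h n (n + 1) ≫ W.e (n + 1) n = 0 := by
    rw [← Category.assoc, projector_f, Preadditive.sub_comp, Preadditive.add_comp, h2,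
      Category.assoc, Category.assoc, W.h_t_h, W.h_h]
    simp
  have hx : W.projector.f n ≫ W.e n (n - 1) ≫ W.h (n - 1) n = 0 := by
    have ea : W.t n (n - 1) ≫ W.h (n - 1) n ≫ W.e n (n - 1) ≫ W.h (n - 1) n =
        W.t n (n - 1) ≫ W.h (n - 1) n := by
      rw [← Category.assoc (W.h (n - 1) n), W.h_e' (by ring)]
      simp only [Preadditive.sub_comp, Preadditive.comp_sub, Category.id_comp]
      rw [h2, Category.assoc, W.h_h]
      simp
    have eb : W.h n (n + 1) ≫ W.t (n + 1) n ≫ W.e n (n - 1) ≫ W.h (n - 1) n =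
        - W.t n (n - 1) ≫ W.h (n - 1) n := by
      rw [← Category.assoc (W.t (n + 1) n), W.t_e (n + 1) n (n - 1) rfl (by ring),
        Preadditive.neg_comp, Preadditive.comp_neg, Category.assoc, ← Category.assoc (W.h n _),
        h_e]
      simp only [Preadditive.sub_comp, Category.id_comp, Category.assoc, h3, W.h_t_h, comp_zero,
        sub_zero]
    have er : W.remainder n ≫ W.e n (n - 1) ≫ W.h (n - 1) n = 0 := by
      rw [e_h]
      simp only [Preadditive.comp_sub, Category.comp_id, h1, sub_self, zero_sub]
      rw [← Category.assoc, h2]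
      simp
    rw [projector_f, Preadditive.sub_comp, er, Preadditive.add_comp, Category.assoc,
      Category.assoc, ea, eb]
    simp
  have : W.remainder n = 𝟙 _ - (W.e n (n - 1) ≫ W.h (n - 1) n + W.h n (n + 1) ≫ W.e (n + 1) n) :=
    rfl
  rw [this, Preadditive.comp_sub, Preadditive.comp_add, hx, hy]
  simp

/-- If the contraction retracts `(E, e)` to `C`, and the retraction `φ` is a chain map for the
perturbed differential, then `φ` is a homotopy equivalence. -/
theorem exists_homotopyEquiv_of_retraction (φ : E ⟶ C) (i : ∀ n, C.X n ⟶ E.X n)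
    (hi : ∀ n, i n ≫ φ.f n = 𝟙 _) (hr : ∀ n, W.remainder n = φ.f n ≫ i n)
    (hφ : ∀ n m, W.h n m ≫ φ.f m = 0)
    (tφ : ∀ n m, W.t n m ≫ φ.f m = φ.f n ≫ C.d n m) :
    ∃ e : HomotopyEquiv E C, e.hom = φ := by
  have key : ∀ n, φ.f n ≫ i n ≫ W.projector.f n = W.projector.f n := by
    intro n
    rw [← Category.assoc, ← hr]
    refine W.remainder_projector n ?_ ?_ ?_
    · rw [hr, Category.assoc, ← Category.assoc (i n), hi, Category.id_comp]
    · intro n m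
      rw [hr, ← Category.assoc, hφ, zero_comp]
    · intro n m l
      rw [hr, ← Category.assoc (W.t m l), tφ, Category.assoc, ← Category.assoc, hφ, zero_comp]
  -- It suffices to check that `ψ` is a chain map after composing with the split epimorphism `φ`.
  let ψ : C ⟶ E :=
    { f := fun n => i n ≫ W.projector.f n
      comm' := fun n m _ => by
        have e : φ.f n ≫ (i n ≫ W.projector.f n) ≫ E.d n m =
            φ.f n ≫ C.d n m ≫ i m ≫ W.projector.f m := by
          rw [← Category.assoc, key, φ.comm_assoc, key, W.projector.comm]
        have e' := congrArg (fun x => i n ≫ x) e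
        rwa [← Category.assoc (i n), ← Category.assoc (i n), hi, Category.id_comp,
          Category.id_comp] at e' }
  have h1 : φ ≫ ψ = W.projector := by
    ext n : 1
    exact key n
  have h2 : ψ ≫ φ = 𝟙 C := by
    ext n : 1
    change (i n ≫ W.projector.f n) ≫ φ.f n = 𝟙 _
    rw [projector_f, hr, Category.assoc, Preadditive.sub_comp, Preadditive.add_comp,
      Category.assoc, hi, Category.comp_id, Category.assoc, Category.assoc, hφ, tφ,
      ← Category.assoc (W.h _ _), hφ]
    simp [hi]
  exact ⟨⟨φ, ψ, (Homotopy.ofEq h1).trans W.projectorHomotopy.symm, Homotopy.ofEq h2⟩, rfl⟩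

/-- If the contraction retracts `(E, e)` to `C`, and the inclusion `φ` is a chain map for the
perturbed differential, then `φ` is a homotopy equivalence. -/
theorem exists_homotopyEquiv_of_inclusion (φ : C ⟶ E) (i : ∀ n, E.X n ⟶ C.X n)
    (hi : ∀ n, φ.f n ≫ i n = 𝟙 _) (hr : ∀ n, W.remainder n = i n ≫ φ.f n)
    (hφ : ∀ n m, φ.f n ≫ W.h n m = 0)
    (tφ : ∀ n m, φ.f n ≫ W.t n m = C.d n m ≫ φ.f m) :
    ∃ e : HomotopyEquiv C E, e.hom = φ := by
  have key : ∀ n, W.projector.f n ≫ i n ≫ φ.f n = W.projector.f n := by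
    intro n
    rw [← hr]
    refine W.projector_remainder n ?_ ?_ ?_
    · rw [hr, Category.assoc, ← Category.assoc (φ.f n), hi, Category.id_comp]
    · intro n m
      rw [hr, Category.assoc, hφ, comp_zero]
    · intro n m l
      rw [hr, Category.assoc, ← Category.assoc (φ.f n), tφ, Category.assoc, hφ, comp_zero,
        comp_zero]
  -- It suffices to check that `ψ` is a chain map after composing with the split monomorphism `φ`.
  let ψ : E ⟶ C :=
    { f := fun n => W.projector.f n ≫ i n
      comm' := fun n m _ => by
        have e : ((W.projector.f n ≫ i n) ≫ C.d n m) ≫ φ.f m =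
            (E.d n m ≫ W.projector.f m ≫ i m) ≫ φ.f m := by
          simp only [Category.assoc]
          rw [key, ← φ.comm, ← W.projector.comm, ← Category.assoc (i n),
            ← Category.assoc (W.projector.f n), key]
        have e' := congrArg (fun x => x ≫ i m) e
        rwa [Category.assoc _ (φ.f m), Category.assoc _ (φ.f m), hi, Category.comp_id,
          Category.comp_id] at e' }
  have h1 : ψ ≫ φ = W.projector := by
    ext n : 1
    exact (Category.assoc _ _ _).trans (key n)
  have h2 : φ ≫ ψ = 𝟙 C := by
    ext n : 1
    change φ.f n ≫ W.projector.f n ≫ i n = 𝟙 _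
    rw [projector_f, hr, ← Category.assoc, Preadditive.comp_sub, Preadditive.comp_add,
      ← Category.assoc (φ.f n), hi, Category.id_comp, ← Category.assoc (φ.f n) (W.h _ _), hφ,
      ← Category.assoc (φ.f n) (W.t _ _), tφ, Category.assoc, hφ]
    simp [hi]
  exact ⟨⟨φ, ψ, Homotopy.ofEq h2, (Homotopy.ofEq h1).trans W.projectorHomotopy.symm⟩, rfl⟩

end PerturbedContraction

end Perturbation

/-! ### A single subdivision -/

namespace Centres

namespace Approx

variable {X : FLComplex.{u}} {S : Centres X} {r : S.Approx} {k : Kind}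
  {𝒜 : Type v} [Category.{w} 𝒜] [Preadditive 𝒜] [HasFiniteBiproducts 𝒜]

variable (r) in
/-- The chain complex `R_r Sd_r C`. -/
abbrev assembledSd (C : ChainComplex (Ctrl k X 𝒜) ℤ) : ChainComplex (Ctrl k X 𝒜) ℤ :=
  ((assemble k 𝒜 r.map.onSimplex).mapHomologicalComplex _).obj (sdComplex r C)

theorem assembledSd_d (C : ChainComplex (Ctrl k X 𝒜) ℤ) (n m : ℤ) :
    (assembledSd r C).d n m = assembleMap r.map.onSimplex (tMat C.d n m) +
      n.negOnePow • diagonalPart r C.X n m := by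
  change (assemble k 𝒜 r.map.onSimplex).map (sdD r C n m) = _
  rw [sdD_eq, Functor.map_add, Units.smul_def, Functor.map_zsmul]
  rfl

variable (r) in
/-- The differential of `R_r Sd_r C` as a perturbation of its part on the diagonal. -/
def sdContraction (C : ChainComplex (Ctrl k X 𝒜) ℤ) :
    PerturbedContraction (assembledSd r C) where
  h n m := m.negOnePow • contraction r C.X n m
  t n m := assembleMap r.map.onSimplex (tMat C.d n m)
  e n m := n.negOnePow • diagonalPart r C.X n m
  d_eq n m _ := assembledSd_d C n m
  shape n m h := by
    have e : m.negOnePow • contraction r C.X n m = 0 := by rw [contraction_shape h, smul_zero]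
    exact e
  h_h n m l := by
    have e : (m.negOnePow • contraction r C.X n m) ≫ (l.negOnePow • contraction r C.X m l) = 0 := by
      simp only [Units.smul_def, Preadditive.zsmul_comp, Preadditive.comp_zsmul]
      rw [contraction_contraction, smul_zero, smul_zero]
    exact e
  h_t_h n m l j := by
    have e : (m.negOnePow • contraction r C.X n m) ≫
        assembleMap r.map.onSimplex (tMat C.d m l) ≫ (j.negOnePow • contraction r C.X l j) = 0 := by
      simp only [Units.smul_def, Preadditive.zsmul_comp, Preadditive.comp_zsmul]
      rw [contraction_tMat_contraction, smul_zero, smul_zero]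
    exact e
  t_e n m l hm hl := by
    have e : assembleMap r.map.onSimplex (tMat C.d n m) ≫ diagonalPart r C.X m l =
        diagonalPart r C.X n m ≫ assembleMap r.map.onSimplex (tMat C.d m l) := by
      unfold diagonalPart
      rw [← assembleMap_comp, ← assembleMap_comp, t_eDiff C.d hl hm]
    have e' : assembleMap r.map.onSimplex (tMat C.d n m) ≫ (m.negOnePow • diagonalPart r C.X m l) =
        - ((n.negOnePow • diagonalPart r C.X n m) ≫
          assembleMap r.map.onSimplex (tMat C.d m l)) := by
      rw [← hm, Int.negOnePow_succ, hm]
      simp only [Units.smul_def, Preadditive.zsmul_comp, Preadditive.comp_zsmul, Units.val_neg,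
        neg_smul, Preadditive.neg_comp, neg_neg, e]
    exact e'

theorem remainder_sdContraction (C : ChainComplex (Ctrl k X 𝒜) ℤ) (n : ℤ) :
    (sdContraction r C).remainder n =
      𝟙 _ - (diagonalPart r C.X n (n - 1) ≫ contraction r C.X (n - 1) n +
        contraction r C.X n (n + 1) ≫ diagonalPart r C.X (n + 1) n) := by
  have h : ∀ a : ℤ, ((a.negOnePow : ℤˣ) : ℤ) * (a.negOnePow : ℤˣ) = 1 := fun a => by
    rw [← Units.val_mul, Int.units_mul_self, Units.val_one]
  have e1 : (sdContraction r C).e n (n - 1) ≫ (sdContraction r C).h (n - 1) n =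
      diagonalPart r C.X n (n - 1) ≫ contraction r C.X (n - 1) n := by
    change (n.negOnePow • diagonalPart r C.X n (n - 1)) ≫
      (n.negOnePow • contraction r C.X (n - 1) n) = _
    simp only [Units.smul_def, Preadditive.zsmul_comp, Preadditive.comp_zsmul, smul_smul, h,
      one_smul]
  have e2 : (sdContraction r C).h n (n + 1) ≫ (sdContraction r C).e (n + 1) n =
      contraction r C.X n (n + 1) ≫ diagonalPart r C.X (n + 1) n := by
    change ((n + 1).negOnePow • contraction r C.X n (n + 1)) ≫
      ((n + 1).negOnePow • diagonalPart r C.X (n + 1) n) = _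
    simp only [Units.smul_def, Preadditive.zsmul_comp, Preadditive.comp_zsmul, smul_smul, h,
      one_smul]
  unfold PerturbedContraction.remainder
  rw [e1, e2]
  rfl

variable (r) in
/-- The chain map `R_r Sd_r C ⟶ C`, which is the identity on the summands of the same dimension as
their image. -/
def upperMap (C : ChainComplex (Ctrl Kind.upper X 𝒜) ℤ) : assembledSd r C ⟶ C where
  f n := project r C.X (fun _ => True) n
  comm' n m _ := by
    rw [assembledSd_d]
    have e : (assembleMap r.map.onSimplex (tMat C.d n m) +
        n.negOnePow • diagonalPart r C.X n m) ≫ project r C.X (fun _ => True) m =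
        project r C.X (fun _ => True) n ≫ C.d n m := by
      rw [Preadditive.add_comp, Units.smul_def, Preadditive.zsmul_comp, diagonalPart_project,
        smul_zero, add_zero, tMat_project]
    exact e.symm

variable (r) in
/-- The chain map `C ⟶ R_r Sd_r C`, which is the identity to the summands of the same dimension as
their image. -/
def lowerMap (C : ChainComplex (Ctrl Kind.lower X 𝒜) ℤ) : C ⟶ assembledSd r C where
  f n := embed r C.X (fun _ => True) n
  comm' n m _ := by
    rw [assembledSd_d]
    have e : embed r C.X (fun _ => True) n ≫ (assembleMap r.map.onSimplex (tMat C.d n m) +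
        n.negOnePow • diagonalPart r C.X n m) = C.d n m ≫ embed r C.X (fun _ => True) m := by
      rw [Preadditive.comp_add, Units.smul_def, Preadditive.comp_zsmul, embed_diagonalPart,
        smul_zero, add_zero, embed_tMat]
    exact e

theorem upperMap_naturality {C D : ChainComplex (Ctrl Kind.upper X 𝒜) ℤ} (f : C ⟶ D) :
    ((assemble Kind.upper 𝒜 r.map.onSimplex).mapHomologicalComplex _).map (sdMap r f) ≫
      upperMap r D = upperMap r C ≫ f := by
  ext n : 1
  change assembleMap r.map.onSimplex (sdF r f n) ≫ project r D.X (fun _ => True) n =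
    project r C.X (fun _ => True) n ≫ f.f n
  rw [sdF_eq, tMat_project, family_self]

theorem lowerMap_naturality {C D : ChainComplex (Ctrl Kind.lower X 𝒜) ℤ} (f : C ⟶ D) :
    f ≫ lowerMap r D = lowerMap r C ≫
      ((assemble Kind.lower 𝒜 r.map.onSimplex).mapHomologicalComplex _).map (sdMap r f) := by
  ext n : 1
  change f.f n ≫ embed r D.X (fun _ => True) n =
    embed r C.X (fun _ => True) n ≫ assembleMap r.map.onSimplex (sdF r f n)
  rw [sdF_eq, embed_tMat, family_self]

theorem exists_homotopyEquiv_upperMap (C : ChainComplex (Ctrl Kind.upper X 𝒜) ℤ) :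
    ∃ e : HomotopyEquiv (assembledSd r C) C, e.hom = upperMap r C := by
  refine (sdContraction r C).exists_homotopyEquiv_of_retraction (upperMap r C)
    (fun n => embed r C.X (fun ρ => ρ = r.canonicalLift (r.map.onSimplex ρ)) n)
    (fun n => embed_project (fun ρ => by rw [and_true]) n) (fun n => ?_) (fun n m => ?_)
    (fun n m => tMat_project C.d n m)
  · rw [remainder_sdContraction, diagonal_homotopy_upper (by ring) rfl]
    exact sub_sub_cancel _ _
  · change (m.negOnePow • contraction r C.X n m) ≫ project r C.X (fun _ => True) m = 0
    rw [Units.smul_def, Preadditive.zsmul_comp, contraction_project, smul_zero]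

theorem exists_homotopyEquiv_lowerMap (C : ChainComplex (Ctrl Kind.lower X 𝒜) ℤ) :
    ∃ e : HomotopyEquiv C (assembledSd r C), e.hom = lowerMap r C := by
  refine (sdContraction r C).exists_homotopyEquiv_of_inclusion (lowerMap r C)
    (fun n => project r C.X (fun ρ => ρ = r.canonicalLift (r.map.onSimplex ρ)) n)
    (fun n => embed_project (A := fun _ => True) (fun ρ => by rw [true_and]) n) (fun n => ?_) (fun n m => ?_)
    (fun n m => embed_tMat C.d n m)
  · rw [remainder_sdContraction, diagonal_homotopy_lower (by ring) rfl]
    exact sub_sub_cancel _ _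
  · change embed r C.X (fun _ => True) n ≫ (m.negOnePow • contraction r C.X n m) = 0
    rw [Units.smul_def, Preadditive.comp_zsmul, embed_contraction, smul_zero]

variable (r 𝒜)

/-- The natural chain equivalence `R_r Sd_r C ⟶ C` for `𝒜^*`. -/
def upperEquivalence :
    r.Sd Kind.upper 𝒜 ⋙ assembly Kind.upper r.map 𝒜 ⟶ 𝟭 (FinComplex (Ctrl Kind.upper X 𝒜)) where
  app C := ObjectProperty.homMk (upperMap r C.obj)
  naturality _ _ f := ObjectProperty.hom_ext _ (upperMap_naturality f.hom)

/-- The natural chain equivalence `C ⟶ R_r Sd_r C` for `𝒜_*`. -/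
def lowerEquivalence :
    𝟭 (FinComplex (Ctrl Kind.lower X 𝒜)) ⟶ r.Sd Kind.lower 𝒜 ⋙ assembly Kind.lower r.map 𝒜 where
  app C := ObjectProperty.homMk (lowerMap r C.obj)
  naturality _ _ f := ObjectProperty.hom_ext _ (lowerMap_naturality f.hom)

theorem isChainEquiv_upperEquivalence (C : FinComplex (Ctrl Kind.upper X 𝒜)) :
    IsChainEquiv ((upperEquivalence r 𝒜).app C) :=
  exists_homotopyEquiv_upperMap C.obj

theorem isChainEquiv_lowerEquivalence (C : FinComplex (Ctrl Kind.lower X 𝒜)) :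
    IsChainEquiv ((lowerEquivalence r 𝒜).app C) :=
  exists_homotopyEquiv_lowerMap C.obj

theorem ι_upperEquivalence (C : FinComplex (Ctrl Kind.upper X 𝒜)) (n : ℤ) (τ σ : X.Simplex)
    (ρ : Fibre r.map.onSimplex σ) :
    assembleι r.map.onSimplex (((r.Sd Kind.upper 𝒜).obj C).obj.X n) ρ ≫
      Controlled.entry (((upperEquivalence r 𝒜).app C).hom.f n) τ σ =
    r.retraction C.obj.X n ρ.1 τ :=
  (ι_project (M := C.obj.X) (fun _ => True) n τ ρ).trans (if_pos trivial)

theorem lowerEquivalence_π (C : FinComplex (Ctrl Kind.lower X 𝒜)) (n : ℤ) (τ σ : X.Simplex)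
    (ρ : Fibre r.map.onSimplex σ) :
    Controlled.entry (((lowerEquivalence r 𝒜).app C).hom.f n) σ τ ≫
      assembleπ r.map.onSimplex (((r.Sd Kind.lower 𝒜).obj C).obj.X n) ρ =
    r.inclusion C.obj.X n ρ.1 τ :=
  (embed_π (M := C.obj.X) (fun _ => True) n ρ τ).trans (if_pos trivial)

end Approx

end Centres

/-! ### Iterated subdivisions -/

section ChainEquiv

variable {𝒞 : Type u} [Category.{v} 𝒞] [Preadditive 𝒞] {C D E : FinComplex 𝒞}

theorem IsChainEquiv.comp {f : C ⟶ D} {g : D ⟶ E} (hf : IsChainEquiv f) (hg : IsChainEquiv g) :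
    IsChainEquiv (f ≫ g) := by
  obtain ⟨a, ha⟩ := hf
  obtain ⟨b, hb⟩ := hg
  exact ⟨a.trans b, by rw [ObjectProperty.FullSubcategory.comp_hom, ← ha, ← hb]; rfl⟩

theorem isChainEquiv_of_iso (f : C ≅ D) : IsChainEquiv f.hom :=
  ⟨HomotopyEquiv.ofIso ((IsFiniteComplex 𝒞).ι.mapIso f), rfl⟩

theorem IsChainEquiv.map {𝒟 : Type u} [Category.{v} 𝒟] [Preadditive 𝒟] (F : 𝒞 ⥤ 𝒟) [F.Additive]
    {f : C ⟶ D} (hf : IsChainEquiv f) : IsChainEquiv ((mapFinComplex F).map f) := by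
  obtain ⟨a, ha⟩ := hf
  exact ⟨F.mapHomotopyEquiv a, congrArg (fun g => (F.mapHomologicalComplex _).map g) ha⟩

/-- Isomorphic additive functors induce isomorphic functors on finite chain complexes. -/
def mapFinComplexIso {𝒟 : Type u} [Category.{v} 𝒟] [Preadditive 𝒟] {F G : 𝒞 ⥤ 𝒟} [F.Additive]
    [G.Additive] (α : F ≅ G) : mapFinComplex F ≅ mapFinComplex G :=
  NatIso.ofComponents
    (fun C => ObjectProperty.isoMk _ ((NatIso.mapHomologicalComplex α _).app C.obj))
    fun f => ObjectProperty.hom_ext _ ((NatIso.mapHomologicalComplex α _).hom.naturality f.hom)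

variable (𝒞) in
/-- The functor induced by the identity on finite chain complexes is the identity. -/
def mapFinComplexIdIso : mapFinComplex (𝟭 𝒞) ≅ 𝟭 (FinComplex 𝒞) :=
  NatIso.ofComponents
    (fun C => ObjectProperty.isoMk _ ((Functor.mapHomologicalComplexIdIso 𝒞 _).app C.obj))
    fun f => ObjectProperty.hom_ext _
      ((Functor.mapHomologicalComplexIdIso 𝒞 _).hom.naturality f.hom)

end ChainEquiv

section IteratedAssembly

variable (k : Kind) (𝒜 : Type v) [Category.{w} 𝒜] [Preadditive 𝒜] [HasFiniteBiproducts 𝒜]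

/-- Assembly along the identity is the identity. -/
def assemblyIdIso (X : FLComplex.{u}) :
    assembly k (FiniteMap.id X) 𝒜 ≅ 𝟭 (FinComplex (Ctrl k X 𝒜)) :=
  mapFinComplexIso (assembleIdIso k 𝒜 (FiniteMap.id X).onSimplex
    fun _ => Subtype.ext Finset.image_id') ≪≫ mapFinComplexIdIso _

/-- Assembly along a composite is the composite of the assemblies. -/
def assemblyCompIso {Z Y X : FLComplex.{u}} (r : FiniteMap Y X) (q : FiniteMap Z Y) :
    assembly k (r.comp q) 𝒜 ≅ assembly k q 𝒜 ⋙ assembly k r 𝒜 :=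
  mapFinComplexIso (assembleCompIso k 𝒜 (r.comp q).onSimplex r.onSimplex q.onSimplex
    fun _ => Subtype.ext Finset.image_image)

end IteratedAssembly

namespace Iterated

variable {X : FLComplex.{u}} (𝒜 : Type v) [Category.{w} 𝒜] [Preadditive 𝒜] [HasFiniteBiproducts 𝒜]

theorem exists_equivalence_upper {X' : FLComplex.{u}} (h : Iterated X X') :
    ∃ Φ : h.Sd Kind.upper 𝒜 ⋙ assembly Kind.upper h.map 𝒜 ⟶
      𝟭 (FinComplex (Ctrl Kind.upper X 𝒜)), ∀ C, IsChainEquiv (Φ.app C) := by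
  induction h with
  | refl =>
    exact ⟨(assemblyIdIso Kind.upper 𝒜 X).hom, fun C =>
      isChainEquiv_of_iso ((assemblyIdIso Kind.upper 𝒜 X).app C)⟩
  | step h S r ih =>
    obtain ⟨Φ, hΦ⟩ := ih
    let α : h.Sd Kind.upper 𝒜 ⋙ r.Sd Kind.upper 𝒜 ⋙ assembly Kind.upper (h.map.comp r.map) 𝒜 ⟶
        h.Sd Kind.upper 𝒜 ⋙ r.Sd Kind.upper 𝒜 ⋙
          assembly Kind.upper r.map 𝒜 ⋙ assembly Kind.upper h.map 𝒜 :=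
      Functor.whiskerLeft _ (Functor.whiskerLeft _ (assemblyCompIso Kind.upper 𝒜 h.map r.map).hom)
    let β : h.Sd Kind.upper 𝒜 ⋙ (r.Sd Kind.upper 𝒜 ⋙ assembly Kind.upper r.map 𝒜) ⋙
        assembly Kind.upper h.map 𝒜 ⟶ h.Sd Kind.upper 𝒜 ⋙ 𝟭 _ ⋙ assembly Kind.upper h.map 𝒜 :=
      Functor.whiskerLeft _ (Functor.whiskerRight (r.upperEquivalence 𝒜) _)
    refine ⟨α ≫ β ≫ Φ, fun C => IsChainEquiv.comp ?_ (IsChainEquiv.comp ?_ (hΦ C))⟩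
    · exact isChainEquiv_of_iso ((assemblyCompIso Kind.upper 𝒜 h.map r.map).app _)
    · exact (r.isChainEquiv_upperEquivalence 𝒜 _).map _

theorem exists_equivalence_lower {X' : FLComplex.{u}} (h : Iterated X X') :
    ∃ Ψ : 𝟭 (FinComplex (Ctrl Kind.lower X 𝒜)) ⟶
      h.Sd Kind.lower 𝒜 ⋙ assembly Kind.lower h.map 𝒜, ∀ C, IsChainEquiv (Ψ.app C) := by
  induction h with
  | refl =>
    exact ⟨(assemblyIdIso Kind.lower 𝒜 X).inv, fun C =>
      isChainEquiv_of_iso ((assemblyIdIso Kind.lower 𝒜 X).app C).symm⟩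
  | step h S r ih =>
    obtain ⟨Ψ, hΨ⟩ := ih
    let α : h.Sd Kind.lower 𝒜 ⋙ r.Sd Kind.lower 𝒜 ⋙
          assembly Kind.lower r.map 𝒜 ⋙ assembly Kind.lower h.map 𝒜 ⟶
        h.Sd Kind.lower 𝒜 ⋙ r.Sd Kind.lower 𝒜 ⋙ assembly Kind.lower (h.map.comp r.map) 𝒜 :=
      Functor.whiskerLeft _ (Functor.whiskerLeft _ (assemblyCompIso Kind.lower 𝒜 h.map r.map).inv)
    let β : h.Sd Kind.lower 𝒜 ⋙ 𝟭 _ ⋙ assembly Kind.lower h.map 𝒜 ⟶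
        h.Sd Kind.lower 𝒜 ⋙ (r.Sd Kind.lower 𝒜 ⋙ assembly Kind.lower r.map 𝒜) ⋙
          assembly Kind.lower h.map 𝒜 :=
      Functor.whiskerLeft _ (Functor.whiskerRight (r.lowerEquivalence 𝒜) _)
    refine ⟨Ψ ≫ β ≫ α, fun C => IsChainEquiv.comp (hΨ C) (IsChainEquiv.comp ?_ ?_)⟩
    · exact (r.isChainEquiv_lowerEquivalence 𝒜 _).map _
    · exact isChainEquiv_of_iso ((assemblyCompIso Kind.lower 𝒜 h.map r.map).app _).symm

end Iterated

end GeomAlg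

end

theorem mainTheorem7 (X : FLComplex.{u}) (𝒜 : Type v) [Category.{w} 𝒜] [Preadditive 𝒜]
    [HasFiniteBiproducts 𝒜] :
    (∀ (S : Centres X) (r : S.Approx),
      (∃ Φ : r.Sd Kind.upper 𝒜 ⋙ assembly Kind.upper r.map 𝒜 ⟶ 𝟭 (FinComplex (Ctrl Kind.upper X 𝒜)),
        (∀ (C : FinComplex (Ctrl Kind.upper X 𝒜)) (n : ℤ) (τ σ : X.Simplex)
            (ρ : Fibre r.map.onSimplex σ),
          assembleι r.map.onSimplex (((r.Sd Kind.upper 𝒜).obj C).obj.X n) ρ ≫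
              Controlled.entry ((Φ.app C).hom.f n) τ σ
            = r.retraction C.obj.X n ρ.1 τ) ∧
        ∀ C, IsChainEquiv (Φ.app C)) ∧
      (∃ Ψ : 𝟭 (FinComplex (Ctrl Kind.lower X 𝒜)) ⟶ r.Sd Kind.lower 𝒜 ⋙ assembly Kind.lower r.map 𝒜,
        (∀ (C : FinComplex (Ctrl Kind.lower X 𝒜)) (n : ℤ) (τ σ : X.Simplex)
            (ρ : Fibre r.map.onSimplex σ),
          Controlled.entry ((Ψ.app C).hom.f n) σ τ ≫
              assembleπ r.map.onSimplex (((r.Sd Kind.lower 𝒜).obj C).obj.X n) ρ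
            = r.inclusion C.obj.X n ρ.1 τ) ∧
        ∀ C, IsChainEquiv (Ψ.app C))) ∧
    (∀ (X' : FLComplex.{u}) (h : Iterated X X'),
      (∃ Φ : h.Sd Kind.upper 𝒜 ⋙ assembly Kind.upper h.map 𝒜 ⟶ 𝟭 (FinComplex (Ctrl Kind.upper X 𝒜)),
        ∀ C, IsChainEquiv (Φ.app C)) ∧
      (∃ Ψ : 𝟭 (FinComplex (Ctrl Kind.lower X 𝒜)) ⟶ h.Sd Kind.lower 𝒜 ⋙ assembly Kind.lower h.map 𝒜,
        ∀ C, IsChainEquiv (Ψ.app C))) := by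
  refine ⟨fun S r => ⟨⟨r.upperEquivalence 𝒜, ?_, ?_⟩, ⟨r.lowerEquivalence 𝒜, ?_, ?_⟩⟩,
    fun X' h => ⟨h.exists_equivalence_upper 𝒜, h.exists_equivalence_lower 𝒜⟩⟩
  · exact r.ι_upperEquivalence 𝒜
  · exact r.isChainEquiv_upperEquivalence 𝒜
  · exact r.lowerEquivalence_π 𝒜
  · exact r.isChainEquiv_lowerEquivalence 𝒜
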